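/- Let $\Theta$ be a (possibly unbounded) positive, boundedly invertible self-adjoint operator on a separable complex Hilbert space $\mathcal H$. For $s\in\mathbb R$ let $\mathcal H^s$ be the completion of $\operatorname{dom}\Theta^s$ in the norm $\|\xi\|_s=\|\Theta^s\xi\|$, and let $\mathcal H^\infty=\bigcap_{s\ge 0}\operatorname{dom}\Theta^s$. For $r\in\mathbb R$ let $\operatorname{op}^r(\Theta)$ be the set of linear maps $A:\mathcal H^\infty\to\mathcal H^\infty$ that extend to a continuous operator $\mathcal H^{s+r}\to\mathcal H^s$ for every $s\in\mathbb R$; an unbounded operator $T$ on $\mathcal H$ is said to belong to $\operatorname{op}^r(\Theta)$ if $\mathcal H^\infty\subseteq\operatorname{dom}T$, $T(\mathcal H^\infty)\subseteq\mathcal H^\infty$ and $T|_{\mathcal H^\infty}\in\operatorname{op}^r(\Theta)$. An operator $A\in\operatorname{op}^r(\Theta)$ is $\Theta$-elliptic if there is $P\in\operatorname{op}^{-r}(\Theta)$ such that $AP-1$ and $PA-1$ lie in $\bigcap_{t\in\mathbb R}\operatorname{op}^t(\Theta)$. Let $r>0$ and let $A\in\operatorname{op}^r(\Theta)$ be $\Theta$-elliptic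 and symmetric, that is, $\langle Ax,y\rangle=\langle x,Ay\rangle$ for $x,y\in\mathcal H^\infty$. Then the continuous extension $\overline A^{r,0}:\mathcal H^r\to\mathcal H$, regarded as an unbounded operator on $\mathcal H$ with domain $\mathcal H^r=\operatorname{dom}\Theta^r$, is self-adjoint and so has a spectral measure $E$ on the Borel sets of $\mathbb R$. Let $\beta\in\mathbb R$, and for Borel measurable $f:\mathbb R\to\mathbb C$ let $\|f\|_{L^\beta_\infty(E)}$ denote the essential supremum of $x\mapsto|f(x)|\,(1+x^2)^{-\beta/2}$ with respect to $E$. If $\|f\|_{L^\beta_\infty(E)}<\infty$, then the operator $f(A):=f(\overline A^{r,0})=\int f\,dE$ given by the Borel functional calculus belongs to $\operatorname{op}^{\beta r}(\Theta)$. Moreover, for every $s\in\mathbb R$ there is a constant $C$, depending on $s$, $\beta$ and $A$ (and on $\Theta$, $r$) but not on $f$, such that $$\|f(A)\|_{\mathcal H^{s+\beta r}\to\mathcal H^s}\le C\,\|f\|_{L^\beta_\infty(E)}$$ for all such $f$. -/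

import Mathlib

open MeasureTheory Filter Topology
open scoped InnerProductSpace ENNReal

noncomputable section

/-! ### Spectral measures on the real line and the Borel functional calculus -/

/-- A spectral measure (projection-valued measure) on the Borel sets of `ℝ`, with values in the
orthogonal projections of the Hilbert space `H`: it is countably additive in the strong operator
topology and has total mass `1`. -/
structure SpectralMeasure (H : Type*) [NormedAddCommGroup H] [InnerProductSpace ℂ H]
    [CompleteSpace H] where
  /-- The projection attached to a Borel set (irrelevant on sets that are not Borel). -/
  proj : Set ℝ → H →L[ℂ] H
  isStarProjection : ∀ S, MeasurableSet S → IsStarProjection (proj S)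
  proj_univ : proj Set.univ = 1
  hasSum_iUnion : ∀ S : ℕ → Set ℝ, (∀ n, MeasurableSet (S n)) →
    Pairwise (fun m n => Disjoint (S m) (S n)) →
    ∀ x : H, HasSum (fun n => proj (S n) x) (proj (⋃ n, S n) x)

namespace SpectralMeasure

variable {H : Type*} [NormedAddCommGroup H] [InnerProductSpace ℂ H] [CompleteSpace H]
variable (E : SpectralMeasure H)

theorem proj_empty (x : H) : E.proj ∅ x = 0 := by
  have h := E.hasSum_iUnion (fun _ => ∅) (fun _ => MeasurableSet.empty)
    (fun _ _ _ => disjoint_bot_left) x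
  simpa [summable_const_iff] using h.summable

theorem proj_union {S T : Set ℝ} (hS : MeasurableSet S) (hT : MeasurableSet T)
    (hST : Disjoint S T) : E.proj (S ∪ T) = E.proj S + E.proj T := by
  ext x
  let U : ℕ → Set ℝ := fun n => if n = 0 then S else if n = 1 then T else ∅
  have hU0 : U 0 = S := rfl
  have hU1 : U 1 = T := rfl
  have hU2 : ∀ n, 2 ≤ n → U n = ∅ := fun n hn => by
    simp only [U]; rw [if_neg (by omega), if_neg (by omega)]
  have hm : ∀ n, MeasurableSet (U n) := fun n => by
    simp only [U]; split_ifs <;> simp [*]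
  have hd : Pairwise (fun m n => Disjoint (U m) (U n)) := by
    intro m n hmn
    simp only [U]
    split_ifs <;> first | omega | simp_all [disjoint_comm]
  have hun : (⋃ n, U n) = S ∪ T := by
    ext t
    simp only [Set.mem_iUnion, Set.mem_union]
    constructor
    · rintro ⟨n, hn⟩
      rcases n with _ | _ | n
      · exact Or.inl hn
      · exact Or.inr hn
      · rw [hU2 _ (by omega)] at hn; exact hn.elim
    · rintro (h | h)
      · exact ⟨0, h⟩
      · exact ⟨1, h⟩
  have h := E.hasSum_iUnion U hm hd x
  rw [hun] at h
  have h2 : HasSum (fun n => E.proj (U n) x) (∑ n ∈ Finset.range 2, E.proj (U n) x) :=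
    hasSum_sum_of_ne_finset_zero (fun n hn => by
      rw [hU2 n (by simp at hn; omega), E.proj_empty])
  rw [h.unique h2]
  simp [Finset.sum_range_succ, hU0, hU1]

theorem inner_proj_self {S : Set ℝ} (hS : MeasurableSet S) (x : H) :
    (⟪E.proj S x, x⟫_ℂ).re = ‖E.proj S x‖ ^ 2 := by
  have h1 := (E.isStarProjection S hS).isIdempotentElem
  have h2 := (E.isStarProjection S hS).isSelfAdjoint
  have h3 : E.proj S x = E.proj S (E.proj S x) := by
    conv_lhs => rw [← h1.eq]
    rfl
  have h4 : ⟪E.proj S x, x⟫_ℂ = ⟪E.proj S x, E.proj S x⟫_ℂ := by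
    conv_lhs => rw [h3]
    exact h2.isSymmetric _ _
  rw [h4]
  exact inner_self_eq_norm_sq (𝕜 := ℂ) _

theorem inner_proj_of_disjoint {S T : Set ℝ} (hS : MeasurableSet S) (hT : MeasurableSet T)
    (hST : Disjoint S T) (x y : H) : ⟪E.proj S x, E.proj T y⟫_ℂ = 0 := by
  have hs := E.isStarProjection S hS
  have ht := E.isStarProjection T hT
  have hu := (E.isStarProjection _ (hS.union hT)).isIdempotentElem
  rw [E.proj_union hS hT hST] at hu
  have h0 : E.proj S * E.proj T + E.proj T * E.proj S = 0 := by
    have := hu.eq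
    have e1 := hs.isIdempotentElem.eq
    have e2 := ht.isIdempotentElem.eq
    rw [add_mul, mul_add, mul_add, e1, e2] at this
    have e3 : E.proj S + E.proj T + (E.proj S * E.proj T + E.proj T * E.proj S)
        = E.proj S + E.proj T := by
      refine Eq.trans ?_ this
      abel
    simpa using e3
  have h1 : E.proj S * E.proj T = 0 := by
    have e1 := hs.isIdempotentElem.eq
    have a1 : E.proj S * E.proj T + E.proj S * E.proj T * E.proj S = 0 := by
      have := congrArg (fun z => E.proj S * z) h0
      simpa [mul_add, ← mul_assoc, e1] using this
    have a2 : E.proj S * E.proj T * E.proj S + E.proj S * E.proj T * E.proj S = 0 := by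
      have := congrArg (fun z => z * E.proj S) a1
      simpa [add_mul, mul_assoc, e1] using this
    have a3 : E.proj S * E.proj T * E.proj S = 0 := by
      have : (2 : ℂ) • (E.proj S * E.proj T * E.proj S) = 0 := by rw [two_smul]; exact a2
      simpa using this
    rw [a3, add_zero] at a1
    exact a1
  refine (hs.isSelfAdjoint.isSymmetric x (E.proj T y)).trans ?_
  change ⟪x, E.proj S (E.proj T y)⟫_ℂ = 0
  have : E.proj S (E.proj T y) = (E.proj S * E.proj T) y := rfl
  rw [this, h1]
  simp

/-- The finite scalar measure `S ↦ ‖E(S) x‖ ^ 2 = ⟪E(S) x, x⟫`. -/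
def scalar (x : H) : Measure ℝ :=
  Measure.ofMeasurable (fun S _ => ENNReal.ofReal (‖E.proj S x‖ ^ 2))
    (by simp [E.proj_empty])
    (by
      intro S hS hd
      have h := E.hasSum_iUnion S hS hd x
      have h1 : HasSum (fun n => ‖E.proj (S n) x‖ ^ 2) (‖E.proj (⋃ n, S n) x‖ ^ 2) := by
        have h2 := (h.mapL ((innerSL ℂ x))).mapL Complex.reCLM
        rw [← E.inner_proj_self (MeasurableSet.iUnion hS)]
        simp_rw [← E.inner_proj_self (hS _)]
        convert h2 using 1
        · ext n
          exact inner_re_symm (𝕜 := ℂ) _ _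
        · exact inner_re_symm (𝕜 := ℂ) _ _
      rw [← h1.tsum_eq]
      exact ENNReal.ofReal_tsum_of_nonneg (fun n => by positivity) h1.summable)

theorem scalar_apply (x : H) {S : Set ℝ} (hS : MeasurableSet S) :
    E.scalar x S = ENNReal.ofReal (‖E.proj S x‖ ^ 2) :=
  Measure.ofMeasurable_apply S hS

instance (x : H) : IsFiniteMeasure (E.scalar x) :=
  ⟨by rw [E.scalar_apply x MeasurableSet.univ]; exact ENNReal.ofReal_lt_top⟩

theorem scalar_add_le (x y : H) :
    E.scalar (x + y) ≤ (2 : ℝ≥0∞) • (E.scalar x + E.scalar y) := by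
  refine Measure.le_iff.2 fun S hS => ?_
  simp only [Measure.smul_apply, Measure.add_apply, E.scalar_apply _ hS, smul_eq_mul]
  rw [← ENNReal.ofReal_add (by positivity) (by positivity),
    show (2 : ℝ≥0∞) = ENNReal.ofReal 2 by simp, ← ENNReal.ofReal_mul (by norm_num)]
  refine ENNReal.ofReal_le_ofReal ?_
  rw [map_add]
  have h := norm_add_le (E.proj S x) (E.proj S y)
  nlinarith [sq_nonneg (‖E.proj S x‖ - ‖E.proj S y‖), norm_nonneg (E.proj S x + E.proj S y)]

theorem scalar_smul (c : ℂ) (x : H) :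
    E.scalar (c • x) = ENNReal.ofReal (‖c‖ ^ 2) • E.scalar x := by
  refine Measure.ext fun S hS => ?_
  simp only [Measure.smul_apply, E.scalar_apply _ hS, smul_eq_mul]
  rw [← ENNReal.ofReal_mul (by positivity), map_smul, norm_smul, mul_pow]

/-- The integral `∑ c, c • E(φ⁻¹{c})` of a simple function. -/
def simpleIntegral (φ : SimpleFunc ℝ ℂ) : H →L[ℂ] H :=
  ∑ c ∈ φ.range, c • E.proj (φ ⁻¹' {c})

theorem simpleIntegral_sub (φ ψ : SimpleFunc ℝ ℂ) :
    E.simpleIntegral (φ - ψ) = E.simpleIntegral φ - E.simpleIntegral ψ := by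
  ext x
  let T : Set ℝ → ℂ →L[ℝ] H := fun S =>
    ((ContinuousLinearMap.id ℂ ℂ).smulRight (E.proj S x)).restrictScalars ℝ
  have hT : FinMeasAdditive (E.scalar x) T := by
    intro S S' hS hS' _ _ hd
    ext1; simp [T, E.proj_union hS hS' hd]
  have key : ∀ χ : SimpleFunc ℝ ℂ, E.simpleIntegral χ x = χ.setToSimpleFunc T := by
    intro χ
    simp [simpleIntegral, SimpleFunc.setToSimpleFunc, T]
  have hint : ∀ χ : SimpleFunc ℝ ℂ, Integrable χ (E.scalar x) :=
    fun χ => SimpleFunc.integrable_of_isFiniteMeasure χ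
  rw [sub_apply, key, key, key,
    SimpleFunc.setToSimpleFunc_sub T hT (hint φ) (hint ψ)]

theorem enorm_simpleIntegral (φ : SimpleFunc ℝ ℂ) (x : H) :
    ‖E.simpleIntegral φ x‖ₑ = eLpNorm φ 2 (E.scalar x) := by
  have hm : ∀ c, MeasurableSet (φ ⁻¹' {c}) := fun c => φ.measurableSet_fiber c
  have h1 : ‖E.simpleIntegral φ x‖ ^ 2
      = ∑ c ∈ φ.range, ‖c‖ ^ 2 * ‖E.proj (φ ⁻¹' {c}) x‖ ^ 2 := by
    have e : E.simpleIntegral φ x = ∑ c ∈ φ.range, c • E.proj (φ ⁻¹' {c}) x := by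
      simp [simpleIntegral]
    rw [e, ← inner_self_eq_norm_sq (𝕜 := ℂ), sum_inner, map_sum]
    refine Finset.sum_congr rfl fun c hc => ?_
    rw [inner_sum, Finset.sum_eq_single c]
    · rw [inner_self_eq_norm_sq (𝕜 := ℂ), norm_smul, mul_pow]
    · intro d _ hdc
      rw [inner_smul_left, inner_smul_right, E.inner_proj_of_disjoint (hm c) (hm d)]
      · simp
      · exact Disjoint.preimage _ (by simpa using hdc.symm)
    · exact fun h => (h hc).elim
  have h2 : ∫⁻ t, ‖φ t‖ₑ ^ (2 : ℝ) ∂(E.scalar x) = ‖E.simpleIntegral φ x‖ₑ ^ (2 : ℝ) := by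
    have e : ∀ t, ‖φ t‖ₑ ^ (2 : ℝ) = φ.map (fun c => ‖c‖ₑ ^ (2 : ℝ)) t := fun t => rfl
    simp_rw [e]
    rw [(φ.map fun c => ‖c‖ₑ ^ (2 : ℝ)).lintegral_eq_lintegral, SimpleFunc.map_lintegral]
    simp_rw [E.scalar_apply x (hm _), ENNReal.rpow_ofNat, ← ofReal_norm,
      ← ENNReal.ofReal_pow (norm_nonneg _), ← ENNReal.ofReal_mul (sq_nonneg _)]
    rw [h1, ENNReal.ofReal_sum_of_nonneg (fun c _ => by positivity)]
  rw [eLpNorm_eq_lintegral_rpow_enorm_toReal (by norm_num) (by norm_num)]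
  simp only [ENNReal.toReal_ofNat]
  rw [h2, ← ENNReal.rpow_mul]
  norm_num

/-- Simple functions converging pointwise to `f`, dominated by `2 * ‖f‖`. -/
def approx (f : ℝ → ℂ) (hf : Measurable f) (n : ℕ) : SimpleFunc ℝ ℂ :=
  SimpleFunc.approxOn f hf Set.univ 0 (Set.mem_univ 0) n

theorem tendsto_simpleIntegral (f : ℝ → ℂ) (hf : Measurable f) {x : H}
    (hx : MemLp f 2 (E.scalar x)) :
    Tendsto (fun n => E.simpleIntegral (approx f hf n) x) atTop
      (𝓝 (limUnder atTop (fun n => E.simpleIntegral (approx f hf n) x))) := by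
  have h0 : Tendsto (fun n => eLpNorm (⇑(approx f hf n) - f) 2 (E.scalar x)) atTop (𝓝 0) :=
    SimpleFunc.tendsto_approxOn_Lp_eLpNorm hf (Set.mem_univ 0) (by norm_num) (by simp)
      (by simpa using hx.2)
  have hc : CauchySeq (fun n => E.simpleIntegral (approx f hf n) x) := by
    rw [EMetric.cauchySeq_iff]
    intro ε hε
    obtain ⟨N, hN⟩ := eventually_atTop.1 (h0.eventually_lt_const (ENNReal.half_pos hε.ne'))
    refine ⟨N, fun m hm n hn => ?_⟩
    have hmeas : ∀ k, AEStronglyMeasurable (⇑(approx f hf k) - f) (E.scalar x) := fun k =>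
      (approx f hf k).aestronglyMeasurable.sub hf.aestronglyMeasurable
    rw [edist_eq_enorm_sub, ← sub_apply, ← E.simpleIntegral_sub, E.enorm_simpleIntegral]
    have e : ⇑(approx f hf m - approx f hf n)
        = (⇑(approx f hf m) - f) - (⇑(approx f hf n) - f) := by
      rw [SimpleFunc.coe_sub]; abel
    rw [e]
    calc _ ≤ _ := eLpNorm_sub_le (hmeas m) (hmeas n) (by norm_num)
      _ < ε / 2 + ε / 2 := ENNReal.add_lt_add (hN m hm) (hN n hn)
      _ = ε := ENNReal.add_halves ε
  obtain ⟨y, hy⟩ := cauchySeq_tendsto_of_complete hc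
  exact hy.limUnder_eq.symm ▸ hy

theorem memLp_add (f : ℝ → ℂ) (hf : Measurable f) {x y : H} (hx : MemLp f 2 (E.scalar x))
    (hy : MemLp f 2 (E.scalar y)) : MemLp f 2 (E.scalar (x + y)) := by
  have h : MemLp f 2 (E.scalar x + E.scalar y) := by
    refine ⟨hf.aestronglyMeasurable, ?_⟩
    have h1 := hx.2
    have h2 := hy.2
    rw [eLpNorm_lt_top_iff_lintegral_rpow_enorm_lt_top (by norm_num) (by norm_num)] at h1 h2 ⊢
    rw [lintegral_add_measure]
    exact ENNReal.add_lt_top.2 ⟨h1, h2⟩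
  exact (h.smul_measure (by norm_num : (2 : ℝ≥0∞) ≠ ∞)).mono_measure (E.scalar_add_le x y)

/-- The Borel functional calculus: the (in general unbounded) operator `∫ f dE`. Its domain
consists of the `x` with `∫ |f| ^ 2 d⟪E x, x⟫ < ∞`, and its value at such an `x` is the limit of the
integrals of simple functions that converge to `f` in `L²(⟪E x, x⟫)`. -/
def integral (f : ℝ → ℂ) (hf : Measurable f) : H →ₗ.[ℂ] H where
  domain :=
    { carrier := {x | MemLp f 2 (E.scalar x)}
      zero_mem' := by
        have h : E.scalar 0 = 0 := by
          have := E.scalar_smul 0 0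
          simpa using this
        simp [h]
      add_mem' := fun hx hy => E.memLp_add f hf hx hy
      smul_mem' := fun c x hx => by
        change MemLp f 2 (E.scalar (c • x))
        rw [E.scalar_smul]
        exact MemLp.smul_measure hx ENNReal.ofReal_ne_top }
  toFun :=
    { toFun := fun x => limUnder atTop (fun n => E.simpleIntegral (approx f hf n) (x : H))
      map_add' := fun x y => by
        refine Tendsto.limUnder_eq ?_
        simpa using (E.tendsto_simpleIntegral f hf x.2).add (E.tendsto_simpleIntegral f hf y.2)
      map_smul' := fun c x => by
        refine Tendsto.limUnder_eq ?_
        simpa using (E.tendsto_simpleIntegral f hf x.2).const_smul c }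

/-- `E` is the spectral measure of the operator `T`: `T = ∫ t dE(t)`, including domains. -/
def IsSpectralMeasureOf (T : H →ₗ.[ℂ] H) : Prop :=
  E.integral (fun t : ℝ => (t : ℂ)) Complex.measurable_ofReal = T

/-- The set of the essential bounds of `t ↦ f t * ⟨t⟩ ^ (-β)` with respect to `E`, where
`⟨t⟩ = (1 + t ^ 2) ^ (1 / 2)`. -/
def essBounds (β : ℝ) (f : ℝ → ℂ) : Set ℝ :=
  {y | 0 ≤ y ∧ E.proj {t | y < ‖f t‖ * (1 + t ^ 2) ^ (-β / 2)} = 0}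

/-- `f ∈ L^β_∞(E)`: the function `f⟨t⟩ ^ (-β)` is essentially bounded with respect to `E`. -/
def MemLinfty (β : ℝ) (f : ℝ → ℂ) : Prop :=
  (E.essBounds β f).Nonempty

/-- The norm of `L^β_∞(E)`: the essential supremum of `|f|⟨t⟩ ^ (-β)` with respect to `E`. -/
def linftyNorm (β : ℝ) (f : ℝ → ℂ) : ℝ :=
  sInf (E.essBounds β f)

end SpectralMeasure

/-! ### The Sobolev scale of a positive invertible operator -/

namespace Sobolev

variable {H : Type*} [NormedAddCommGroup H] [InnerProductSpace ℂ H] [CompleteSpace H]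

/-- `B` is the bounded everywhere defined inverse of the unbounded operator `Θ`. -/
def IsBoundedInverse (Θ : H →ₗ.[ℂ] H) (B : H →L[ℂ] H) : Prop :=
  (∀ x : Θ.domain, B (Θ x) = x) ∧ ∀ y : H, ∃ h : B y ∈ Θ.domain, Θ ⟨B y, h⟩ = y

open Classical in
/-- The bounded inverse `Θ⁻¹`, for `Θ` boundedly invertible (and `0` otherwise). -/
def boundedInverse (Θ : H →ₗ.[ℂ] H) : H →L[ℂ] H :=
  if h : ∃ B, IsBoundedInverse Θ B then h.choose else 0

open Classical in
/-- The real powers of a positive boundedly invertible self-adjoint operator `Θ`. For `s ≤ 0`,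
`Θ ^ s` is the bounded operator `(Θ⁻¹) ^ (-s)` given by the continuous functional calculus of
`Θ⁻¹ ≥ 0`; for `s > 0`, `Θ ^ s` is the unbounded inverse of the injective operator `(Θ⁻¹) ^ s`. -/
def power (Θ : H →ₗ.[ℂ] H) (s : ℝ) : H →ₗ.[ℂ] H :=
  if s ≤ 0 then (boundedInverse Θ ^ (-s) : H →L[ℂ] H).toLinearMap.toPMap ⊤
  else ((boundedInverse Θ ^ s : H →L[ℂ] H).toLinearMap.toPMap ⊤).inverse

theorem power_domain_of_nonpos (Θ : H →ₗ.[ℂ] H) {s : ℝ} (hs : s ≤ 0) :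
    (power Θ s).domain = ⊤ := by
  rw [power, if_pos hs, LinearMap.toPMap_domain]

/-- `dom Θ ^ s`, to be equipped with the norm `‖Θ ^ s x‖`. -/
def PreSpace (Θ : H →ₗ.[ℂ] H) (s : ℝ) : Type _ := (power Θ s).domain

instance (Θ : H →ₗ.[ℂ] H) (s : ℝ) : AddCommGroup (PreSpace Θ s) :=
  inferInstanceAs (AddCommGroup (power Θ s).domain)

instance (Θ : H →ₗ.[ℂ] H) (s : ℝ) : Module ℂ (PreSpace Θ s) :=
  inferInstanceAs (Module ℂ (power Θ s).domain)

/-- The linear map `x ↦ Θ ^ s x` on `dom Θ ^ s`. -/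
def PreSpace.toH (Θ : H →ₗ.[ℂ] H) (s : ℝ) : PreSpace Θ s →ₗ[ℂ] H := (power Θ s).toFun

/-- The norm `‖x‖_s = ‖Θ ^ s x‖` on `dom Θ ^ s`. -/
instance (Θ : H →ₗ.[ℂ] H) (s : ℝ) : SeminormedAddCommGroup (PreSpace Θ s) :=
  SeminormedAddCommGroup.induced _ _ (PreSpace.toH Θ s)

instance (Θ : H →ₗ.[ℂ] H) (s : ℝ) : NormedSpace ℂ (PreSpace Θ s) :=
  NormedSpace.induced ℂ _ _ (PreSpace.toH Θ s)

/-- The Sobolev space `H^s(Θ)`: the completion of `dom Θ ^ s` in the norm `‖Θ ^ s x‖`. -/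
abbrev Space (Θ : H →ₗ.[ℂ] H) (s : ℝ) : Type _ := UniformSpace.Completion (PreSpace Θ s)

/-- `H^∞(Θ)`, the intersection of the domains of all `Θ ^ s`, `s ≥ 0`. -/
def smooth (Θ : H →ₗ.[ℂ] H) : Submodule ℂ H :=
  ⨅ s : ℝ, ⨅ _ : 0 ≤ s, (power Θ s).domain

theorem smooth_le_domain (Θ : H →ₗ.[ℂ] H) (s : ℝ) : smooth Θ ≤ (power Θ s).domain := by
  rcases le_or_gt s 0 with hs | hs
  · rw [power_domain_of_nonpos Θ hs]
    exact le_top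
  · exact iInf₂_le s hs.le

/-- The inclusion of `H^∞(Θ)` in `dom Θ ^ s`. -/
def toPreSpace (Θ : H →ₗ.[ℂ] H) (s : ℝ) : smooth Θ →ₗ[ℂ] PreSpace Θ s :=
  Submodule.inclusion (smooth_le_domain Θ s)

/-- The inclusion of `H^∞(Θ)` in `H^s(Θ)`. -/
def toSpace (Θ : H →ₗ.[ℂ] H) (s : ℝ) (x : smooth Θ) : Space Θ s :=
  (toPreSpace Θ s x : PreSpace Θ s)

/-- The continuous operator `T : H^t(Θ) → H^s(Θ)` extends `A : H^∞(Θ) → H^∞(Θ)`. -/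
def Extends (Θ : H →ₗ.[ℂ] H) {t s : ℝ} (T : Space Θ t →L[ℂ] Space Θ s)
    (A : smooth Θ →ₗ[ℂ] smooth Θ) : Prop :=
  ∀ x, T (toSpace Θ t x) = toSpace Θ s (A x)

/-- `A ∈ op^r(Θ)`: for every real `s`, the operator `A` on `H^∞(Θ)` extends to a continuous
operator from `H^(s+r)(Θ)` to `H^s(Θ)`. -/
def IsOp (Θ : H →ₗ.[ℂ] H) (r : ℝ) (A : smooth Θ →ₗ[ℂ] smooth Θ) : Prop :=
  ∀ s : ℝ, ∃ T : Space Θ (s + r) →L[ℂ] Space Θ s, Extends Θ T A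

/-- `A ∈ op^(-∞)(Θ)`. -/
def IsSmoothing (Θ : H →ₗ.[ℂ] H) (A : smooth Θ →ₗ[ℂ] smooth Θ) : Prop :=
  ∀ t : ℝ, IsOp Θ t A

/-- `A` is `Θ`-elliptic of order `r`: it has a two-sided parametrix of order `-r`. -/
def IsElliptic (Θ : H →ₗ.[ℂ] H) (r : ℝ) (A : smooth Θ →ₗ[ℂ] smooth Θ) : Prop :=
  ∃ P : smooth Θ →ₗ[ℂ] smooth Θ, IsOp Θ (-r) P ∧
    IsSmoothing Θ (A ∘ₗ P - LinearMap.id) ∧ IsSmoothing Θ (P ∘ₗ A - LinearMap.id)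

/-- The unbounded operator on `H` with domain `H^r(Θ) = dom Θ ^ r` (for `r ≥ 0`) that is the
extension by continuity, from `H^∞(Θ)` to `H^r(Θ)`, of `A : H^∞(Θ) → H^∞(Θ) ⊆ H`. -/
def extensionOp (Θ : H →ₗ.[ℂ] H) (r : ℝ) (A : smooth Θ →ₗ[ℂ] smooth Θ) : H →ₗ.[ℂ] H where
  domain := (power Θ r).domain
  toFun := (((smooth Θ).subtype ∘ₗ A).extendOfNorm (toPreSpace Θ r) :
    PreSpace Θ r →L[ℂ] H).toLinearMap

/-- The unbounded operator `T` on `H` is defined on `H^∞(Θ)`, and restricts there to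
`A : H^∞(Θ) → H^∞(Θ)`. -/
def RestrictsTo (Θ : H →ₗ.[ℂ] H) (T : H →ₗ.[ℂ] H) (A : smooth Θ →ₗ[ℂ] smooth Θ) : Prop :=
  ∀ x : smooth Θ, ∃ h : (x : H) ∈ T.domain, T ⟨x, h⟩ = A x

end Sobolev

end

/-!
Let `T` be the extension of `A` to `dom Θ ^ r`, and `⟨T⟩ = (1 + T ^ 2) ^ (1 / 2)`. The theorem holds
because the operators `⟨T⟩ ^ σ` and `Θ ^ (σ r)` define equivalent norms on the smooth vectors, for
every real `σ`. In the scale of the norms `‖⟨T⟩ ^ σ x‖` the estimate for `f(T)` is the trivial one: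
`f(T)` commutes with `⟨T⟩ ^ σ`, and `|f| ≤ M ⟨t⟩ ^ β` almost everywhere gives
`‖⟨T⟩ ^ σ f(T) x‖ ≤ M ‖⟨T⟩ ^ (σ + β) x‖`. Moreover a vector in the domains of all `⟨T⟩ ^ σ` is
smooth, so that `f(T)` preserves the smooth vectors (`exists_restrictsTo_integral`).

The equivalence of norms is proved for the bounded negative powers. Write `B = Θ⁻¹`.
* For `σ = 2 j` even, `‖B ^ (2 j r) u‖ ≤ C ‖⟨T⟩ ^ (-2 j) u‖` follows by duality from
  `(1 + A ^ 2) ^ j` having order `2 j r`. The converse is elliptic regularity: if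
  `y = ⟨T⟩ ^ (-2 j) w`, then `y` and `z = T ^ (2 j) y` have norm at most `‖w‖`, and
  `⟪z, x⟫ = ⟪y, A ^ (2 j) x⟫` for smooth `x`. With a parametrix `P` of `A` and
  `x = P ^ (2 j) Θ ^ (2 j r) v`, for which `A ^ (2 j) x` is `Θ ^ (2 j r) v` up to a smoothing
  operator applied to it, this bounds `⟪y, Θ ^ (2 j r) v⟫` by `C ‖w‖ ‖v‖`, so that `y` is in the
  domain of `Θ ^ (2 j r)` (`exists_rpow_eq_of_weak_solution`).
* For general `σ ≥ 0` the inequalities follow by interpolation, that is, by the Heinz inequality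
  (`exists_norm_rpow_le`), an instance of the operator monotonicity of `t ↦ t ^ θ`, `0 ≤ θ ≤ 1`.

The same regularity argument for `A` instead of `A ^ (2 j)` shows that `T` is self-adjoint. The
spectral theorem for `T` is derived from the continuous functional calculus of the normal operator
`(T + i)⁻¹` and the Riesz–Markov–Kakutani theorem (`SelfAdjointOperator.exists_spectralMeasure`).
-/

noncomputable section

namespace SpectralMeasure

variable {H : Type*} [NormedAddCommGroup H] [InnerProductSpace ℂ H] [CompleteSpace H]
variable (E : SpectralMeasure H)

/-! ### Calculus with the integrals of a spectral measure -/

theorem proj_apply_of_disjoint {S T : Set ℝ} (hS : MeasurableSet S) (hT : MeasurableSet T)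
    (hST : Disjoint S T) (x : H) : E.proj S (E.proj T x) = 0 := by
  refine ext_inner_left ℂ fun y => ?_
  have h := (E.isStarProjection S hS).isSelfAdjoint.isSymmetric y (E.proj T x)
  rw [inner_zero_right]
  exact h.symm.trans (E.inner_proj_of_disjoint hS hT hST y x)

theorem proj_proj {S T : Set ℝ} (hS : MeasurableSet S) (hT : MeasurableSet T) (x : H) :
    E.proj S (E.proj T x) = E.proj (S ∩ T) x := by
  have h1 : E.proj S = E.proj (S ∩ T) + E.proj (S \ T) := by
    rw [← E.proj_union (hS.inter hT) (hS.diff hT)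
      (Set.disjoint_sdiff_right.mono_left Set.inter_subset_right), Set.inter_union_sdiff]
  have h2 : E.proj T = E.proj (S ∩ T) + E.proj (T \ S) := by
    rw [← E.proj_union (hS.inter hT) (hT.diff hS)
      (Set.disjoint_sdiff_right.mono_left Set.inter_subset_left), Set.inter_comm,
      Set.inter_union_sdiff]
  have h3 : E.proj (S \ T) (E.proj T x) = 0 :=
    E.proj_apply_of_disjoint (hS.diff hT) hT Set.disjoint_sdiff_left x
  have h4 : E.proj (S ∩ T) (E.proj (T \ S) x) = 0 :=
    E.proj_apply_of_disjoint (hS.inter hT) (hT.diff hS)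
      (Set.disjoint_sdiff_right.mono_left Set.inter_subset_left) x
  have h5 : E.proj (S ∩ T) (E.proj (S ∩ T) x) = E.proj (S ∩ T) x :=
    DFunLike.congr_fun (E.isStarProjection _ (hS.inter hT)).isIdempotentElem.eq x
  rw [h1, add_apply, h3, add_zero, h2, add_apply, map_add, h4, add_zero, h5]

theorem proj_simpleIntegral {S : Set ℝ} (hS : MeasurableSet S) (φ : SimpleFunc ℝ ℂ) (x : H) :
    E.proj S (E.simpleIntegral φ x) = E.simpleIntegral φ (E.proj S x) := by
  simp only [simpleIntegral, _root_.sum_apply, smul_apply, map_sum, map_smul]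
  refine Finset.sum_congr rfl fun c _ => ?_
  rw [E.proj_proj hS (φ.measurableSet_fiber c), E.proj_proj (φ.measurableSet_fiber c) hS,
    Set.inter_comm]

theorem scalar_proj {S : Set ℝ} (hS : MeasurableSet S) (x : H) :
    E.scalar (E.proj S x) = (E.scalar x).restrict S := by
  refine Measure.ext fun T hT => ?_
  rw [Measure.restrict_apply hT, E.scalar_apply _ hT, E.scalar_apply _ (hT.inter hS),
    E.proj_proj hT hS]

theorem scalar_univ (x : H) : E.scalar x Set.univ = ENNReal.ofReal (‖x‖ ^ 2) := by
  rw [E.scalar_apply x MeasurableSet.univ, E.proj_univ, one_apply_eq_self]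

/-- The value `(∫ f dE) x` as a function of all `x`. It is meaningful if `f` is square integrable
with respect to `E.scalar x`, and a junk value otherwise. -/
def integralAt {f : ℝ → ℂ} (hf : Measurable f) (x : H) : H :=
  limUnder atTop (fun n => E.simpleIntegral (approx f hf n) x)

variable {f g : ℝ → ℂ} {x y : H}

theorem integral_apply (hf : Measurable f) (x : (E.integral f hf).domain) :
    E.integral f hf x = E.integralAt hf (x : H) := rfl

theorem tendsto_eLpNorm_approx (hf : Measurable f) (hx : MemLp f 2 (E.scalar x)) :
    Tendsto (fun n => eLpNorm (⇑(approx f hf n) - f) 2 (E.scalar x)) atTop (𝓝 0) :=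
  SimpleFunc.tendsto_approxOn_Lp_eLpNorm hf (Set.mem_univ 0) (by norm_num) (by simp)
    (by simpa using hx.2)

/-- Every sequence of simple functions converging to `f` in `L²(⟪E x, x⟫)` computes `(∫ f dE) x`. -/
theorem tendsto_integralAt (hf : Measurable f) (hx : MemLp f 2 (E.scalar x))
    {φ : ℕ → SimpleFunc ℝ ℂ}
    (hφ : Tendsto (fun n => eLpNorm (⇑(φ n) - f) 2 (E.scalar x)) atTop (𝓝 0)) :
    Tendsto (fun n => E.simpleIntegral (φ n) x) atTop (𝓝 (E.integralAt hf x)) := by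
  have h1 := E.tendsto_simpleIntegral f hf hx
  have h2 : Tendsto (fun n => E.simpleIntegral (φ n) x - E.simpleIntegral (approx f hf n) x)
      atTop (𝓝 0) := by
    rw [tendsto_zero_iff_enorm_tendsto_zero]
    have h3 := hφ.add (E.tendsto_eLpNorm_approx hf hx)
    rw [add_zero] at h3
    refine tendsto_of_tendsto_of_tendsto_of_le_of_le tendsto_const_nhds h3 (fun _ => bot_le)
      fun n => ?_
    simp only
    rw [← sub_apply, ← E.simpleIntegral_sub, E.enorm_simpleIntegral]
    have e : ⇑(φ n - approx f hf n) = (⇑(φ n) - f) - (⇑(approx f hf n) - f) := by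
      rw [SimpleFunc.coe_sub]; abel
    rw [e]
    exact eLpNorm_sub_le ((φ n).aestronglyMeasurable.sub hf.aestronglyMeasurable)
      ((approx f hf n).aestronglyMeasurable.sub hf.aestronglyMeasurable) (by norm_num)
  simpa [integralAt] using h2.add h1

theorem enorm_integralAt (hf : Measurable f) (hx : MemLp f 2 (E.scalar x)) :
    ‖E.integralAt hf x‖ₑ = eLpNorm f 2 (E.scalar x) := by
  have h1 := (E.tendsto_simpleIntegral f hf hx).enorm
  simp_rw [E.enorm_simpleIntegral] at h1
  refine tendsto_nhds_unique h1 ?_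
  have h0 := E.tendsto_eLpNorm_approx hf hx
  have hm : ∀ n, AEStronglyMeasurable (⇑(approx f hf n) - f) (E.scalar x) := fun n =>
    (approx f hf n).aestronglyMeasurable.sub hf.aestronglyMeasurable
  have hup : Tendsto (fun n => eLpNorm f 2 (E.scalar x) +
      eLpNorm (⇑(approx f hf n) - f) 2 (E.scalar x)) atTop (𝓝 (eLpNorm f 2 (E.scalar x))) := by
    simpa using tendsto_const_nhds.add h0
  have hlo : Tendsto (fun n => eLpNorm f 2 (E.scalar x) -
      eLpNorm (⇑(approx f hf n) - f) 2 (E.scalar x)) atTop (𝓝 (eLpNorm f 2 (E.scalar x))) := by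
    simpa using ENNReal.Tendsto.sub tendsto_const_nhds h0 (Or.inl hx.2.ne)
  refine tendsto_of_tendsto_of_tendsto_of_le_of_le hlo hup (fun n => ?_) fun n => ?_
  · refine tsub_le_iff_right.2 ?_
    have e : f = ⇑(approx f hf n) - (⇑(approx f hf n) - f) := by abel
    conv_lhs => rw [e]
    exact eLpNorm_sub_le (approx f hf n).aestronglyMeasurable (hm n) (by norm_num)
  · have e : ⇑(approx f hf n) = f + (⇑(approx f hf n) - f) := by abel
    dsimp only
    conv_lhs => rw [e]
    exact eLpNorm_add_le hf.aestronglyMeasurable (hm n) (by norm_num)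

theorem integralAt_sub (hf : Measurable f) (hg : Measurable g) (hx : MemLp f 2 (E.scalar x))
    (hx' : MemLp g 2 (E.scalar x)) :
    E.integralAt (hf.sub hg) x = E.integralAt hf x - E.integralAt hg x := by
  have h1 := (E.tendsto_simpleIntegral f hf hx).sub (E.tendsto_simpleIntegral g hg hx')
  refine tendsto_nhds_unique (E.tendsto_integralAt (hf.sub hg) (hx.sub hx')
    (φ := fun n => approx f hf n - approx g hg n) ?_) ?_
  · have h3 := (E.tendsto_eLpNorm_approx hf hx).add (E.tendsto_eLpNorm_approx hg hx')
    rw [add_zero] at h3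
    refine tendsto_of_tendsto_of_tendsto_of_le_of_le tendsto_const_nhds h3 (fun _ => bot_le)
      fun n => ?_
    have e : ⇑(approx f hf n - approx g hg n) - (f - g)
        = (⇑(approx f hf n) - f) - (⇑(approx g hg n) - g) := by
      rw [SimpleFunc.coe_sub]; abel
    dsimp only
    rw [e]
    exact eLpNorm_sub_le ((approx f hf n).aestronglyMeasurable.sub hf.aestronglyMeasurable)
      ((approx g hg n).aestronglyMeasurable.sub hg.aestronglyMeasurable) (by norm_num)
  · simp_rw [E.simpleIntegral_sub]
    exact h1

theorem integralAt_simpleFunc (φ : SimpleFunc ℝ ℂ) (x : H) :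
    E.integralAt φ.measurable x = E.simpleIntegral φ x :=
  tendsto_nhds_unique (E.tendsto_integralAt φ.measurable
    (φ.memLp_of_isFiniteMeasure 2 (E.scalar x)) (φ := fun _ => φ) (by simp))
    tendsto_const_nhds

theorem simpleIntegral_const (c : ℂ) (x : H) :
    E.simpleIntegral (SimpleFunc.const ℝ c) x = c • x := by
  have h : Function.const ℝ c ⁻¹' {c} = Set.univ := by ext; simp
  simp [simpleIntegral, SimpleFunc.range_const, h, E.proj_univ]

theorem integralAt_const (c : ℂ) (x : H) :
    E.integralAt (measurable_const : Measurable fun _ : ℝ => c) x = c • x :=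
  (E.integralAt_simpleFunc (SimpleFunc.const ℝ c) x).trans (E.simpleIntegral_const c x)

theorem inner_simpleIntegral (φ : SimpleFunc ℝ ℂ) (x y : H) :
    ⟪E.simpleIntegral φ x, y⟫_ℂ = ⟪x, E.simpleIntegral (φ.map (starRingEnd ℂ)) y⟫_ℂ := by
  have h1 : ∀ c, (φ.map (starRingEnd ℂ)) ⁻¹' {starRingEnd ℂ c} = φ ⁻¹' {c} := by
    intro c; ext t; simp [(starRingEnd ℂ).injective.eq_iff]
  have h2 : E.simpleIntegral (φ.map (starRingEnd ℂ)) y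
      = ∑ c ∈ φ.range, starRingEnd ℂ c • E.proj (φ ⁻¹' {c}) y := by
    classical
    simp only [simpleIntegral, _root_.sum_apply, smul_apply]
    rw [SimpleFunc.range_map, Finset.sum_image (starRingEnd ℂ).injective.injOn]
    simp_rw [h1]
  rw [h2]
  simp only [simpleIntegral, _root_.sum_apply, smul_apply, sum_inner, inner_sum,
    inner_smul_left, inner_smul_right]
  refine Finset.sum_congr rfl fun c _ => ?_
  congr 1
  exact (E.isStarProjection _ (φ.measurableSet_fiber c)).isSelfAdjoint.isSymmetric x y

theorem inner_integralAt (hf : Measurable f) (hf' : Measurable fun t => starRingEnd ℂ (f t))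
    (hx : MemLp f 2 (E.scalar x)) (hy : MemLp f 2 (E.scalar y)) :
    ⟪E.integralAt hf x, y⟫_ℂ = ⟪x, E.integralAt hf' y⟫_ℂ := by
  have hy' : MemLp (fun t => starRingEnd ℂ (f t)) 2 (E.scalar y) := hy.star
  have h1 := (E.tendsto_simpleIntegral f hf hx).inner (tendsto_const_nhds (x := y)) (𝕜 := ℂ)
  have h2 := E.tendsto_integralAt hf' hy' (φ := fun n => (approx f hf n).map (starRingEnd ℂ)) (by
    refine (E.tendsto_eLpNorm_approx hf hy).congr fun n => ?_
    refine eLpNorm_congr_norm_ae (ae_of_all _ fun t => ?_)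
    simp only [Pi.sub_apply, SimpleFunc.map_apply, ← map_sub, RCLike.norm_conj])
  have h3 := (tendsto_const_nhds (x := x)).inner h2 (𝕜 := ℂ)
  simp_rw [E.inner_simpleIntegral] at h1
  exact tendsto_nhds_unique h1 h3

theorem memLp_proj {S : Set ℝ} (hS : MeasurableSet S) (hx : MemLp f 2 (E.scalar x)) :
    MemLp f 2 (E.scalar (E.proj S x)) := by
  rw [E.scalar_proj hS]
  exact hx.restrict S

theorem proj_integralAt {S : Set ℝ} (hS : MeasurableSet S) (hf : Measurable f)
    (hx : MemLp f 2 (E.scalar x)) :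
    E.proj S (E.integralAt hf x) = E.integralAt hf (E.proj S x) := by
  have h1 := ((E.proj S).continuous.tendsto _).comp (E.tendsto_simpleIntegral f hf hx)
  simp_rw [Function.comp_def, E.proj_simpleIntegral hS] at h1
  exact tendsto_nhds_unique h1 (E.tendsto_simpleIntegral f hf (E.memLp_proj hS hx))

/-- The scalar spectral measure of `(∫ f dE) x` has density `|f| ^ 2` with respect to that
of `x`. -/
theorem scalar_integralAt (hf : Measurable f) (hx : MemLp f 2 (E.scalar x)) :
    E.scalar (E.integralAt hf x) = (E.scalar x).withDensity fun t => ‖f t‖ₑ ^ 2 := by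
  refine Measure.ext fun S hS => ?_
  rw [E.scalar_apply _ hS, withDensity_apply _ hS, E.proj_integralAt hS hf hx,
    ENNReal.ofReal_pow (norm_nonneg _), ofReal_norm, E.enorm_integralAt hf (E.memLp_proj hS hx),
    E.scalar_proj hS, eLpNorm_eq_lintegral_rpow_enorm_toReal (by norm_num) (by norm_num),
    ← ENNReal.rpow_natCast, ← ENNReal.rpow_mul]
  norm_num

theorem eLpNorm_scalar_integralAt (hf : Measurable f) (hx : MemLp f 2 (E.scalar x))
    (hg : Measurable g) :
    eLpNorm g 2 (E.scalar (E.integralAt hf x)) = eLpNorm (fun t => g t * f t) 2 (E.scalar x) := by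
  rw [E.scalar_integralAt hf hx, eLpNorm_eq_lintegral_rpow_enorm_toReal (by norm_num) (by norm_num),
    eLpNorm_eq_lintegral_rpow_enorm_toReal (by norm_num) (by norm_num)]
  congr 1
  rw [lintegral_withDensity_eq_lintegral_mul _ (by fun_prop) (by fun_prop)]
  refine lintegral_congr fun t => ?_
  simp [mul_pow, mul_comm]

theorem memLp_scalar_integralAt (hf : Measurable f) (hx : MemLp f 2 (E.scalar x))
    (hg : Measurable g) :
    MemLp g 2 (E.scalar (E.integralAt hf x)) ↔ MemLp (fun t => g t * f t) 2 (E.scalar x) := by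
  rw [MemLp, MemLp, E.eLpNorm_scalar_integralAt hf hx hg]
  exact ⟨fun h => ⟨(hg.mul hf).aestronglyMeasurable, h.2⟩,
    fun h => ⟨hg.aestronglyMeasurable, h.2⟩⟩

theorem simpleIntegral_map (χ : SimpleFunc ℝ (ℂ × ℂ)) {k : ℂ × ℂ → ℂ} (hk : k 0 = 0) (x : H) :
    E.simpleIntegral (χ.map k) x = ∑ c ∈ χ.range, k c • E.proj (χ ⁻¹' {c}) x := by
  let T : Set ℝ → ℂ →L[ℝ] H := fun S =>
    ((ContinuousLinearMap.id ℂ ℂ).smulRight (E.proj S x)).restrictScalars ℝ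
  have hT : FinMeasAdditive (E.scalar x) T := by
    intro S S' hS hS' _ _ hd
    ext1; simp [T, E.proj_union hS hS' hd]
  have key : E.simpleIntegral (χ.map k) x = (χ.map k).setToSimpleFunc T := by
    simp [simpleIntegral, SimpleFunc.setToSimpleFunc, T]
  rw [key, SimpleFunc.map_setToSimpleFunc T hT
    (SimpleFunc.integrable_of_isFiniteMeasure χ) hk]
  simp [T]

theorem simpleIntegral_simpleIntegral (φ ψ : SimpleFunc ℝ ℂ) (x : H) :
    E.simpleIntegral φ (E.simpleIntegral ψ x) = E.simpleIntegral (φ * ψ) x := by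
  let χ := φ.pair ψ
  have hχ : ∀ c, MeasurableSet (χ ⁻¹' {c}) := fun c => χ.measurableSet_fiber c
  have h1 : φ = χ.map Prod.fst := rfl
  have h2 : ψ = χ.map Prod.snd := rfl
  have h3 : φ * ψ = χ.map fun c => c.1 * c.2 := rfl
  rw [h3, E.simpleIntegral_map χ (by simp), h1, E.simpleIntegral_map χ rfl, h2,
    E.simpleIntegral_map χ rfl]
  refine Finset.sum_congr rfl fun c hc => ?_
  rw [map_sum, Finset.sum_eq_single c]
  · rw [map_smul, E.proj_proj (hχ c) (hχ c), Set.inter_self, smul_smul]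
  · intro d _ hd
    rw [map_smul, E.proj_apply_of_disjoint (hχ c) (hχ d), smul_zero]
    exact Disjoint.preimage _ (by simpa using hd.symm)
  · exact fun h => (h hc).elim

theorem integralAt_integralAt (hf : Measurable f) (hg : Measurable g)
    (hx : MemLp f 2 (E.scalar x)) (hx' : MemLp (fun t => g t * f t) 2 (E.scalar x)) :
    E.integralAt hg (E.integralAt hf x) = E.integralAt (hg.mul hf) x := by
  -- If `g` is simple, approximate `f` by simple functions.
  have hbdd : ∀ φ : SimpleFunc ℝ ℂ, MemLp (fun t => φ t * f t) 2 (E.scalar x) ∧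
      E.simpleIntegral φ (E.integralAt hf x) = E.integralAt (φ.measurable.mul hf) x := by
    intro φ
    obtain ⟨C, hC⟩ := φ.exists_forall_norm_le
    have hm : MemLp (fun t => φ t * f t) 2 (E.scalar x) :=
      (E.memLp_scalar_integralAt hf hx φ.measurable).1 (φ.memLp_of_isFiniteMeasure 2 _)
    refine ⟨hm, ?_⟩
    have h1 := ((E.simpleIntegral φ).continuous.tendsto _).comp (E.tendsto_simpleIntegral f hf hx)
    simp_rw [Function.comp_def, E.simpleIntegral_simpleIntegral] at h1
    refine tendsto_nhds_unique h1 (E.tendsto_integralAt (φ.measurable.mul hf) hm ?_)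
    have h0 := ENNReal.Tendsto.const_mul (a := ENNReal.ofReal C)
      (E.tendsto_eLpNorm_approx hf hx) (Or.inr ENNReal.ofReal_ne_top)
    rw [mul_zero] at h0
    refine tendsto_of_tendsto_of_tendsto_of_le_of_le tendsto_const_nhds h0 (fun _ => bot_le)
      fun n => ?_
    refine eLpNorm_le_mul_eLpNorm_of_ae_le_mul (ae_of_all _ fun t => ?_) 2
    simp only [Pi.sub_apply, SimpleFunc.coe_mul, Pi.mul_apply, ← mul_sub, norm_mul]
    exact mul_le_mul_of_nonneg_right (hC t) (norm_nonneg _)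
  have hy : MemLp g 2 (E.scalar (E.integralAt hf x)) :=
    (E.memLp_scalar_integralAt hf hx hg).2 hx'
  refine tendsto_nhds_unique (E.tendsto_simpleIntegral g hg hy) ?_
  rw [← tendsto_sub_nhds_zero_iff, tendsto_zero_iff_enorm_tendsto_zero]
  refine (E.tendsto_eLpNorm_approx hg hy).congr fun n => ?_
  have hm := (approx g hg n).measurable
  rw [(hbdd _).2, ← E.integralAt_sub (hm.mul hf) (hg.mul hf) (hbdd _).1 hx',
    E.enorm_integralAt _ ((hbdd _).1.sub hx'), E.eLpNorm_scalar_integralAt hf hx (hm.sub hg)]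
  congr 1
  ext t
  simp [sub_mul]

theorem memLp_of_bounded (hf : Measurable f) {C : ℝ} (hC : ∀ t, ‖f t‖ ≤ C) (x : H) :
    MemLp f 2 (E.scalar x) :=
  MemLp.of_bound hf.aestronglyMeasurable C (ae_of_all _ hC)

theorem norm_integralAt_le (hf : Measurable f) {C : ℝ} (hC : ∀ t, ‖f t‖ ≤ C) (x : H) :
    ‖E.integralAt hf x‖ ≤ C * ‖x‖ := by
  have hC0 : 0 ≤ C := (norm_nonneg _).trans (hC 0)
  have h := E.enorm_integralAt hf (E.memLp_of_bounded hf hC x)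
  have h1 := eLpNorm_le_of_ae_bound (p := 2) (μ := E.scalar x) (ae_of_all _ hC)
  rw [← h, E.scalar_univ, ENNReal.ofReal_pow (norm_nonneg _), ofReal_norm,
    ← ENNReal.rpow_natCast, ← ENNReal.rpow_mul] at h1
  norm_num at h1
  rw [← ofReal_norm, ← ofReal_norm, ← ENNReal.ofReal_mul (norm_nonneg _),
    ENNReal.ofReal_le_ofReal_iff (by positivity)] at h1
  linarith

/-- The bounded operator `∫ f dE` for a bounded function `f`. -/
def boundedIntegral (hf : Measurable f) {C : ℝ} (hC : ∀ t, ‖f t‖ ≤ C) : H →L[ℂ] H :=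
  LinearMap.mkContinuous
    { toFun := E.integralAt hf
      map_add' := fun x y => (E.integral f hf).map_add ⟨x, E.memLp_of_bounded hf hC x⟩
        ⟨y, E.memLp_of_bounded hf hC y⟩
      map_smul' := fun c x => (E.integral f hf).map_smul c ⟨x, E.memLp_of_bounded hf hC x⟩ }
    C (E.norm_integralAt_le hf hC)

theorem boundedIntegral_apply (hf : Measurable f) {C : ℝ} (hC : ∀ t, ‖f t‖ ≤ C) (x : H) :
    E.boundedIntegral hf hC x = E.integralAt hf x := rfl

theorem integralAt_add (hf : Measurable f) (hg : Measurable g) (hx : MemLp f 2 (E.scalar x))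
    (hx' : MemLp g 2 (E.scalar x)) :
    E.integralAt (hf.add hg) x = E.integralAt hf x + E.integralAt hg x := by
  have h := E.integralAt_sub (hf.add hg) hg (hx.add hx') hx'
  have e : E.integralAt ((hf.add hg).sub hg) x = E.integralAt hf x := by
    congr 1; simp
  rw [← e, h]
  abel

/-! ### Continuous functions of an integral -/

theorem inner_integralAt_ofReal {g : ℝ → ℝ} (hg : Measurable fun t => (g t : ℂ))
    (hx : MemLp (fun t => (g t : ℂ)) 2 (E.scalar x))
    (hy : MemLp (fun t => (g t : ℂ)) 2 (E.scalar y)) :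
    ⟪E.integralAt hg x, y⟫_ℂ = ⟪x, E.integralAt hg y⟫_ℂ := by
  rw [E.inner_integralAt hg (by simpa using hg) hx hy]
  congr 2
  simp

theorem boundedIntegral_nonneg {g : ℝ → ℝ} (hg : Measurable fun t => (g t : ℂ)) {C : ℝ}
    (hC : ∀ t, ‖(g t : ℂ)‖ ≤ C) (h0 : ∀ t, 0 ≤ g t) : 0 ≤ E.boundedIntegral hg hC := by
  rw [ContinuousLinearMap.nonneg_iff_isPositive, ContinuousLinearMap.isPositive_iff_complex]
  intro x
  have hm : Measurable fun t => ((√(g t) : ℝ) : ℂ) := by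
    have : Measurable g := by
      simpa [Function.comp_def] using Complex.measurable_re.comp hg
    fun_prop
  have hb : ∀ t, ‖((√(g t) : ℝ) : ℂ)‖ ≤ √C := fun t => by
    have := hC t
    rw [Complex.norm_real, Real.norm_of_nonneg (h0 t)] at this
    rw [Complex.norm_real, Real.norm_of_nonneg (Real.sqrt_nonneg _)]
    exact Real.sqrt_le_sqrt this
  have e : E.integralAt hg x = E.integralAt hm (E.integralAt hm x) := by
    have h2 : (fun t => (g t : ℂ)) = fun t => ((√(g t) : ℝ) : ℂ) * ((√(g t) : ℝ) : ℂ) := by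
      ext t
      rw [← Complex.ofReal_mul, Real.mul_self_sqrt (h0 t)]
    rw [E.integralAt_integralAt hm hm (E.memLp_of_bounded hm hb x)
      (h2 ▸ E.memLp_of_bounded hg hC x)]
    congr 1
  have h : ⟪E.boundedIntegral hg hC x, x⟫_ℂ = ((‖E.integralAt hm x‖ ^ 2 : ℝ) : ℂ) := by
    rw [boundedIntegral_apply, e, E.inner_integralAt_ofReal hm (E.memLp_of_bounded hm hb _)
      (E.memLp_of_bounded hm hb x), inner_self_eq_norm_sq_to_K]
    simp
  rw [h]
  refine ⟨rfl, ?_⟩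
  rw [RCLike.re_to_complex, Complex.ofReal_re]
  positivity

theorem spectrum_boundedIntegral_subset {g : ℝ → ℝ} (hg : Measurable fun t => (g t : ℂ))
    (hC : ∀ t, ‖(g t : ℂ)‖ ≤ 1) (h0 : ∀ t, 0 ≤ g t) :
    spectrum ℝ (E.boundedIntegral hg hC) ⊆ Set.Icc 0 1 := by
  intro k hk
  refine ⟨spectrum_nonneg_of_nonneg (E.boundedIntegral_nonneg hg hC h0) hk, ?_⟩
  have h1 := spectrum.norm_le_norm_mul_of_mem hk
  have h2 : ‖E.boundedIntegral hg hC‖ ≤ 1 := LinearMap.mkContinuous_norm_le _ zero_le_one _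
  have h3 : ‖(1 : H →L[ℂ] H)‖ ≤ 1 := ContinuousLinearMap.norm_id_le
  calc k ≤ ‖k‖ := Real.le_norm_self k
    _ ≤ _ := h1
    _ ≤ 1 * 1 := mul_le_mul h2 h3 (norm_nonneg _) zero_le_one
    _ = 1 := one_mul 1

theorem aeval_boundedIntegral {g : ℝ → ℝ} (hg : Measurable fun t => (g t : ℂ))
    (hC : ∀ t, ‖(g t : ℂ)‖ ≤ 1) (x : H) (p : Polynomial ℝ)
    (hp : Measurable fun t => ((p.eval (g t) : ℝ) : ℂ)) :
    MemLp (fun t => ((p.eval (g t) : ℝ) : ℂ)) 2 (E.scalar x) ∧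
    Polynomial.aeval (E.boundedIntegral hg hC) p x = E.integralAt hp x := by
  have hgr : Measurable g := by simpa [Function.comp_def] using Complex.measurable_re.comp hg
  induction p using Polynomial.induction_on with
  | C a =>
    simp only [Polynomial.eval_C, Polynomial.aeval_C]
    refine ⟨memLp_const _, ?_⟩
    rw [E.integralAt_const]
    simp [Algebra.algebraMap_eq_smul_one]
  | add p q ihp ihq =>
    obtain ⟨h1, h2⟩ := ihp (by fun_prop)
    obtain ⟨h3, h4⟩ := ihq (by fun_prop)
    simp only [Polynomial.eval_add, map_add, Complex.ofReal_add, add_apply]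
    refine ⟨h1.add h3, ?_⟩
    rw [h2, h4]
    exact (E.integralAt_add _ _ h1 h3).symm
  | monomial n a ih =>
    obtain ⟨h1, h2⟩ := ih (by fun_prop)
    have e : (fun t => (((Polynomial.C a * Polynomial.X ^ (n + 1)).eval (g t) : ℝ) : ℂ))
        = fun t => (g t : ℂ) * (((Polynomial.C a * Polynomial.X ^ n).eval (g t) : ℝ) : ℂ) := by
      ext t; simp; ring
    have h3 : MemLp (fun t => (g t : ℂ) *
        (((Polynomial.C a * Polynomial.X ^ n).eval (g t) : ℝ) : ℂ)) 2 (E.scalar x) :=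
      (E.memLp_scalar_integralAt (by fun_prop) h1 hg).1 (E.memLp_of_bounded hg hC _)
    refine ⟨e ▸ h3, ?_⟩
    have e' : Polynomial.aeval (E.boundedIntegral hg hC) (Polynomial.C a * Polynomial.X ^ (n + 1))
        = E.boundedIntegral hg hC *
          Polynomial.aeval (E.boundedIntegral hg hC) (Polynomial.C a * Polynomial.X ^ n) := by
      rw [show Polynomial.C a * Polynomial.X ^ (n + 1)
        = Polynomial.X * (Polynomial.C a * Polynomial.X ^ n) by ring, map_mul, Polynomial.aeval_X]
    rw [e', mul_apply_eq_comp, h2, boundedIntegral_apply, E.integralAt_integralAt _ hg h1 h3]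
    congr 1
    exact e.symm

/-- The continuous functional calculus of the operator `∫ g dE` is given by composition with `g`. -/
theorem cfc_boundedIntegral_apply {g : ℝ → ℝ} (hg : Measurable fun t => (g t : ℂ))
    (hC : ∀ t, ‖(g t : ℂ)‖ ≤ 1) (h0 : ∀ t, 0 ≤ g t) {φ : ℝ → ℝ} (hφ : Continuous φ)
    (hm : Measurable fun t => (φ (g t) : ℂ)) (x : H) :
    cfc φ (E.boundedIntegral hg hC) x = E.integralAt hm x := by
  have hgr : Measurable g := by simpa [Function.comp_def] using Complex.measurable_re.comp hg
  have hsa : IsSelfAdjoint (E.boundedIntegral hg hC) :=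
    (E.boundedIntegral_nonneg hg hC h0).isSelfAdjoint
  have hg01 : ∀ t, g t ∈ Set.Icc (0 : ℝ) 1 := fun t => ⟨h0 t, by
    have := hC t
    rwa [Complex.norm_real, Real.norm_of_nonneg (h0 t)] at this⟩
  obtain ⟨M, hM⟩ := isCompact_Icc.exists_bound_of_continuousOn (hφ.continuousOn (s := Set.Icc 0 1))
  have hφL : MemLp (fun t => (φ (g t) : ℂ)) 2 (E.scalar x) :=
    E.memLp_of_bounded hm (C := M) (fun t => by simpa using hM _ (hg01 t)) x
  refine eq_of_forall_dist_le fun ε hε => ?_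
  obtain ⟨δ, hδ, hδε⟩ : ∃ δ > 0, 2 * δ * ‖x‖ ≤ ε := by
    refine ⟨ε / (2 * (‖x‖ + 1)), by positivity, ?_⟩
    have : 0 < ‖x‖ + 1 := by positivity
    rw [show 2 * (ε / (2 * (‖x‖ + 1))) * ‖x‖ = ε * (‖x‖ / (‖x‖ + 1)) by field_simp]
    exact mul_le_of_le_one_right hε.le ((div_le_one this).2 (by linarith))
  obtain ⟨p, hp⟩ := exists_polynomial_near_of_continuousOn 0 1 φ hφ.continuousOn δ hδ
  have hpm : Measurable fun t => ((p.eval (g t) : ℝ) : ℂ) := by fun_prop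
  obtain ⟨hpL, hpe⟩ := E.aeval_boundedIntegral hg hC x p hpm
  have h1 : ‖cfc φ (E.boundedIntegral hg hC) x - E.integralAt hpm x‖ ≤ δ * ‖x‖ := by
    rw [← hpe, ← cfc_polynomial p _ hsa, ← sub_apply, ← cfc_sub _ _ _ hφ.continuousOn
      (by fun_prop)]
    refine ContinuousLinearMap.le_of_opNorm_le _ (norm_cfc_le hδ.le fun t ht => ?_) x
    rw [norm_sub_rev]
    exact (hp t (E.spectrum_boundedIntegral_subset hg hC h0 ht)).le
  have h2 : ‖E.integralAt hpm x - E.integralAt hm x‖ ≤ δ * ‖x‖ := by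
    rw [← E.integralAt_sub hpm hm hpL hφL]
    refine E.norm_integralAt_le _ (fun t => ?_) x
    rw [Pi.sub_apply, ← Complex.ofReal_sub, Complex.norm_real]
    exact (hp _ (hg01 t)).le
  rw [dist_eq_norm]
  calc _ ≤ _ := norm_sub_le_norm_sub_add_norm_sub _ (E.integralAt hpm x) _
    _ ≤ δ * ‖x‖ + δ * ‖x‖ := add_le_add h1 h2
    _ ≤ ε := by linarith

/-! ### The weights `(1 + t ^ 2) ^ (σ / 2)` -/

/-- The weight `⟨t⟩ ^ σ = (1 + t ^ 2) ^ (σ / 2)`. -/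
def weight (σ t : ℝ) : ℝ := (1 + t ^ 2) ^ (σ / 2)

theorem weight_pos (σ t : ℝ) : 0 < weight σ t := Real.rpow_pos_of_pos (by positivity) _

theorem weight_add (σ τ t : ℝ) : weight (σ + τ) t = weight σ t * weight τ t := by
  rw [weight, add_div, Real.rpow_add (by positivity)]
  rfl

theorem weight_mono {σ τ : ℝ} (h : σ ≤ τ) (t : ℝ) : weight σ t ≤ weight τ t :=
  Real.rpow_le_rpow_of_exponent_le (by nlinarith [sq_nonneg t]) (by linarith)

theorem weight_zero (t : ℝ) : weight 0 t = 1 := by simp [weight]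

theorem weight_rpow (σ θ t : ℝ) : weight σ t ^ θ = weight (σ * θ) t := by
  rw [weight, ← Real.rpow_mul (by positivity), weight]
  ring_nf

theorem measurable_weight (σ : ℝ) : Measurable fun t => (weight σ t : ℂ) := by
  unfold weight
  fun_prop

theorem norm_weight (σ t : ℝ) : ‖(weight σ t : ℂ)‖ = weight σ t := by
  rw [Complex.norm_real, Real.norm_of_nonneg (weight_pos σ t).le]

theorem norm_weight_neg_abs_le (s t : ℝ) : ‖(weight (-|s|) t : ℂ)‖ ≤ 1 := by
  rw [norm_weight, ← weight_zero t]
  exact weight_mono (by simp) t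

/-- `⟨T⟩ ^ (-|s|)` for the operator `T = ∫ t dE`, a bounded operator. The absolute value makes the
definition total; it is used for `s ≥ 0`. -/
def besselPotential (s : ℝ) : H →L[ℂ] H :=
  E.boundedIntegral (measurable_weight (-|s|)) (norm_weight_neg_abs_le s)

/-- `x` is in the domain of `⟨T⟩ ^ σ` for the operator `T = ∫ t dE`. -/
def MemWeight (σ : ℝ) (x : H) : Prop := MemLp (fun t => (weight σ t : ℂ)) 2 (E.scalar x)

/-- `⟨T⟩ ^ σ x` for the operator `T = ∫ t dE`. -/
def weightAt (σ : ℝ) (x : H) : H := E.integralAt (measurable_weight σ) x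

variable {E}

theorem MemWeight.mono {σ τ : ℝ} (h : E.MemWeight τ x) (hστ : σ ≤ τ) : E.MemWeight σ x := by
  refine MemLp.mono h (measurable_weight σ).aestronglyMeasurable (ae_of_all _ fun t => ?_)
  rw [norm_weight, norm_weight]
  exact weight_mono hστ t

theorem memWeight_of_nonpos {σ : ℝ} (hσ : σ ≤ 0) (x : H) : E.MemWeight σ x :=
  MemWeight.mono (τ := 0) (by simpa [MemWeight, weight_zero] using memLp_const 1) hσ

theorem memWeight_weightAt {σ τ : ℝ} (hσ : E.MemWeight σ x) :
    E.MemWeight τ (E.weightAt σ x) ↔ E.MemWeight (τ + σ) x := by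
  rw [MemWeight, weightAt, E.memLp_scalar_integralAt (measurable_weight σ) hσ (measurable_weight τ)]
  simp_rw [← Complex.ofReal_mul, ← weight_add]
  rfl

theorem weightAt_weightAt {σ τ : ℝ} (hσ : E.MemWeight σ x) (hτ : E.MemWeight (τ + σ) x) :
    E.weightAt τ (E.weightAt σ x) = E.weightAt (τ + σ) x := by
  have e : (fun t => (weight (τ + σ) t : ℂ)) = fun t => (weight τ t : ℂ) * (weight σ t : ℂ) := by
    ext t; rw [weight_add, Complex.ofReal_mul]
  have hτ' : MemLp (fun t => (weight τ t : ℂ) * (weight σ t : ℂ)) 2 (E.scalar x) := e ▸ hτ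
  rw [weightAt, weightAt, E.integralAt_integralAt (measurable_weight σ)
    (measurable_weight τ) hσ hτ', weightAt]
  congr 1
  exact e.symm

theorem weightAt_zero (x : H) : E.weightAt 0 x = x := by
  have e : (fun t => (weight 0 t : ℂ)) = fun _ => 1 := by ext t; rw [weight_zero]; rfl
  have h := E.integralAt_const 1 x
  rw [one_smul] at h
  refine Eq.trans ?_ h
  rw [weightAt]
  congr 1

variable (E)

theorem besselPotential_apply {s : ℝ} (hs : 0 ≤ s) (x : H) :
    E.besselPotential s x = E.weightAt (-s) x := by
  rw [besselPotential, boundedIntegral_apply, weightAt]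
  congr 1
  rw [abs_of_nonneg hs]

theorem besselPotential_nonneg (s : ℝ) : 0 ≤ E.besselPotential s :=
  E.boundedIntegral_nonneg _ _ fun t => (weight_pos _ t).le

theorem inner_besselPotential (s : ℝ) (x y : H) :
    ⟪E.besselPotential s x, y⟫_ℂ = ⟪x, E.besselPotential s y⟫_ℂ :=
  (E.besselPotential_nonneg s).isSelfAdjoint.isSymmetric x y

theorem norm_besselPotential_le (s : ℝ) (x : H) : ‖E.besselPotential s x‖ ≤ ‖x‖ := by
  exact (E.norm_integralAt_le _ (norm_weight_neg_abs_le s) x).trans_eq (one_mul _)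

theorem besselPotential_weightAt {s : ℝ} (hs : 0 ≤ s) (hx : E.MemWeight s x) :
    E.besselPotential s (E.weightAt s x) = x := by
  rw [E.besselPotential_apply hs,
    weightAt_weightAt hx (by rw [neg_add_cancel]; exact memWeight_of_nonpos le_rfl x),
    neg_add_cancel, weightAt_zero]

theorem besselPotential_rpow {s θ : ℝ} (hs : 0 ≤ s) (hθ : 0 ≤ θ) :
    E.besselPotential s ^ θ = E.besselPotential (s * θ) := by
  have hsθ : 0 ≤ s * θ := mul_nonneg hs hθ
  have e : ∀ t, weight (-|s|) t ^ θ = weight (-|s * θ|) t := fun t => by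
    rw [weight_rpow, abs_of_nonneg hs, abs_of_nonneg hsθ, neg_mul]
  ext x
  rw [CFC.rpow_eq_cfc_real (E.besselPotential_nonneg s)]
  refine (E.cfc_boundedIntegral_apply _ _ (fun t => (weight_pos _ t).le)
    (Real.continuous_rpow_const hθ) ?_ x).trans ?_
  · simp_rw [e]
    exact measurable_weight _
  · rw [besselPotential, boundedIntegral_apply]
    congr 1
    ext t
    rw [e]

end SpectralMeasure

/-! ### Spectral measures from representations of algebras of continuous functions -/

namespace ContinuousRep

variable {H : Type*} [NormedAddCommGroup H] [InnerProductSpace ℂ H] [CompleteSpace H]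

section

variable {X : Type*} [MeasurableSpace X]

theorem tendsto_eLpNorm_mono {μ ν : Measure X} (h : μ ≤ ν) {u : ℕ → X → ℂ}
    (hu : Tendsto (fun n => eLpNorm (u n) 2 ν) atTop (𝓝 0)) :
    Tendsto (fun n => eLpNorm (u n) 2 μ) atTop (𝓝 0) :=
  tendsto_of_tendsto_of_tendsto_of_le_of_le tendsto_const_nhds hu (fun _ => bot_le)
    fun _ => eLpNorm_mono_measure _ h

theorem tendsto_eLpNorm_mul {μ : Measure X} {h : X → ℂ} {C : ℝ} {u : ℕ → X → ℂ}
    (hC : ∀ t, ‖h t‖ ≤ C)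
    (hu : Tendsto (fun n => eLpNorm (u n) 2 μ) atTop (𝓝 0)) :
    Tendsto (fun n => eLpNorm (h * u n) 2 μ) atTop (𝓝 0) := by
  have h0 := ENNReal.Tendsto.const_mul (a := ENNReal.ofReal C) hu (Or.inr ENNReal.ofReal_ne_top)
  rw [mul_zero] at h0
  refine tendsto_of_tendsto_of_tendsto_of_le_of_le tendsto_const_nhds h0 (fun _ => bot_le)
    fun n => ?_
  refine eLpNorm_le_mul_eLpNorm_of_ae_le_mul (ae_of_all _ fun t => ?_) 2
  rw [Pi.mul_apply, norm_mul]
  exact mul_le_mul_of_nonneg_right (hC t) (norm_nonneg _)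

theorem memLp_bounded {g : X → ℂ} {C : ℝ} (hg : Measurable g) (hC : ∀ t, ‖g t‖ ≤ C) (μ : Measure X)
    [IsFiniteMeasure μ] : MemLp g 2 μ :=
  MemLp.of_bound hg.aestronglyMeasurable C (ae_of_all _ hC)

end

variable {X : Type*} [TopologicalSpace X]

theorem inner_map (Φ : C(X, ℂ) →⋆ₐ[ℂ] (H →L[ℂ] H)) (f : C(X, ℂ)) (x y : H) :
    ⟪Φ f x, y⟫_ℂ = ⟪x, Φ (star f) y⟫_ℂ := by
  rw [map_star, ContinuousLinearMap.star_eq_adjoint, ContinuousLinearMap.adjoint_inner_right]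

theorem inner_map_star_mul (Φ : C(X, ℂ) →⋆ₐ[ℂ] (H →L[ℂ] H)) (f : C(X, ℂ)) (x : H) :
    ⟪Φ (star f * f) x, x⟫_ℂ = ((‖Φ f x‖ ^ 2 : ℝ) : ℂ) := by
  rw [map_mul, mul_apply_eq_comp, inner_map, star_star, inner_self_eq_norm_sq_to_K]
  simp

/-- Complexification of real continuous functions. -/
def toComplex (f : C(X, ℝ)) : C(X, ℂ) :=
  (⟨Complex.ofReal, Complex.continuous_ofReal⟩ : C(ℝ, ℂ)).comp f

variable {X : Type*} [MetricSpace X] [CompactSpace X] [MeasurableSpace X] [BorelSpace X]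
variable (Φ : C(X, ℂ) →⋆ₐ[ℂ] (H →L[ℂ] H))

/-- The positive functional `f ↦ ⟪Φ f x, x⟫` on real functions. -/
def functional (x : H) : CompactlySupportedContinuousMap X ℝ →ₚ[ℝ] ℝ :=
  PositiveLinearMap.mk₀
    { toFun := fun f => (⟪Φ (toComplex f.toContinuousMap) x, x⟫_ℂ).re
      map_add' := fun f g => by
        have : toComplex (f + g).toContinuousMap
            = toComplex f.toContinuousMap + toComplex g.toContinuousMap := by
          ext t; simp [toComplex]
        rw [this, map_add, add_apply, inner_add_left, Complex.add_re]
      map_smul' := fun c f => by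
        have : toComplex (c • f).toContinuousMap
            = (c : ℂ) • toComplex f.toContinuousMap := by
          ext t; simp [toComplex]
        rw [this, map_smul, smul_apply, inner_smul_left, Complex.conj_ofReal,
          Complex.re_ofReal_mul]
        rfl }
    (fun f hf => by
      let s : C(X, ℂ) := toComplex ⟨fun t => √(f t), by fun_prop⟩
      have : toComplex f.toContinuousMap = star s * s := by
        ext t
        have h0 : 0 ≤ f t := hf t
        simp only [toComplex, ContinuousMap.comp_apply, ContinuousMap.coe_mk,
          ContinuousMap.mul_apply, ContinuousMap.star_apply, s, RCLike.star_def,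
          Complex.conj_ofReal]
        rw [← Complex.ofReal_mul, Real.mul_self_sqrt h0]
        rfl
      change 0 ≤ (⟪Φ (toComplex f.toContinuousMap) x, x⟫_ℂ).re
      rw [this, inner_map_star_mul, Complex.ofReal_re]
      positivity)

/-- The measure on `X` that represents `f ↦ ⟪Φ f x, x⟫`. -/
def repMeasure (x : H) : Measure X := RealRMK.rieszMeasure (functional Φ x)

instance (x : H) : (repMeasure Φ x).Regular := RealRMK.regular_rieszMeasure _

/-- The map `f ↦ Φ f x` is isometric for the norm of `L²(repMeasure Φ x)`, because
`‖Φ f x‖ ^ 2 = ⟪Φ (star f * f) x, x⟫`. -/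
theorem enorm_map (f : C(X, ℂ)) (x : H) : ‖Φ f x‖ₑ = eLpNorm f 2 (repMeasure Φ x) := by
  let F : C(X, ℝ) := ⟨fun t => ‖f t‖ ^ 2, by fun_prop⟩
  have h1 : toComplex F = star f * f := by
    ext t
    simp only [toComplex, ContinuousMap.comp_apply, ContinuousMap.coe_mk, ContinuousMap.mul_apply,
      ContinuousMap.star_apply, RCLike.star_def, F, Complex.conj_mul', Complex.ofReal_pow]
  have h2 : ∫ t, ‖f t‖ ^ 2 ∂(repMeasure Φ x) = ‖Φ f x‖ ^ 2 := by
    have h3 := RealRMK.integral_rieszMeasure (functional Φ x)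
      ⟨F, HasCompactSupport.of_compactSpace _⟩
    refine Eq.trans h3 ?_
    change (⟪Φ (toComplex F) x, x⟫_ℂ).re = _
    rw [h1, inner_map_star_mul, Complex.ofReal_re]
  have h4 : ∫⁻ t, ‖f t‖ₑ ^ (2 : ℝ) ∂(repMeasure Φ x) = ‖Φ f x‖ₑ ^ (2 : ℝ) := by
    rw [← ofReal_norm, ENNReal.ofReal_rpow_of_nonneg (norm_nonneg _) zero_le_two,
      Real.rpow_two, ← h2,
      ofReal_integral_eq_lintegral_ofReal _ (ae_of_all _ fun t => by positivity)]
    · refine lintegral_congr fun t => ?_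
      rw [← ofReal_norm, ENNReal.ofReal_rpow_of_nonneg (norm_nonneg _) zero_le_two, Real.rpow_two]
    · exact F.continuous.integrable_of_hasCompactSupport (HasCompactSupport.of_compactSpace _)
  rw [eLpNorm_eq_lintegral_rpow_enorm_toReal (by norm_num) (by norm_num)]
  simp only [ENNReal.toReal_ofNat]
  rw [h4, ← ENNReal.rpow_mul]
  norm_num

/-- The linear map `f ↦ Φ f x`. -/
def orbit (x : H) : C(X, ℂ) →ₗ[ℂ] H where
  toFun f := Φ f x
  map_add' f g := by rw [map_add, add_apply]
  map_smul' c f := by rw [map_smul, smul_apply]; rfl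

/-- The isometric extension of `f ↦ Φ f x` to `L²`. -/
def extension (x : H) : Lp ℂ 2 (repMeasure Φ x) →L[ℂ] H :=
  (orbit Φ x).extendOfNorm (ContinuousMap.toLp 2 (repMeasure Φ x) ℂ).toLinearMap

theorem norm_toLp (x : H) (f : C(X, ℂ)) :
    ‖ContinuousMap.toLp 2 (repMeasure Φ x) ℂ f‖ = ‖Φ f x‖ := by
  rw [Lp.norm_def, eLpNorm_congr_ae (ContinuousMap.coeFn_toLp (𝕜 := ℂ) (repMeasure Φ x) f),
    ← enorm_map, toReal_enorm]

theorem extension_toLp (x : H) (f : C(X, ℂ)) :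
    extension Φ x (ContinuousMap.toLp 2 (repMeasure Φ x) ℂ f) = Φ f x := by
  have hd : DenseRange (ContinuousMap.toLp (E := ℂ) 2 (repMeasure Φ x) ℂ).toLinearMap :=
    ContinuousMap.toLp_denseRange ℂ _ ℂ (by norm_num)
  have hn : ∀ f, ‖orbit Φ x f‖
      ≤ 1 * ‖(ContinuousMap.toLp (E := ℂ) 2 (repMeasure Φ x) ℂ).toLinearMap f‖ := fun f => by
    rw [one_mul]
    exact (norm_toLp Φ x f).ge
  exact LinearMap.extendOfNorm_eq hd ⟨1, hn⟩ f

theorem norm_extension (x : H) (u : Lp ℂ 2 (repMeasure Φ x)) : ‖extension Φ x u‖ = ‖u‖ := by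
  have hd : DenseRange (ContinuousMap.toLp 2 (repMeasure Φ x) ℂ) :=
    ContinuousMap.toLp_denseRange ℂ _ ℂ (by norm_num)
  refine hd.induction_on (p := fun u => ‖extension Φ x u‖ = ‖u‖) u
    (isClosed_eq (by fun_prop) (by fun_prop)) fun f => ?_
  rw [extension_toLp, norm_toLp]

open Classical in
/-- The extension of `f ↦ Φ f x` to square integrable Borel functions (and `0` for other
functions). -/
def borelAt (g : X → ℂ) (x : H) : H :=
  if h : MemLp g 2 (repMeasure Φ x) then extension Φ x (h.toLp g) else 0

variable {g h : X → ℂ} {x y : H}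

theorem borelAt_eq (hg : MemLp g 2 (repMeasure Φ x)) :
    borelAt Φ g x = extension Φ x (hg.toLp g) := dif_pos hg

theorem enorm_borelAt (hg : MemLp g 2 (repMeasure Φ x)) :
    ‖borelAt Φ g x‖ₑ = eLpNorm g 2 (repMeasure Φ x) := by
  rw [borelAt_eq Φ hg, ← Lp.enorm_toLp hg, ← ofReal_norm, norm_extension, ofReal_norm]

theorem borelAt_add (hg : MemLp g 2 (repMeasure Φ x)) (hh : MemLp h 2 (repMeasure Φ x)) :
    borelAt Φ (g + h) x = borelAt Φ g x + borelAt Φ h x := by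
  rw [borelAt_eq Φ hg, borelAt_eq Φ hh, borelAt_eq Φ (hg.add hh), MemLp.toLp_add, map_add]

theorem borelAt_sub (hg : MemLp g 2 (repMeasure Φ x)) (hh : MemLp h 2 (repMeasure Φ x)) :
    borelAt Φ (g - h) x = borelAt Φ g x - borelAt Φ h x := by
  rw [borelAt_eq Φ hg, borelAt_eq Φ hh, borelAt_eq Φ (hg.sub hh), MemLp.toLp_sub, map_sub]

theorem borelAt_const_smul (c : ℂ) (hg : MemLp g 2 (repMeasure Φ x)) :
    borelAt Φ (c • g) x = c • borelAt Φ g x := by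
  rw [borelAt_eq Φ hg, borelAt_eq Φ (hg.const_smul c), MemLp.toLp_const_smul, map_smul]

theorem memLp_continuous (f : C(X, ℂ)) (μ : Measure X) [IsFiniteMeasure μ] : MemLp f 2 μ :=
  MemLp.of_bound f.continuous.aestronglyMeasurable ‖f‖ (ae_of_all _ f.norm_coe_le_norm)

theorem borelAt_continuous (f : C(X, ℂ)) (x : H) : borelAt Φ f x = Φ f x := by
  rw [borelAt_eq Φ (memLp_continuous f _), ← extension_toLp]
  rfl

theorem tendsto_borelAt {f : ℕ → C(X, ℂ)} (hg : MemLp g 2 (repMeasure Φ x))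
    (hf : Tendsto (fun n => eLpNorm (⇑(f n) - g) 2 (repMeasure Φ x)) atTop (𝓝 0)) :
    Tendsto (fun n => Φ (f n) x) atTop (𝓝 (borelAt Φ g x)) := by
  rw [← tendsto_sub_nhds_zero_iff, tendsto_zero_iff_enorm_tendsto_zero]
  refine hf.congr fun n => ?_
  rw [← borelAt_continuous, ← borelAt_sub Φ (memLp_continuous _ _) hg,
    enorm_borelAt Φ ((memLp_continuous _ _).sub hg)]

/-- Density of `C(X, ℂ)` in `L²(ν)`. Taking for `ν` a sum of measures gives one sequence that
converges for several vectors at once, which yields linearity and multiplicativity in the vector. -/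
theorem exists_approx (ν : Measure X) [IsFiniteMeasure ν] (hg : MemLp g 2 ν) :
    ∃ f : ℕ → C(X, ℂ), Tendsto (fun n => eLpNorm (⇑(f n) - g) 2 ν) atTop (𝓝 0) := by
  have h1 : ∀ n : ℕ, ∃ f : C(X, ℂ), eLpNorm (⇑f - g) 2 ν ≤ ((n : ℝ≥0∞) + 1)⁻¹ := by
    intro n
    obtain ⟨f, hf, -⟩ := hg.exists_boundedContinuous_eLpNorm_sub_le (by norm_num)
      (ε := ((n : ℝ≥0∞) + 1)⁻¹) (by simp)
    refine ⟨f.toContinuousMap, ?_⟩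
    rw [eLpNorm_sub_comm]
    exact hf
  choose f hf using h1
  refine ⟨f, tendsto_of_tendsto_of_tendsto_of_le_of_le tendsto_const_nhds ?_ (fun _ => bot_le) hf⟩
  have := (tendsto_add_atTop_iff_nat 1).2 ENNReal.tendsto_inv_nat_nhds_zero
  simpa using this

variable {C : ℝ}

theorem borelAt_vector_add (hg : Measurable g) (hC : ∀ t, ‖g t‖ ≤ C) (x y : H) :
    borelAt Φ g (x + y) = borelAt Φ g x + borelAt Φ g y := by
  obtain ⟨f, hf⟩ := exists_approx (repMeasure Φ (x + y) + (repMeasure Φ x + repMeasure Φ y))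
    (memLp_bounded hg hC _)
  have h1 := tendsto_borelAt Φ (memLp_bounded hg hC _)
    (tendsto_eLpNorm_mono (Measure.le_add_right le_rfl) hf)
  have hf' := tendsto_eLpNorm_mono (Measure.le_add_left le_rfl) hf
  have h2 := tendsto_borelAt Φ (memLp_bounded hg hC _)
    (tendsto_eLpNorm_mono (Measure.le_add_right le_rfl) hf')
  have h3 := tendsto_borelAt Φ (memLp_bounded hg hC _)
    (tendsto_eLpNorm_mono (Measure.le_add_left le_rfl) hf')
  simp_rw [map_add] at h1
  exact tendsto_nhds_unique h1 (h2.add h3)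

theorem borelAt_vector_smul (hg : Measurable g) (hC : ∀ t, ‖g t‖ ≤ C) (c : ℂ) (x : H) :
    borelAt Φ g (c • x) = c • borelAt Φ g x := by
  obtain ⟨f, hf⟩ := exists_approx (repMeasure Φ (c • x) + repMeasure Φ x)
    (memLp_bounded hg hC _)
  have h1 := tendsto_borelAt Φ (memLp_bounded hg hC _)
    (tendsto_eLpNorm_mono (Measure.le_add_right le_rfl) hf)
  have h2 := tendsto_borelAt Φ (memLp_bounded hg hC _)
    (tendsto_eLpNorm_mono (Measure.le_add_left le_rfl) hf)
  simp_rw [map_smul] at h1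
  exact tendsto_nhds_unique h1 (h2.const_smul c)

theorem map_borelAt (f : C(X, ℂ)) (hg : Measurable g) (hC : ∀ t, ‖g t‖ ≤ C) (x : H) :
    Φ f (borelAt Φ g x) = borelAt Φ (f * g) x := by
  obtain ⟨u, hu⟩ := exists_approx (repMeasure Φ x) (memLp_bounded hg hC _)
  have h1 := ((Φ f).continuous.tendsto _).comp (tendsto_borelAt Φ (memLp_bounded hg hC _) hu)
  refine tendsto_nhds_unique h1 ?_
  have h2 : ∀ n, (Φ f ∘ fun n => Φ (u n) x) n = Φ (f * u n) x := fun n => by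
    rw [map_mul]; rfl
  simp_rw [Function.comp_def] at h2 ⊢
  simp_rw [h2]
  refine tendsto_borelAt Φ (memLp_bounded (C := ‖f‖ * C) (f.continuous.measurable.mul hg)
    (fun t => ?_) _) ?_
  · rw [Pi.mul_apply, norm_mul]
    exact mul_le_mul (f.norm_coe_le_norm t) (hC t) (norm_nonneg _) (norm_nonneg _)
  · simpa only [ContinuousMap.coe_mul, mul_sub] using
      tendsto_eLpNorm_mul (h := f) f.norm_coe_le_norm hu

theorem borelAt_borelAt {C' : ℝ} (hg : Measurable g) (hC : ∀ t, ‖g t‖ ≤ C) (hh : Measurable h)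
    (hC' : ∀ t, ‖h t‖ ≤ C') (x : H) :
    borelAt Φ g (borelAt Φ h x) = borelAt Φ (h * g) x := by
  obtain ⟨u, hu⟩ := exists_approx (repMeasure Φ (borelAt Φ h x) + repMeasure Φ x)
    (memLp_bounded hg hC _)
  have h1 := tendsto_borelAt Φ (memLp_bounded hg hC _)
    (tendsto_eLpNorm_mono (Measure.le_add_right le_rfl) hu)
  have h2 := tendsto_eLpNorm_mul (h := h) hC' (tendsto_eLpNorm_mono (Measure.le_add_left le_rfl) hu)
  simp_rw [map_borelAt Φ _ hh hC'] at h1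
  refine tendsto_nhds_unique h1 ?_
  rw [← tendsto_sub_nhds_zero_iff, tendsto_zero_iff_enorm_tendsto_zero]
  refine h2.congr fun n => ?_
  have m1 : MemLp (⇑(u n) * h) 2 (repMeasure Φ x) :=
    memLp_bounded (C := ‖u n‖ * C') ((u n).continuous.measurable.mul hh) (fun t => by
      rw [Pi.mul_apply, norm_mul]
      exact mul_le_mul ((u n).norm_coe_le_norm t) (hC' t) (norm_nonneg _) (norm_nonneg _)) _
  have m2 : MemLp (h * g) 2 (repMeasure Φ x) :=
    memLp_bounded (C := C' * C) (hh.mul hg) (fun t => by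
      rw [Pi.mul_apply, norm_mul]
      exact mul_le_mul (hC' t) (hC t) (norm_nonneg _) ((norm_nonneg _).trans (hC' t))) _
  rw [← borelAt_sub Φ m1 m2, enorm_borelAt Φ (m1.sub m2), mul_sub, mul_comm h]

theorem inner_borelAt (hg : Measurable g) (hC : ∀ t, ‖g t‖ ≤ C) (x y : H) :
    ⟪borelAt Φ g x, y⟫_ℂ = ⟪x, borelAt Φ (star g) y⟫_ℂ := by
  obtain ⟨u, hu⟩ := exists_approx (repMeasure Φ x + repMeasure Φ y) (memLp_bounded hg hC _)
  have h1 := (tendsto_borelAt Φ (memLp_bounded hg hC _)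
    (tendsto_eLpNorm_mono (Measure.le_add_right le_rfl) hu)).inner
    (tendsto_const_nhds (x := y)) (𝕜 := ℂ)
  have h2 := tendsto_borelAt Φ (f := fun n => star (u n)) (g := star g) (x := y)
    (memLp_bounded (C := C) (Complex.continuous_conj.measurable.comp hg)
      (fun t => by simpa using hC t) _) (by
      refine (tendsto_eLpNorm_mono (Measure.le_add_left le_rfl) hu).congr fun n => ?_
      refine eLpNorm_congr_norm_ae (ae_of_all _ fun t => ?_)
      simp only [Pi.sub_apply, Pi.star_apply, ContinuousMap.star_apply, ← star_sub, norm_star])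
  simp_rw [inner_map] at h1
  exact tendsto_nhds_unique h1 ((tendsto_const_nhds (x := x)).inner h2 (𝕜 := ℂ))

end ContinuousRep

/-! ### The spectral measure on the line given by a real function -/

namespace ContinuousRep

variable {H : Type*} [NormedAddCommGroup H] [InnerProductSpace ℂ H] [CompleteSpace H]

section

variable {X : Type*} (π : X → ℝ)

/-- The indicator function of `π ⁻¹ S`. -/
def preimageIndicator (S : Set ℝ) : X → ℂ := (π ⁻¹' S).indicator fun _ => 1

theorem norm_preimageIndicator_le (S : Set ℝ) (t : X) : ‖preimageIndicator π S t‖ ≤ 1 :=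
  (norm_indicator_le_norm_self _ _).trans (by simp)

variable {π}

theorem measurable_preimageIndicator [MeasurableSpace X] (hπ : Measurable π) {S : Set ℝ}
    (hS : MeasurableSet S) :
    Measurable (preimageIndicator π S) := measurable_const.indicator (hπ hS)

theorem memLp_preimageIndicator [MeasurableSpace X] (hπ : Measurable π) {S : Set ℝ}
    (hS : MeasurableSet S) (μ : Measure X) [IsFiniteMeasure μ] :
    MemLp (preimageIndicator π S) 2 μ :=
  memLp_bounded (measurable_preimageIndicator hπ hS) (norm_preimageIndicator_le π S) μ

theorem preimageIndicator_union {S T : Set ℝ} (h : Disjoint S T) :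
    preimageIndicator π (S ∪ T) = preimageIndicator π S + preimageIndicator π T := by
  rw [preimageIndicator, Set.preimage_union, Set.indicator_union_of_disjoint (h.preimage π)]
  rfl

end

variable {X : Type*} [MetricSpace X] [CompactSpace X] [MeasurableSpace X] [BorelSpace X]
variable (Φ : C(X, ℂ) →⋆ₐ[ℂ] (H →L[ℂ] H)) {g : X → ℂ} {C : ℝ}

theorem norm_borelAt_le (hg : Measurable g) (hC : ∀ t, ‖g t‖ ≤ C) (x : H) :
    ‖borelAt Φ g x‖ ≤ C * ‖x‖ := by
  -- If `X` is empty, then `1 = 0` in `C(X, ℂ)`, so that `H` is trivial; `C` may then be negative.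
  rcases isEmpty_or_nonempty X with hX | ⟨⟨t₀⟩⟩
  · have h0 : g = 0 := Subsingleton.elim _ _
    have h1 : (1 : C(X, ℂ)) = 0 := Subsingleton.elim _ _
    have h2 : x = 0 := by
      have := DFunLike.congr_fun (map_one Φ) x
      rw [h1, map_zero] at this
      exact this.symm
    have h3 := borelAt_vector_smul Φ hg hC 0 x
    simp only [zero_smul] at h3
    rw [h2, h3]
    simp
  have hC0 : 0 ≤ C := (norm_nonneg _).trans (hC t₀)
  have h1 := enorm_borelAt Φ (memLp_bounded hg hC (repMeasure Φ x))
  have h2 : eLpNorm g 2 (repMeasure Φ x)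
      ≤ ENNReal.ofReal C * eLpNorm (1 : C(X, ℂ)) 2 (repMeasure Φ x) :=
    eLpNorm_le_mul_eLpNorm_of_ae_le_mul (ae_of_all _ fun t => by simpa using hC t) 2
  rw [← h1, ← enorm_map, map_one, one_apply_eq_self, ← ofReal_norm, ← ofReal_norm,
    ← ENNReal.ofReal_mul hC0, ENNReal.ofReal_le_ofReal_iff (by positivity)] at h2
  exact h2

/-- The bounded operator attached to a bounded Borel function on `X`. -/
def borelOperator (hg : Measurable g) (hC : ∀ t, ‖g t‖ ≤ C) : H →L[ℂ] H :=
  LinearMap.mkContinuous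
    { toFun := borelAt Φ g
      map_add' := borelAt_vector_add Φ hg hC
      map_smul' := borelAt_vector_smul Φ hg hC } C (norm_borelAt_le Φ hg hC)

variable {π : X → ℝ}

theorem borelOperator_apply (hg : Measurable g) (hC : ∀ t, ‖g t‖ ≤ C) (x : H) :
    borelOperator Φ hg hC x = borelAt Φ g x := rfl

theorem enorm_borelAt_preimageIndicator (hπ : Measurable π) {S : Set ℝ} (hS : MeasurableSet S)
    (x : H) : ‖borelAt Φ (preimageIndicator π S) x‖ₑ
      = repMeasure Φ x (π ⁻¹' S) ^ (1 / (2 : ℝ)) := by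
  rw [enorm_borelAt Φ (memLp_preimageIndicator hπ hS _), preimageIndicator,
    eLpNorm_indicator_const (hπ hS) (by norm_num) (by norm_num)]
  simp

theorem hasSum_borelAt_preimageIndicator (hπ : Measurable π) {S : ℕ → Set ℝ}
    (hS : ∀ n, MeasurableSet (S n)) (hd : Pairwise fun m n => Disjoint (S m) (S n)) (x : H) :
    HasSum (fun n => borelAt Φ (preimageIndicator π (S n)) x)
      (borelAt Φ (preimageIndicator π (⋃ n, S n)) x) := by
  have hU : MeasurableSet (⋃ n, S n) := MeasurableSet.iUnion hS
  have hV : ∀ F : Finset ℕ, MeasurableSet (⋃ n ∈ F, S n) := fun F =>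
    F.measurableSet_biUnion fun n _ => hS n
  have hsum : ∀ F : Finset ℕ, ∑ n ∈ F, borelAt Φ (preimageIndicator π (S n)) x
      = borelAt Φ (preimageIndicator π (⋃ n ∈ F, S n)) x := by
    intro F
    classical
    induction F using Finset.induction_on with
    | empty =>
      have h := enorm_borelAt_preimageIndicator Φ hπ (hV ∅) x
      simp only [Finset.notMem_empty, Set.iUnion_of_empty, Set.iUnion_empty, Set.preimage_empty,
        measure_empty] at h ⊢
      rw [ENNReal.zero_rpow_of_pos (by norm_num), enorm_eq_zero] at h
      rw [h, Finset.sum_empty]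
    | insert a F ha ih =>
      have hdis : Disjoint (S a) (⋃ n ∈ F, S n) := by
        simp only [Set.disjoint_iUnion_right]
        exact fun n hn => hd (fun h => ha (h ▸ hn))
      rw [Finset.sum_insert ha, ih, Finset.set_biUnion_insert, preimageIndicator_union hdis,
        borelAt_add Φ (memLp_preimageIndicator hπ (hS a) _) (memLp_preimageIndicator hπ (hV F) _)]
  have hdiff : ∀ F : Finset ℕ, ‖borelAt Φ (preimageIndicator π (⋃ n, S n)) x
      - ∑ n ∈ F, borelAt Φ (preimageIndicator π (S n)) x‖ₑ
      = (repMeasure Φ x (π ⁻¹' ⋃ n, S n) - ∑ n ∈ F, repMeasure Φ x (π ⁻¹' S n))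
        ^ (1 / (2 : ℝ)) := by
    intro F
    have hsub : (⋃ n ∈ F, S n) ⊆ ⋃ n, S n := Set.iUnion₂_subset fun n _ => Set.subset_iUnion S n
    have e : preimageIndicator π (⋃ n, S n)
        = preimageIndicator π (⋃ n ∈ F, S n) + preimageIndicator π ((⋃ n, S n) \ ⋃ n ∈ F, S n) := by
      rw [← preimageIndicator_union Set.disjoint_sdiff_right, Set.union_sdiff_cancel hsub]
    rw [hsum, e, borelAt_add Φ (memLp_preimageIndicator hπ (hV F) _)
      (memLp_preimageIndicator hπ (hU.diff (hV F)) _), add_sub_cancel_left,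
      enorm_borelAt_preimageIndicator Φ hπ (hU.diff (hV F)), Set.preimage_sdiff,
      measure_sdiff (Set.preimage_mono hsub) (hπ (hV F)).nullMeasurableSet (measure_ne_top _ _)]
    congr 2
    simp_rw [Set.preimage_iUnion]
    exact measure_biUnion_finset (fun m _ n _ hmn => (hd hmn).preimage π) fun n _ => hπ (hS n)
  have hm : HasSum (fun n => repMeasure Φ x (π ⁻¹' S n)) (repMeasure Φ x (π ⁻¹' ⋃ n, S n)) := by
    rw [Set.preimage_iUnion, measure_iUnion (fun m n hmn => (hd hmn).preimage π)
      fun n => hπ (hS n)]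
    exact ENNReal.summable.hasSum
  have hlim : Tendsto (fun F : Finset ℕ => (repMeasure Φ x (π ⁻¹' ⋃ n, S n)
      - ∑ n ∈ F, repMeasure Φ x (π ⁻¹' S n)) ^ (1 / (2 : ℝ))) atTop (𝓝 0) := by
    have h := ENNReal.Tendsto.sub (tendsto_const_nhds (x := repMeasure Φ x (π ⁻¹' ⋃ n, S n)))
      hm (Or.inl (measure_ne_top _ _))
    rw [tsub_self] at h
    simpa using h.ennrpow_const (1 / (2 : ℝ))
  rw [HasSum, SummationFilter.unconditional_filter, ← tendsto_sub_nhds_zero_iff,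
    tendsto_zero_iff_enorm_tendsto_zero]
  refine hlim.congr fun F => ?_
  rw [← hdiff, enorm_sub_rev]

theorem borelAt_one (x : H) : borelAt Φ (fun _ => 1) x = x := by
  have h := borelAt_continuous Φ 1 x
  rw [map_one] at h
  exact h

open Classical in
/-- The image under `π : X → ℝ` of the spectral measure on `X` defined by `Φ`. -/
def spectralMeasure (hπ : Measurable π) : SpectralMeasure H where
  proj S := if hS : MeasurableSet S then
    borelOperator Φ (measurable_preimageIndicator hπ hS) (norm_preimageIndicator_le π S) else 0
  isStarProjection S hS := by
    rw [dif_pos hS]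
    refine ⟨?_, ?_⟩
    · ext x
      refine (borelAt_borelAt Φ (measurable_preimageIndicator hπ hS) (norm_preimageIndicator_le π S)
        (measurable_preimageIndicator hπ hS) (norm_preimageIndicator_le π S) x).trans ?_
      change _ = borelAt Φ (preimageIndicator π S) x
      congr 1
      ext t
      by_cases ht : t ∈ π ⁻¹' S <;> simp [preimageIndicator, ht]
    · rw [ContinuousLinearMap.isSelfAdjoint_iff_isSymmetric]
      intro x y
      refine (inner_borelAt Φ (measurable_preimageIndicator hπ hS)
        (norm_preimageIndicator_le π S) x y).trans ?_
      change _ = ⟪x, borelAt Φ (preimageIndicator π S) y⟫_ℂ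
      congr 2
      ext t
      by_cases ht : t ∈ π ⁻¹' S <;> simp [preimageIndicator, ht]
  proj_univ := by
    rw [dif_pos MeasurableSet.univ]
    ext x
    refine Eq.trans ?_ (borelAt_one Φ x)
    change borelAt Φ (preimageIndicator π Set.univ) x = _
    congr 1
    simp [preimageIndicator]
  hasSum_iUnion S hS hd x := by
    simp only [dif_pos (hS _), dif_pos (MeasurableSet.iUnion hS)]
    exact hasSum_borelAt_preimageIndicator Φ hπ hS hd x

theorem spectralMeasure_proj_apply (hπ : Measurable π) {S : Set ℝ} (hS : MeasurableSet S) (x : H) :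
    (spectralMeasure Φ hπ).proj S x = borelAt Φ (preimageIndicator π S) x := by
  simp only [spectralMeasure, dif_pos hS]
  rfl

theorem scalar_spectralMeasure (hπ : Measurable π) (x : H) :
    (spectralMeasure Φ hπ).scalar x = (repMeasure Φ x).map π := by
  refine Measure.ext fun S hS => ?_
  rw [SpectralMeasure.scalar_apply _ x hS, Measure.map_apply hπ hS,
    spectralMeasure_proj_apply Φ hπ hS, ENNReal.ofReal_pow (norm_nonneg _), ofReal_norm,
    enorm_borelAt_preimageIndicator Φ hπ hS, ← ENNReal.rpow_natCast, ← ENNReal.rpow_mul]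
  norm_num

theorem simpleIntegral_spectralMeasure (hπ : Measurable π) (φ : SimpleFunc ℝ ℂ) (x : H) :
    (spectralMeasure Φ hπ).simpleIntegral φ x = borelAt Φ (φ ∘ π) x := by
  have hsum : ∀ F : Finset ℂ, MemLp (∑ c ∈ F, c • preimageIndicator π (φ ⁻¹' {c})) 2
      (repMeasure Φ x) ∧ borelAt Φ (∑ c ∈ F, c • preimageIndicator π (φ ⁻¹' {c})) x
        = ∑ c ∈ F, c • borelAt Φ (preimageIndicator π (φ ⁻¹' {c})) x := by
    intro F
    classical
    induction F using Finset.induction_on with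
    | empty =>
      refine ⟨by simp, ?_⟩
      have h := borelAt_const_smul Φ (x := x) 0 (g := 0) (by simp)
      simpa using h
    | insert a F ha ih =>
      have h1 := (memLp_preimageIndicator hπ (φ.measurableSet_fiber a) (repMeasure Φ x))
      rw [Finset.sum_insert ha, Finset.sum_insert ha]
      exact ⟨(h1.const_smul a).add ih.1, by
        rw [borelAt_add Φ (h1.const_smul a) ih.1, borelAt_const_smul Φ a h1, ih.2]⟩
  have e : φ ∘ π = ∑ c ∈ φ.range, c • preimageIndicator π (φ ⁻¹' {c}) := by
    ext t
    rw [Finset.sum_apply, Finset.sum_eq_single (φ (π t))]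
    · simp [preimageIndicator]
    · intro c _ hc
      simp [preimageIndicator, hc.symm]
    · exact fun h => (h (φ.mem_range_self _)).elim
  rw [e, (hsum _).2]
  simp only [SpectralMeasure.simpleIntegral, _root_.sum_apply, smul_apply,
    spectralMeasure_proj_apply Φ hπ (φ.measurableSet_fiber _)]

theorem integralAt_spectralMeasure (hπ : Measurable π) {h : ℝ → ℂ} (hh : Measurable h)
    (hC : ∀ t, ‖h t‖ ≤ C) (x : H) :
    (spectralMeasure Φ hπ).integralAt hh x = borelAt Φ (h ∘ π) x := by
  set E := spectralMeasure Φ hπ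
  have hL := E.memLp_of_bounded hh hC x
  refine tendsto_nhds_unique (E.tendsto_simpleIntegral h hh hL) ?_
  rw [← tendsto_sub_nhds_zero_iff, tendsto_zero_iff_enorm_tendsto_zero]
  refine (E.tendsto_eLpNorm_approx hh hL).congr fun n => ?_
  have m1 : MemLp (SpectralMeasure.approx h hh n ∘ π) 2 (repMeasure Φ x) := by
    have h1 := SimpleFunc.memLp_of_isFiniteMeasure (SpectralMeasure.approx h hh n) 2 (E.scalar x)
    rw [scalar_spectralMeasure Φ hπ] at h1
    exact h1.comp_of_map hπ.aemeasurable
  have m2 : MemLp (h ∘ π) 2 (repMeasure Φ x) := memLp_bounded (hh.comp hπ) (fun t => hC _) _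
  rw [simpleIntegral_spectralMeasure, ← borelAt_sub Φ m1 m2, enorm_borelAt Φ (m1.sub m2),
    scalar_spectralMeasure Φ hπ, eLpNorm_map_measure
      ((SimpleFunc.measurable _).sub hh).aestronglyMeasurable hπ.aemeasurable]
  rfl

end ContinuousRep

/-! ### The spectral theorem for unbounded self-adjoint operators -/

namespace SelfAdjointOperator

variable {H : Type*} [NormedAddCommGroup H] [InnerProductSpace ℂ H] [CompleteSpace H]
variable {T : H →ₗ.[ℂ] H}

theorem inner_map_of_isSelfAdjoint (hT : IsSelfAdjoint T) (x y : T.domain) :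
    ⟪T x, (y : H)⟫_ℂ = ⟪(x : H), T y⟫_ℂ := by
  have h := LinearPMap.adjoint_isFormalAdjoint hT.dense_domain
  rw [show T.adjoint = T from hT] at h
  exact h x y

/-- A self-adjoint operator contains every weak solution `T y = z` in its graph. -/
theorem exists_of_inner_eq (hT : IsSelfAdjoint T) {y z : H}
    (h : ∀ x : T.domain, ⟪z, (x : H)⟫_ℂ = ⟪y, T x⟫_ℂ) : ∃ hy : y ∈ T.domain, T ⟨y, hy⟩ = z := by
  have h1 : y ∈ T.adjoint.domain := LinearPMap.mem_adjoint_domain_of_exists y ⟨z, h⟩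
  have h2 := LinearPMap.adjoint_apply_eq hT.dense_domain ⟨y, h1⟩ h
  have h3 : T.adjoint = T := hT
  have h4 : (y, z) ∈ T.adjoint.graph := by
    rw [LinearPMap.mem_graph_iff]
    exact ⟨⟨y, h1⟩, rfl, h2⟩
  rw [h3, LinearPMap.mem_graph_iff] at h4
  obtain ⟨⟨w, hw⟩, rfl, hwz⟩ := h4
  exact ⟨hw, hwz⟩

theorem norm_sq_add_smul (hT : IsSelfAdjoint T) {c : ℂ} (hc : c.re = 0) (hc1 : ‖c‖ = 1)
    (x : T.domain) : ‖T x + c • (x : H)‖ ^ 2 = ‖T x‖ ^ 2 + ‖(x : H)‖ ^ 2 := by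
  have h1 : (⟪T x, (x : H)⟫_ℂ).im = 0 := by
    have h2 := inner_map_of_isSelfAdjoint hT x x
    rw [← inner_conj_symm] at h2
    have h3 := congrArg Complex.im h2
    have h4 : (⟪(x : H), T x⟫_ℂ).im = 0 := by
      rw [Complex.conj_im] at h3; linarith
    rw [inner_map_of_isSelfAdjoint hT x x, h4]
  rw [norm_add_sq (𝕜 := ℂ), inner_smul_right, norm_smul, hc1, one_mul, RCLike.re_to_complex,
    Complex.mul_re, h1, hc]
  ring

/-- The map `x ↦ T x + c x` on the domain of `T`. -/
def shift (T : H →ₗ.[ℂ] H) (c : ℂ) : T.domain →ₗ[ℂ] H := T.toFun + c • T.domain.subtype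

omit [CompleteSpace H] in
theorem shift_apply (c : ℂ) (x : T.domain) : shift T c x = T x + c • (x : H) := rfl

theorem norm_le_norm_shift (hT : IsSelfAdjoint T) {c : ℂ} (hc : c.re = 0) (hc1 : ‖c‖ = 1)
    (x : T.domain) : ‖(x : H)‖ ≤ ‖shift T c x‖ ∧ ‖T x‖ ≤ ‖shift T c x‖ := by
  have h := norm_sq_add_smul hT hc hc1 x
  rw [show T x + c • (x : H) = shift T c x from rfl] at h
  exact ⟨abs_le_of_sq_le_sq' (by nlinarith) (norm_nonneg _) |>.2,
    abs_le_of_sq_le_sq' (by nlinarith) (norm_nonneg _) |>.2⟩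

/-- The points `±i` are not in the spectrum of a self-adjoint operator (the hypotheses on `c` say
`c = ±i`). -/
theorem shift_bijective (hT : IsSelfAdjoint T) {c : ℂ} (hc : c.re = 0) (hc1 : ‖c‖ = 1) :
    Function.Bijective (shift T c) := by
  have hinj : ∀ c : ℂ, c.re = 0 → ‖c‖ = 1 → Function.Injective (shift T c) := by
    intro c hc hc1
    rw [injective_iff_map_eq_zero]
    intro x hx
    have h := (norm_le_norm_shift hT hc hc1 x).1
    rw [hx, norm_zero] at h
    exact Subtype.ext (norm_le_zero_iff.1 h)
  refine ⟨hinj c hc hc1, ?_⟩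
  -- The range is closed, as the image of the complete graph of `T` under an expanding map.
  let G := T.graph
  have hG : CompleteSpace G := (show IsClosed (G : Set (H × H)) from hT.isClosed).completeSpace_coe
  let L : G →L[ℂ] H :=
    (ContinuousLinearMap.snd ℂ H H + c • ContinuousLinearMap.fst ℂ H H).comp G.subtypeL
  have hL : ∀ p : G, ∃ x : T.domain, (p : H × H) = ((x : H), T x) ∧ L p = shift T c x := by
    rintro ⟨⟨a, b⟩, hp⟩
    obtain ⟨x, rfl, hx⟩ := (LinearPMap.mem_graph_iff T).1 hp
    simp only at hx
    subst hx
    exact ⟨x, rfl, rfl⟩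
  have hanti : AntilipschitzWith 1 L := by
    refine AddMonoidHomClass.antilipschitz_of_bound L fun p => ?_
    obtain ⟨x, hx, hx'⟩ := hL p
    rw [hx', NNReal.coe_one, one_mul, Submodule.coe_norm, hx]
    exact max_le (norm_le_norm_shift hT hc hc1 x).1 (norm_le_norm_shift hT hc hc1 x).2
  have hclosed : IsClosed (Set.range L) := hanti.isClosed_range L.uniformContinuous
  have hrange : Set.range L = Set.range (shift T c) := by
    ext y
    constructor
    · rintro ⟨p, rfl⟩
      obtain ⟨x, -, hx⟩ := hL p
      exact ⟨x, hx.symm⟩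
    · rintro ⟨x, rfl⟩
      exact ⟨⟨((x : H), T x), LinearPMap.mem_graph T x⟩, rfl⟩
  rw [hrange] at hclosed
  let R : Submodule ℂ H := LinearMap.range (shift T c)
  have hR : IsClosed (R : Set H) := hclosed
  have : CompleteSpace R := hR.completeSpace_coe
  have htop : R = ⊤ := by
    rw [← Submodule.orthogonal_eq_bot_iff, Submodule.eq_bot_iff]
    intro y hy
    have h1 : ∀ x : T.domain, ⟪-(starRingEnd ℂ c • y), (x : H)⟫_ℂ = ⟪y, T x⟫_ℂ := by
      intro x
      have h2 : ⟪y, shift T c x⟫_ℂ = 0 :=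
        (Submodule.mem_orthogonal' R y).1 hy _ (LinearMap.mem_range_self _ x)
      rw [shift_apply, inner_add_right, inner_smul_right] at h2
      rw [inner_neg_left, inner_smul_left, RingHomCompTriple.comp_apply, RingHom.id_apply]
      linear_combination -h2
    obtain ⟨hyd, hy2⟩ := exists_of_inner_eq hT h1
    have h3 : shift T (starRingEnd ℂ c) ⟨y, hyd⟩ = 0 := by
      rw [shift_apply, hy2]
      simp
    have h4 := hinj (starRingEnd ℂ c) (by simpa using hc) (by simpa using hc1)
      (h3.trans (map_zero _).symm)
    exact congrArg Subtype.val h4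
  intro y
  have : y ∈ R := htop ▸ Submodule.mem_top
  exact this

theorem exists_resolvent (hT : IsSelfAdjoint T) {c : ℂ} (hc : c.re = 0) (hc1 : ‖c‖ = 1) :
    ∃ R : H →L[ℂ] H, (∀ x : T.domain, R (T x + c • (x : H)) = x) ∧
      ∀ y, ∃ h : R y ∈ T.domain, T ⟨R y, h⟩ + c • R y = y := by
  let e := LinearEquiv.ofBijective (shift T c) (shift_bijective hT hc hc1)
  refine ⟨LinearMap.mkContinuous (T.domain.subtype ∘ₗ e.symm.toLinearMap) 1 fun y => ?_,
    fun x => ?_, fun y => ⟨(e.symm y).2, ?_⟩⟩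
  · rw [one_mul]
    refine (norm_le_norm_shift hT hc hc1 (e.symm y)).1.trans_eq ?_
    exact congrArg norm (e.apply_symm_apply y)
  · exact congrArg Subtype.val (e.symm_apply_apply x)
  · exact e.apply_symm_apply y

/-- The **spectral theorem**. The resolvent `R = (T + i)⁻¹` is normal, and its spectrum lies in
the circle `z̄ - z = 2 i z̄ z`, on which `z ↦ re z⁻¹` inverts `t ↦ (t + i)⁻¹`. The spectral measure
of `T` is the image under this map of the one that the continuous functional calculus of `R`
defines; the exceptional point `z = 0` has measure zero because `R` is injective. -/
theorem exists_spectralMeasure (hT : IsSelfAdjoint T) :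
    ∃ E : SpectralMeasure H, E.IsSpectralMeasureOf T := by
  have hI : Complex.I.re = 0 ∧ ‖Complex.I‖ = 1 := by simp
  obtain ⟨R, hR1, hR2⟩ := exists_resolvent hT hI.1 hI.2
  obtain ⟨R', hR1', hR2'⟩ := exists_resolvent hT (c := -Complex.I) (by simp) (by simp)
  -- `R` and `R'` are the resolvents of `T` at `-i` and `i`.
  have hadj : star R = R' := by
    rw [ContinuousLinearMap.star_eq_adjoint, eq_comm, ContinuousLinearMap.eq_adjoint_iff]
    intro u v
    obtain ⟨ha, hau⟩ := hR2' u
    obtain ⟨hb, hbv⟩ := hR2 v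
    have h := inner_map_of_isSelfAdjoint hT ⟨R' u, ha⟩ ⟨R v, hb⟩
    conv_lhs => rw [← hbv]
    conv_rhs => rw [← hau]
    rw [inner_add_left, inner_add_right, inner_smul_left, inner_smul_right, h]
    simp
  have hid : ∀ y, R' y - R y = (2 * Complex.I) • R' (R y) := by
    intro y
    obtain ⟨ha, hay⟩ := hR2 y
    have h := hR1' ⟨R y, ha⟩
    have e : T ⟨R y, ha⟩ + -Complex.I • R y = y - (2 * Complex.I) • R y := by
      rw [eq_sub_iff_add_eq]
      conv_rhs => rw [← hay]
      module
    rw [e, map_sub, map_smul] at h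
    rw [sub_eq_iff_eq_add, add_comm, ← sub_eq_iff_eq_add]
    exact h
  have hid' : ∀ y, R' y - R y = (2 * Complex.I) • R (R' y) := by
    intro y
    obtain ⟨ha, hay⟩ := hR2' y
    have h := hR1 ⟨R' y, ha⟩
    have e : T ⟨R' y, ha⟩ + Complex.I • R' y = y + (2 * Complex.I) • R' y := by
      rw [← sub_eq_iff_eq_add]
      conv_rhs => rw [← hay]
      module
    rw [e, map_add, map_smul] at h
    simp only at h
    conv_lhs => rw [← h]
    abel
  have hnormal : IsStarNormal R := by
    rw [isStarNormal_iff, hadj]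
    ext y
    have h := (hid y).symm.trans (hid' y)
    exact smul_right_injective H (by simp : (2 * Complex.I) ≠ 0) h
  let X := spectrum ℂ R
  have : CompactSpace X := isCompact_iff_compactSpace.1 (spectrum.isCompact R)
  let Φ : C(X, ℂ) →⋆ₐ[ℂ] (H →L[ℂ] H) := cfcHom hnormal
  let ι : C(X, ℂ) := (ContinuousMap.id ℂ).restrict X
  have hΦι : Φ ι = R := cfcHom_id hnormal
  -- The resolvent identity determines the spectrum of `R`.
  have hspec : ∀ z : X, starRingEnd ℂ (z : ℂ) - z
      = 2 * Complex.I * (starRingEnd ℂ (z : ℂ) * z) := by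
    have h1 : Φ (star ι - ι - (2 * Complex.I) • (star ι * ι)) = 0 := by
      rw [map_sub, map_sub, map_smul, map_mul, map_star, hΦι, hadj]
      ext y
      rw [sub_apply, sub_apply, hid]
      simp
    have h2 : star ι - ι - (2 * Complex.I) • (star ι * ι) = 0 :=
      (cfcHom_isClosedEmbedding hnormal).injective (h1.trans (map_zero _).symm)
    intro z
    exact sub_eq_zero.1 (DFunLike.congr_fun h2 z)
  let π : X → ℝ := fun z => ((z : ℂ)⁻¹).re
  have hπ : Measurable π := by
    exact Complex.measurable_re.comp (measurable_subtype_coe.inv)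
  have hπz : ∀ z : X, (z : ℂ) ≠ 0 → ((π z : ℂ) + Complex.I)⁻¹ = z := by
    intro z hz
    have hz' : starRingEnd ℂ (z : ℂ) ≠ 0 := by simpa using hz
    have h1 : (z : ℂ)⁻¹ - starRingEnd ℂ ((z : ℂ)⁻¹) = 2 * Complex.I := by
      rw [map_inv₀]
      field_simp
      rw [hspec z]
      ring
    have h2 : ((z : ℂ)⁻¹).im = 1 := by
      have := congrArg Complex.im h1
      simp only [Complex.sub_im, Complex.conj_im, Complex.mul_im, Complex.re_ofNat, Complex.I_im,
        Complex.im_ofNat, Complex.I_re] at this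
      linarith
    rw [← inv_inv (z : ℂ)]
    congr 1
    apply Complex.ext <;> simp [π, h2]
  let k : ℝ → ℂ := fun t => ((t : ℂ) + Complex.I)⁻¹
  have hk : Measurable k := by fun_prop
  have hne : ∀ t : ℝ, (t : ℂ) + Complex.I ≠ 0 := fun t h => by
    simpa using congrArg Complex.im h
  have hge : ∀ t : ℝ, 1 ≤ ‖(t : ℂ) + Complex.I‖ := fun t => by
    have := Complex.abs_im_le_norm ((t : ℂ) + Complex.I)
    simpa using this
  have hkC : ∀ t, ‖k t‖ ≤ 1 := fun t => by
    rw [norm_inv]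
    exact inv_le_one_of_one_le₀ (hge t)
  let E := ContinuousRep.spectralMeasure Φ hπ
  -- `R` is injective, so that the point `0` of its spectrum carries no mass.
  let q : X → ℂ := ({z : X | (z : ℂ) = 0}).indicator fun _ => 1
  have hqm : Measurable q :=
    measurable_const.indicator (measurable_subtype_coe (measurableSet_singleton 0))
  have hqC : ∀ z, ‖q z‖ ≤ 1 := fun z => (norm_indicator_le_norm_self _ _).trans (by simp)
  have hRinj : ∀ y, R y = 0 → y = 0 := by
    intro y hy
    obtain ⟨ha, hay⟩ := hR2 y
    have : (⟨R y, ha⟩ : T.domain) = 0 := Subtype.ext hy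
    rw [this, LinearPMap.map_zero, hy, smul_zero, add_zero] at hay
    exact hay.symm
  have hq0 : ∀ x, ContinuousRep.borelAt Φ q x = 0 := by
    intro x
    refine hRinj _ ?_
    have h := ContinuousRep.map_borelAt Φ ι hqm hqC x
    have e : ⇑ι * q = ⇑(0 : C(X, ℂ)) := by
      ext z
      by_cases hz : (z : ℂ) = 0
      · simp [ι, hz]
      · simp [q, hz]
    rw [hΦι, e, ContinuousRep.borelAt_continuous, map_zero] at h
    exact h
  have hER : ∀ x, E.integralAt hk x = R x := by
    intro x
    have hkπ : Measurable (k ∘ π) := hk.comp hπ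
    have m1 := ContinuousRep.memLp_bounded (C := 1) hkπ (fun t => hkC _)
      (ContinuousRep.repMeasure Φ x)
    have m2 := ContinuousRep.memLp_continuous ι (ContinuousRep.repMeasure Φ x)
    have hb : ∀ z : X, ‖(k ∘ π - ⇑ι) z‖ ≤ 1 + ‖ι‖ := fun z =>
      (norm_sub_le _ _).trans (add_le_add (hkC _) (ι.norm_coe_le_norm z))
    have e : k ∘ π - ⇑ι = q * (k ∘ π - ⇑ι) := by
      ext z
      by_cases hz : (z : ℂ) = 0
      · simp [q, hz]
      · have := hπz z hz
        simp [q, hz, ι, k, this]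
    rw [ContinuousRep.integralAt_spectralMeasure Φ hπ hk hkC, ← hΦι,
      ← ContinuousRep.borelAt_continuous, ← sub_eq_zero, ← ContinuousRep.borelAt_sub Φ m1 m2, e,
      ← ContinuousRep.borelAt_borelAt Φ (hkπ.sub ι.continuous.measurable) hb hqm hqC, hq0,
      ← ContinuousRep.borelOperator_apply Φ (hkπ.sub ι.continuous.measurable) hb, map_zero]
  refine ⟨E, ?_⟩
  have hidm : Measurable fun t : ℝ => (t : ℂ) := Complex.measurable_ofReal
  -- Every vector of the domain is `R y = (∫ (t + i)⁻¹ dE) y`, so `T ≤ ∫ t dE`.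
  have hle : T ≤ E.integral (fun t : ℝ => (t : ℂ)) Complex.measurable_ofReal := by
    have key : ∀ x : T.domain, MemLp (fun t : ℝ => (t : ℂ)) 2 (E.scalar (x : H)) ∧
        E.integralAt hidm (x : H) = T x := by
      intro x
      set y := T x + Complex.I • (x : H) with hy
      have hx : (x : H) = E.integralAt hk y := (hER y).symm ▸ (hR1 x).symm
      have hky := E.memLp_of_bounded hk hkC y
      have e : (fun t : ℝ => (t : ℂ) * k t) = fun t => 1 - Complex.I * k t := by
        ext t
        have := hne t
        simp only [k]
        field_simp
        ring
      have hIk : Measurable fun t => Complex.I * k t := measurable_const.mul hk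
      have m1 : MemLp (fun t => Complex.I * k t) 2 (E.scalar y) := hky.const_mul _
      have m2 : MemLp (fun t : ℝ => (t : ℂ) * k t) 2 (E.scalar y) := by
        rw [e]
        exact (memLp_const 1).sub m1
      rw [hx]
      refine ⟨(E.memLp_scalar_integralAt hk hky hidm).2 m2, ?_⟩
      rw [E.integralAt_integralAt hk hidm hky m2]
      have h1 := E.integralAt_sub measurable_const hIk (memLp_const 1) m1
      have h2 := E.integralAt_integralAt hk measurable_const hky m1
      rw [E.integralAt_const, ← hx] at h2
      rw [E.integralAt_const, ← show E.integralAt (measurable_const.mul hk) y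
        = E.integralAt hIk y from rfl, ← h2, one_smul] at h1
      refine Eq.trans ?_ (h1.trans ?_)
      · congr 1
      · rw [hy]; abel
    refine ⟨fun x hx => (key ⟨x, hx⟩).1, ?_⟩
    intro x y hxy
    rw [SpectralMeasure.integral_apply, ← hxy]
    exact (key x).2.symm
  refine (LinearPMap.eq_of_le_of_domain_eq hle
    (le_antisymm (LinearPMap.domain_mono.monotone hle) fun x hx => ?_)).symm
  -- Conversely, `x = R ((∫ (t + i) dE) x)` for `x` in the domain of `∫ t dE`.
  have hx : MemLp (fun t : ℝ => (t : ℂ)) 2 (E.scalar x) := hx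
  have hs : Measurable fun t : ℝ => (t : ℂ) + Complex.I := by fun_prop
  have m1 : MemLp (fun t : ℝ => (t : ℂ) + Complex.I) 2 (E.scalar x) := hx.add (memLp_const _)
  have e : (fun t : ℝ => k t * ((t : ℂ) + Complex.I)) = fun _ => 1 := by
    ext t
    exact inv_mul_cancel₀ (hne t)
  have m2 : MemLp (fun t : ℝ => k t * ((t : ℂ) + Complex.I)) 2 (E.scalar x) := by
    rw [e]; exact memLp_const 1
  have h := E.integralAt_integralAt hs hk m1 m2
  have h1 : E.integralAt (hk.mul hs) x = x := by
    refine Eq.trans ?_ ((E.integralAt_const 1 x).trans (one_smul _ _))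
    congr 1
  rw [hER, h1] at h
  obtain ⟨hd, -⟩ := hR2 (E.integralAt hs x)
  rwa [h] at hd

end SelfAdjointOperator

/-! ### Powers of an injective positive bounded operator -/

namespace PositiveOperator

open scoped NNReal

variable {H : Type*} [NormedAddCommGroup H] [InnerProductSpace ℂ H] [CompleteSpace H]
variable {B : H →L[ℂ] H}

theorem rpow_add {s t : ℝ} (hs : 0 ≤ s) (ht : 0 ≤ t) :
    B ^ (s + t) = B ^ s * B ^ t := by
  simp only [CFC.rpow_def]
  rw [← cfc_mul _ _ B (NNReal.continuous_rpow_const hs).continuousOn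
    (NNReal.continuous_rpow_const ht).continuousOn]
  refine cfc_congr fun x _ => ?_
  exact NNReal.rpow_add_of_nonneg x hs ht

theorem rpow_rpow_apply {s t : ℝ} (hs : 0 ≤ s) (ht : 0 ≤ t) (x : H) :
    (B ^ s) ((B ^ t) x) = (B ^ (s + t)) x := by
  rw [rpow_add hs ht, mul_apply_eq_comp]

theorem inner_rpow (s : ℝ) (x y : H) : ⟪(B ^ s) x, y⟫_ℂ = ⟪x, (B ^ s) y⟫_ℂ :=
  (CFC.rpow_nonneg (a := B) (y := s)).isSelfAdjoint.isSymmetric x y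

theorem rpow_injective (hB : 0 ≤ B) (hinj : Function.Injective B) {s : ℝ} (hs : 0 ≤ s) :
    Function.Injective (B ^ s : H →L[ℂ] H) := by
  obtain ⟨n, hn⟩ := exists_nat_ge s
  have h1 : Function.Injective (B ^ (n : ℝ) : H →L[ℂ] H) := by
    rw [CFC.rpow_natCast B n hB]
    clear hn
    induction n with
    | zero => intro x y h; simpa using h
    | succ n ih =>
      intro x y h
      rw [pow_succ', mul_apply_eq_comp, mul_apply_eq_comp] at h
      exact ih (hinj h)
  intro x y h
  apply h1
  have e : ((n : ℝ) - s) + s = n := by ring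
  rw [← e, ← rpow_rpow_apply (by linarith) hs, ← rpow_rpow_apply (by linarith) hs]
  exact congrArg _ h

theorem mem_range_rpow_mono {s t : ℝ} (hs : 0 ≤ s) (hst : s ≤ t) {x : H}
    (hx : x ∈ Set.range (B ^ t : H →L[ℂ] H)) : x ∈ Set.range (B ^ s : H →L[ℂ] H) := by
  obtain ⟨y, rfl⟩ := hx
  refine ⟨(B ^ (t - s)) y, ?_⟩
  rw [rpow_rpow_apply hs (by linarith)]
  congr 2
  ring

theorem denseRange_of_injective (hB : 0 ≤ B) (hinj : Function.Injective B) : DenseRange B := by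
  have h : (LinearMap.range B.toLinearMap).topologicalClosure = ⊤ := by
    rw [Submodule.topologicalClosure_eq_top_iff, Submodule.eq_bot_iff]
    intro y hy
    apply hinj
    rw [map_zero]
    refine ext_inner_right ℂ fun x => ?_
    rw [inner_zero_left]
    exact (hB.isSelfAdjoint.isSymmetric y x).trans
      ((Submodule.mem_orthogonal' _ y).1 hy _ (LinearMap.mem_range_self _ x))
  have h2 := Submodule.dense_iff_topologicalClosure_eq_top.2 h
  exact h2

/-- The operators `exp (-(n B)⁻¹)`, `n > 0`, regularize: their ranges are contained in those of
all powers of `B`, and they converge to the identity on the range of `B`. -/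
theorem exists_regularizer (hB : 0 ≤ B) {n : ℝ} (hn : 0 < n) :
    ∃ J : H →L[ℂ] H, (∀ s : ℝ, 0 ≤ s → ∀ x, J x ∈ Set.range (B ^ s : H →L[ℂ] H)) ∧
      ∀ x, ‖J (B x) - B x‖ ≤ n⁻¹ * ‖x‖ := by
  let f : ℝ → ℝ := fun t => expNegInvGlue (n * t)
  have hsa : IsSelfAdjoint B := hB.isSelfAdjoint
  have hf : Continuous f := (expNegInvGlue.contDiff (n := 0)).continuous.comp (by fun_prop)
  have hspec : ∀ t ∈ spectrum ℝ B, 0 ≤ t := fun t ht => spectrum_nonneg_of_nonneg hB ht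
  refine ⟨cfc f B, fun s hs x => ?_, fun x => ?_⟩
  · obtain ⟨m, hm⟩ := exists_nat_ge s
    refine mem_range_rpow_mono hs hm ?_
    let g : ℝ → ℝ := fun t => n ^ m *
      ((Polynomial.X ^ m : Polynomial ℝ).eval (n * t)⁻¹ * expNegInvGlue (n * t))
    have hg : Continuous g := by
      have h := (expNegInvGlue.contDiff_polynomial_eval_inv_mul (n := 0)
        (Polynomial.X ^ m)).continuous.comp (continuous_const_mul n)
      exact continuous_const.mul h
    refine ⟨cfc g B x, ?_⟩
    rw [CFC.rpow_natCast B m hB, ← mul_apply_eq_comp]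
    conv_lhs => rw [← cfc_pow_id (R := ℝ) B m hsa]
    rw [← cfc_mul _ _ B (by fun_prop) hg.continuousOn]
    refine DFunLike.congr_fun (cfc_congr fun t ht => ?_) x
    simp only [g, f, Polynomial.eval_pow, Polynomial.eval_X]
    rcases (hspec t ht).eq_or_lt with h0 | h0
    · rw [← h0]; simp
    · have h1 : t * n * (n * t)⁻¹ = 1 := by field_simp
      rw [← mul_assoc, ← mul_assoc, ← mul_pow, ← mul_pow, h1, one_pow, one_mul]
  · have e : cfc f B * B - B = cfc (fun t => f t * t - t) B := by
      rw [cfc_sub _ _ B (by fun_prop) (by fun_prop), cfc_mul _ _ B (by fun_prop) (by fun_prop)]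
      have h := cfc_id' ℝ B hsa
      rw [h]
    have hle : ‖cfc (fun t => f t * t - t) B‖ ≤ n⁻¹ := by
      refine norm_cfc_le (by positivity) fun t ht => ?_
      rcases (hspec t ht).eq_or_lt with h0 | h0
      · rw [← h0]; simp; positivity
      · have hnt : 0 < n * t := by positivity
        have h1 : f t = Real.exp (-(n * t)⁻¹) := by
          simp only [f, expNegInvGlue, not_le.2 hnt, if_false]
        have h2 := Real.add_one_le_exp (-(n * t)⁻¹)
        have h3 : Real.exp (-(n * t)⁻¹) ≤ 1 := Real.exp_le_one_iff.2 (by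
          have := inv_pos.2 hnt; linarith)
        have h4 : (n * t)⁻¹ * t = n⁻¹ := by field_simp
        rw [h1, Real.norm_eq_abs, abs_le]
        constructor <;> nlinarith
    have := ContinuousLinearMap.le_of_opNorm_le _ hle x
    rw [← e] at this
    exact this

end PositiveOperator

namespace Sobolev

open PositiveOperator

variable {H : Type*} [NormedAddCommGroup H] [InnerProductSpace ℂ H] [CompleteSpace H]
variable {Θ : H →ₗ.[ℂ] H}

/-! ### The operators `Θ ^ s` on the smooth vectors -/

/-- The properties of `Θ⁻¹` on which the theory of the Sobolev scale depends. -/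
structure HasPositiveInverse (Θ : H →ₗ.[ℂ] H) : Prop where
  nonneg : 0 ≤ boundedInverse Θ
  injective : Function.Injective (boundedInverse Θ)

/-- The inverse of the bijection `Θ` is bounded by the closed graph theorem. -/
theorem hasPositiveInverse (hΘ : IsSelfAdjoint Θ)
    (hpos : ∀ x : Θ.domain, 0 ≤ (⟪Θ x, (x : H)⟫_ℂ).re) (hinv : Function.Bijective Θ) :
    HasPositiveInverse Θ := by
  have hex : ∃ B, IsBoundedInverse Θ B := by
    let e : Θ.domain ≃ₗ[ℂ] H := LinearEquiv.ofBijective Θ.toFun hinv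
    let g : H →ₗ[ℂ] H := Θ.domain.subtype ∘ₗ e.symm.toLinearMap
    have hcl : IsClosed (g.graph : Set (H × H)) := by
      have h1 : (g.graph : Set (H × H)) = Prod.swap ⁻¹' (Θ.graph : Set (H × H)) := by
        ext ⟨a, b⟩
        simp only [SetLike.mem_coe, LinearMap.mem_graph_iff, Set.mem_preimage, Prod.swap_prod_mk,
          LinearPMap.mem_graph_iff]
        constructor
        · rintro rfl
          exact ⟨e.symm a, rfl, e.apply_symm_apply a⟩
        · rintro ⟨x, rfl, rfl⟩
          exact (congrArg Subtype.val (e.symm_apply_apply x)).symm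
      rw [h1]
      exact IsClosed.preimage continuous_swap hΘ.isClosed
    refine ⟨ContinuousLinearMap.ofIsClosedGraph hcl, fun x => ?_, fun y => ⟨(e.symm y).2, ?_⟩⟩
    · exact congrArg Subtype.val (e.symm_apply_apply x)
    · exact e.apply_symm_apply y
  have hB : IsBoundedInverse Θ (boundedInverse Θ) := by
    rw [boundedInverse, dif_pos hex]
    exact hex.choose_spec
  refine ⟨?_, fun y z hyz => ?_⟩
  · rw [ContinuousLinearMap.nonneg_iff_isPositive]
    refine ⟨fun x y => ?_, fun x => ?_⟩
    · obtain ⟨hx, hx'⟩ := hB.2 x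
      obtain ⟨hy, hy'⟩ := hB.2 y
      have h := SelfAdjointOperator.inner_map_of_isSelfAdjoint hΘ ⟨_, hx⟩ ⟨_, hy⟩
      rw [hx', hy'] at h
      exact h.symm
    · obtain ⟨hx, hx'⟩ := hB.2 x
      have h := hpos ⟨_, hx⟩
      rw [hx'] at h
      exact h.trans_eq (inner_re_symm (𝕜 := ℂ) _ _)
  · obtain ⟨hy, hy'⟩ := hB.2 y
    obtain ⟨hz, hz'⟩ := hB.2 z
    rw [← hy', ← hz']
    congr 1
    exact Subtype.ext hyz

theorem power_apply_of_nonpos {s : ℝ} (hs : s ≤ 0) (x : (power Θ s).domain) :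
    power Θ s x = (boundedInverse Θ ^ (-s)) (x : H) := by
  have key : ∀ y z : H, (y, z) ∈ (power Θ s).graph → z = (boundedInverse Θ ^ (-s)) y := by
    intro y z h
    rw [power, if_pos hs, LinearPMap.mem_graph_iff] at h
    obtain ⟨w, hw, hwz⟩ := h
    simp only at hw hwz
    rw [← hwz, ← hw]
    rfl
  exact key _ _ (LinearPMap.mem_graph _ x)

theorem graph_power_of_pos (hΘ : HasPositiveInverse Θ) {s : ℝ} (hs : 0 < s) {x y : H} :
    (x, y) ∈ (power Θ s).graph ↔ (boundedInverse Θ ^ s) y = x := by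
  rw [power, if_neg (not_le.2 hs), LinearPMap.inverse_graph, Submodule.mem_map]
  · constructor
    · rintro ⟨⟨a, b⟩, hab, h⟩
      obtain ⟨rfl, rfl⟩ := Prod.mk.inj h
      obtain ⟨z, hz, hz'⟩ := (LinearPMap.mem_graph_iff _).1 hab
      simp only at hz hz'
      rw [← hz, ← hz']
      rfl
    · rintro rfl
      exact ⟨(y, _), (LinearPMap.mem_graph_iff _).2 ⟨⟨y, Submodule.mem_top⟩, rfl, rfl⟩, rfl⟩
  · rw [LinearMap.ker_eq_bot]
    intro a b hab
    exact Subtype.ext (rpow_injective hΘ.nonneg hΘ.injective hs.le hab)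

theorem mem_domain_power (hΘ : HasPositiveInverse Θ) {s : ℝ} (hs : 0 ≤ s) {x : H} :
    x ∈ (power Θ s).domain ↔ x ∈ Set.range (boundedInverse Θ ^ s : H →L[ℂ] H) := by
  rcases hs.eq_or_lt with rfl | hs
  · rw [power_domain_of_nonpos Θ le_rfl, CFC.rpow_zero _ hΘ.nonneg]
    exact ⟨fun _ => ⟨x, rfl⟩, fun _ => Submodule.mem_top⟩
  · rw [LinearPMap.mem_domain_iff]
    simp_rw [graph_power_of_pos hΘ hs]
    rfl

theorem rpow_power (hΘ : HasPositiveInverse Θ) {s : ℝ} (hs : 0 ≤ s) (x : (power Θ s).domain) :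
    (boundedInverse Θ ^ s) (power Θ s x) = x := by
  rcases hs.eq_or_lt with rfl | hs
  · rw [power_apply_of_nonpos le_rfl, neg_zero, CFC.rpow_zero _ hΘ.nonneg]
    rfl
  · exact (graph_power_of_pos hΘ hs).1 (LinearPMap.mem_graph _ x)

theorem mem_smooth (hΘ : HasPositiveInverse Θ) {x : H} :
    x ∈ smooth Θ ↔ ∀ s : ℝ, 0 ≤ s → x ∈ Set.range (boundedInverse Θ ^ s : H →L[ℂ] H) := by
  simp only [smooth, Submodule.mem_iInf]
  exact forall₂_congr fun s hs => mem_domain_power hΘ hs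

theorem mem_smooth_of_rpow_eq (hΘ : HasPositiveInverse Θ) {s : ℝ} (hs : 0 ≤ s) {x y : H}
    (hx : x ∈ smooth Θ) (h : (boundedInverse Θ ^ s) y = x) : y ∈ smooth Θ := by
  rw [mem_smooth hΘ] at hx ⊢
  intro t ht
  obtain ⟨z, hz⟩ := hx (s + t) (by linarith)
  refine ⟨z, rpow_injective hΘ.nonneg hΘ.injective hs ?_⟩
  rw [rpow_rpow_apply hs ht, hz, h]

theorem rpow_mem_smooth (hΘ : HasPositiveInverse Θ) {s : ℝ} (hs : 0 ≤ s) {x : H}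
    (hx : x ∈ smooth Θ) : (boundedInverse Θ ^ s) x ∈ smooth Θ := by
  rw [mem_smooth hΘ] at hx ⊢
  intro t ht
  obtain ⟨z, rfl⟩ := hx t ht
  refine ⟨(boundedInverse Θ ^ s) z, ?_⟩
  rw [rpow_rpow_apply hs ht, rpow_rpow_apply ht hs, add_comm]

theorem power_mem_smooth (hΘ : HasPositiveInverse Θ) (s : ℝ) (x : smooth Θ) :
    power Θ s ⟨x, smooth_le_domain Θ s x.2⟩ ∈ smooth Θ := by
  rcases le_or_gt s 0 with hs | hs
  · rw [power_apply_of_nonpos hs]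
    exact rpow_mem_smooth hΘ (by linarith) x.2
  · exact mem_smooth_of_rpow_eq hΘ hs.le x.2 (rpow_power hΘ hs.le _)

/-- The operator `Θ ^ s` on `H^∞(Θ)`. -/
def smoothPower (hΘ : HasPositiveInverse Θ) (s : ℝ) : smooth Θ →ₗ[ℂ] smooth Θ :=
  ((power Θ s).toFun ∘ₗ Submodule.inclusion (smooth_le_domain Θ s)).codRestrict (smooth Θ)
    (power_mem_smooth hΘ s)

theorem coe_smoothPower (hΘ : HasPositiveInverse Θ) (s : ℝ) (x : smooth Θ) :
    (smoothPower hΘ s x : H) = power Θ s ⟨x, smooth_le_domain Θ s x.2⟩ := rfl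

theorem norm_toPreSpace (hΘ : HasPositiveInverse Θ) (s : ℝ) (x : smooth Θ) :
    ‖toPreSpace Θ s x‖ = ‖smoothPower hΘ s x‖ := rfl

theorem norm_toSpace (hΘ : HasPositiveInverse Θ) (s : ℝ) (x : smooth Θ) :
    ‖toSpace Θ s x‖ = ‖smoothPower hΘ s x‖ := by
  rw [toSpace, UniformSpace.Completion.norm_coe, norm_toPreSpace hΘ]

theorem rpow_smoothPower (hΘ : HasPositiveInverse Θ) {a b s : ℝ} (ha : 0 ≤ a) (hb : 0 ≤ b)
    (hab : a = b + s) (x : smooth Θ) :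
    (boundedInverse Θ ^ a) (smoothPower hΘ s x : H) = (boundedInverse Θ ^ b) (x : H) := by
  rw [coe_smoothPower]
  rcases le_or_gt s 0 with hs | hs
  · rw [power_apply_of_nonpos hs, rpow_rpow_apply ha (by linarith)]
    congr 2
    linarith
  · rw [hab, ← rpow_rpow_apply hb hs.le, rpow_power hΘ hs.le]

theorem smoothPower_smoothPower (hΘ : HasPositiveInverse Θ) (s t : ℝ) (x : smooth Θ) :
    smoothPower hΘ s (smoothPower hΘ t x) = smoothPower hΘ (s + t) x := by
  have h1 := abs_nonneg s
  have h2 := abs_nonneg t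
  have h3 := le_abs_self s
  have h4 := le_abs_self t
  refine Subtype.ext (rpow_injective hΘ.nonneg hΘ.injective (add_nonneg h1 h2) ?_)
  rw [rpow_smoothPower hΘ (b := |s| + |t| - s) (by positivity) (by linarith) (by ring),
    rpow_smoothPower hΘ (b := |s| + |t| - s - t) (by linarith) (by linarith) (by ring),
    rpow_smoothPower hΘ (b := |s| + |t| - s - t) (by linarith) (by linarith) (by ring)]

theorem smoothPower_zero (hΘ : HasPositiveInverse Θ) (x : smooth Θ) : smoothPower hΘ 0 x = x := by
  refine Subtype.ext ?_
  rw [coe_smoothPower, power_apply_of_nonpos le_rfl, neg_zero, CFC.rpow_zero _ hΘ.nonneg]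
  rfl

theorem smoothPower_neg_cancel (hΘ : HasPositiveInverse Θ) (s : ℝ) (x : smooth Θ) :
    smoothPower hΘ s (smoothPower hΘ (-s) x) = x := by
  rw [smoothPower_smoothPower, add_neg_cancel, smoothPower_zero]

theorem coe_smoothPower_neg (hΘ : HasPositiveInverse Θ) {s : ℝ} (hs : 0 ≤ s) (x : smooth Θ) :
    (smoothPower hΘ (-s) x : H) = (boundedInverse Θ ^ s) (x : H) := by
  rw [coe_smoothPower, power_apply_of_nonpos (by linarith), neg_neg]

theorem rpow_smoothPower_self (hΘ : HasPositiveInverse Θ) {s : ℝ} (hs : 0 ≤ s) (x : smooth Θ) :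
    (boundedInverse Θ ^ s) (smoothPower hΘ s x : H) = x :=
  rpow_power hΘ hs _

theorem exists_norm_smoothPower_le (hΘ : HasPositiveInverse Θ) {s t : ℝ} (hst : s ≤ t) :
    ∃ C, 0 ≤ C ∧ ∀ x, ‖smoothPower hΘ s x‖ ≤ C * ‖smoothPower hΘ t x‖ := by
  refine ⟨‖boundedInverse Θ ^ (t - s)‖, norm_nonneg _, fun x => ?_⟩
  have h : smoothPower hΘ s x = smoothPower hΘ (-(t - s)) (smoothPower hΘ t x) := by
    rw [smoothPower_smoothPower, show -(t - s) + t = s by ring]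
  rw [h, Submodule.coe_norm, coe_smoothPower_neg hΘ (by linarith)]
  exact ContinuousLinearMap.le_opNorm _ _

theorem dense_smooth (hΘ : HasPositiveInverse Θ) : Dense (smooth Θ : Set H) := by
  have h1 : Set.range (boundedInverse Θ) ⊆ closure (smooth Θ : Set H) := by
    rintro _ ⟨x, rfl⟩
    have h2 : ∀ n : ℕ, ∃ v ∈ smooth Θ,
        ‖v - boundedInverse Θ x‖ ≤ ((n : ℝ) + 1)⁻¹ * ‖x‖ := by
      intro n
      obtain ⟨J, hJ, hJ'⟩ := exists_regularizer hΘ.nonneg (n := (n : ℝ) + 1) (by positivity)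
      exact ⟨_, (mem_smooth hΘ).2 fun s hs => hJ s hs _, hJ' x⟩
    choose v hv hvx using h2
    refine mem_closure_of_tendsto (f := v) (b := atTop) ?_ (Eventually.of_forall hv)
    rw [← tendsto_sub_nhds_zero_iff]
    refine squeeze_zero_norm hvx ?_
    have h3 : Tendsto (fun n : ℕ => ((n : ℝ) + 1)⁻¹) atTop (𝓝 0) := by
      simpa using tendsto_one_div_add_atTop_nhds_zero_nat (𝕜 := ℝ)
    simpa using h3.mul_const ‖x‖
  have h4 : closure (Set.range (boundedInverse Θ)) ⊆ closure (smooth Θ : Set H) :=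
    closure_minimal h1 isClosed_closure
  intro x
  exact h4 (denseRange_of_injective hΘ.nonneg hΘ.injective x)

theorem denseRange_toPreSpace (hΘ : HasPositiveInverse Θ) (s : ℝ) :
    DenseRange (toPreSpace Θ s) := by
  intro x
  rw [Metric.mem_closure_range_iff]
  intro ε hε
  rcases le_or_gt s 0 with hs | hs
  · let x' : (power Θ s).domain := x
    obtain ⟨v, hv, hvx⟩ := Metric.dense_iff.1 (dense_smooth hΘ) (x' : H)
      (ε / (‖boundedInverse Θ ^ (-s)‖ + 1)) (by positivity)
    refine ⟨⟨v, hvx⟩, ?_⟩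
    rw [dist_eq_norm]
    let v' : (power Θ s).domain := ⟨v, smooth_le_domain Θ s hvx⟩
    change ‖power Θ s (x' - v')‖ < ε
    rw [power_apply_of_nonpos hs]
    rw [Metric.mem_ball, dist_comm, dist_eq_norm] at hv
    calc _ ≤ ‖boundedInverse Θ ^ (-s)‖ * ‖(x' : H) - v‖ := ContinuousLinearMap.le_opNorm _ _
      _ ≤ (‖boundedInverse Θ ^ (-s)‖ + 1) * ‖(x' : H) - v‖ := by gcongr; linarith
      _ < (‖boundedInverse Θ ^ (-s)‖ + 1) * (ε / (‖boundedInverse Θ ^ (-s)‖ + 1)) := by gcongr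
      _ = ε := by field_simp
  · let x' : (power Θ s).domain := x
    obtain ⟨v, hv, hvx⟩ := Metric.dense_iff.1 (dense_smooth hΘ) (power Θ s x') ε hε
    refine ⟨smoothPower hΘ (-s) ⟨v, hvx⟩, ?_⟩
    have h1 : power Θ s x' - v = power Θ s x'
        - smoothPower hΘ s (smoothPower hΘ (-s) ⟨v, hvx⟩) := by
      rw [smoothPower_neg_cancel]
    rw [Metric.mem_ball, dist_comm, dist_eq_norm, h1] at hv
    rw [dist_eq_norm]
    change ‖PreSpace.toH Θ s (x - toPreSpace Θ s (smoothPower hΘ (-s) ⟨v, hvx⟩))‖ < ε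
    rw [map_sub]
    exact hv

/-! ### Operators of finite order in terms of norms of smooth vectors -/

/-- The inclusion of `H^∞(Θ)` in `H^s(Θ)`, as a linear map. -/
def toSpaceₗ (Θ : H →ₗ.[ℂ] H) (s : ℝ) : smooth Θ →ₗ[ℂ] Space Θ s :=
  UniformSpace.Completion.toComplₗᵢ.toLinearMap ∘ₗ toPreSpace Θ s

theorem toSpaceₗ_apply (s : ℝ) (x : smooth Θ) : toSpaceₗ Θ s x = toSpace Θ s x := rfl

theorem denseRange_toSpaceₗ (hΘ : HasPositiveInverse Θ) (s : ℝ) : DenseRange (toSpaceₗ Θ s) :=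
  UniformSpace.Completion.denseRange_coe.comp (denseRange_toPreSpace hΘ s)
    (UniformSpace.Completion.continuous_coe _)

/-- Since the smooth vectors are dense in every `H^s(Θ)`, the operators of order `r` are
characterized by estimates on smooth vectors. -/
theorem isOp_iff (hΘ : HasPositiveInverse Θ) {r : ℝ} {A : smooth Θ →ₗ[ℂ] smooth Θ} :
    IsOp Θ r A ↔ ∀ s, ∃ C, 0 ≤ C ∧
      ∀ x, ‖smoothPower hΘ s (A x)‖ ≤ C * ‖smoothPower hΘ (s + r) x‖ := by
  refine forall_congr' fun s => ⟨?_, ?_⟩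
  · rintro ⟨T, hT⟩
    refine ⟨‖T‖, norm_nonneg _, fun x => ?_⟩
    rw [← norm_toSpace hΘ, ← norm_toSpace hΘ, ← hT]
    exact T.le_opNorm _
  · rintro ⟨C, -, hC⟩
    refine ⟨(toSpaceₗ Θ s ∘ₗ A).extendOfNorm (toSpaceₗ Θ (s + r)), fun x => ?_⟩
    refine LinearMap.extendOfNorm_eq (denseRange_toSpaceₗ hΘ (s + r)) ⟨C, fun x => ?_⟩ x
    rw [LinearMap.comp_apply, toSpaceₗ_apply, toSpaceₗ_apply, norm_toSpace hΘ, norm_toSpace hΘ]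
    exact hC x

theorem norm_le_of_extends (hΘ : HasPositiveInverse Θ) {s t C : ℝ} (hC : 0 ≤ C)
    {A : smooth Θ →ₗ[ℂ] smooth Θ} {T : Space Θ t →L[ℂ] Space Θ s} (hT : Extends Θ T A)
    (h : ∀ x, ‖smoothPower hΘ s (A x)‖ ≤ C * ‖smoothPower hΘ t x‖) : ‖T‖ ≤ C := by
  refine T.opNorm_le_bound hC fun u => ?_
  refine (denseRange_toSpaceₗ hΘ t).induction_on (p := fun u => ‖T u‖ ≤ C * ‖u‖) u
    (isClosed_le (by fun_prop) (by fun_prop)) fun x => ?_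
  rw [toSpaceₗ_apply, hT x, norm_toSpace hΘ, norm_toSpace hΘ]
  exact h x

end Sobolev

/-! ### The Heinz inequality -/

namespace PositiveOperator

variable {H : Type*} [NormedAddCommGroup H] [InnerProductSpace ℂ H] [CompleteSpace H]
variable {P Q : H →L[ℂ] H}

theorem smul_rpow (hQ : 0 ≤ Q) {d : ℝ} (hd : 0 ≤ d) {θ : ℝ} (hθ : 0 ≤ θ) :
    (d • Q) ^ θ = d ^ θ • Q ^ θ := by
  have hsa : IsSelfAdjoint Q := hQ.isSelfAdjoint
  rw [CFC.rpow_eq_cfc_real (smul_nonneg hd hQ), CFC.rpow_eq_cfc_real hQ,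
    ← cfc_comp_smul d _ Q (Real.continuous_rpow_const hθ).continuousOn,
    ← cfc_smul _ _ Q (Real.continuous_rpow_const hθ).continuousOn]
  exact cfc_congr fun t ht => Real.mul_rpow hd (spectrum_nonneg_of_nonneg hQ ht)

theorem re_inner_rpow_two_mul {θ : ℝ} (hθ : 0 ≤ θ) (u : H) :
    (⟪(P ^ (2 * θ)) u, u⟫_ℂ).re = ‖(P ^ θ) u‖ ^ 2 := by
  rw [two_mul, ← rpow_rpow_apply hθ hθ, inner_rpow]
  exact inner_self_eq_norm_sq (𝕜 := ℂ) _

theorem le_iff_re_inner {P Q : H →L[ℂ] H} (hP : IsSelfAdjoint P) (hQ : IsSelfAdjoint Q) :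
    P ≤ Q ↔ ∀ u, (⟪P u, u⟫_ℂ).re ≤ (⟪Q u, u⟫_ℂ).re := by
  rw [ContinuousLinearMap.le_def]
  refine ⟨fun h u => ?_, fun h => ⟨(hQ.sub hP).isSymmetric, fun u => ?_⟩⟩
  · have h1 := h.re_inner_nonneg_left u
    rw [sub_apply, inner_sub_left, map_sub] at h1
    exact sub_nonneg.1 h1
  · rw [ContinuousLinearMap.reApplyInnerSelf_apply, sub_apply, inner_sub_left, map_sub]
    exact sub_nonneg.2 (h u)

omit [CompleteSpace H] in
theorem re_inner_smul (d : ℝ) (P : H →L[ℂ] H) (u : H) :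
    (⟪(d • P) u, u⟫_ℂ).re = d * (⟪P u, u⟫_ℂ).re := by
  rw [smul_apply, ← Complex.coe_smul, inner_smul_left, Complex.conj_ofReal, Complex.re_ofReal_mul]

theorem rpow_two_le_smul (hP : 0 ≤ P) (hQ : 0 ≤ Q) {c : ℝ} (h : ∀ u, ‖P u‖ ≤ c * ‖Q u‖) :
    P ^ (2 : ℝ) ≤ c ^ 2 • Q ^ (2 : ℝ) := by
  have key : ∀ R : H →L[ℂ] H, 0 ≤ R → ∀ u, (⟪(R ^ (2 : ℝ)) u, u⟫_ℂ).re = ‖R u‖ ^ 2 := by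
    intro R hR u
    have := re_inner_rpow_two_mul (P := R) zero_le_one u
    rwa [mul_one, CFC.rpow_one R hR] at this
  have hP' : IsSelfAdjoint (P ^ (2 : ℝ)) := CFC.rpow_nonneg.isSelfAdjoint
  have hQ' : IsSelfAdjoint (Q ^ (2 : ℝ)) := CFC.rpow_nonneg.isSelfAdjoint
  refine (le_iff_re_inner hP' ((IsSelfAdjoint.all (c ^ 2)).smul hQ')).2 fun u => ?_
  rw [re_inner_smul, key P hP, key Q hQ, ← mul_pow]
  exact pow_le_pow_left₀ (norm_nonneg _) (h u) 2

theorem norm_rpow_le_of_le_smul {θ d : ℝ} (hθ : 0 ≤ θ) (hd : 0 ≤ d)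
    (h : P ^ (2 * θ) ≤ d • Q ^ (2 * θ)) (u : H) : ‖(P ^ θ) u‖ ≤ √d * ‖(Q ^ θ) u‖ := by
  have hP' : IsSelfAdjoint (P ^ (2 * θ)) := CFC.rpow_nonneg.isSelfAdjoint
  have hQ' : IsSelfAdjoint (Q ^ (2 * θ)) := CFC.rpow_nonneg.isSelfAdjoint
  have h3 := (le_iff_re_inner hP' ((IsSelfAdjoint.all d).smul hQ')).1 h u
  rw [re_inner_smul, re_inner_rpow_two_mul hθ, re_inner_rpow_two_mul hθ] at h3
  rw [← Real.sqrt_sq (norm_nonneg ((P ^ θ) u)), ← Real.sqrt_sq (norm_nonneg ((Q ^ θ) u)),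
    ← Real.sqrt_mul hd]
  exact Real.sqrt_le_sqrt h3

/-- The **Heinz inequality**, a form of the operator monotonicity of `t ↦ t ^ θ`. -/
theorem exists_norm_rpow_le (hP : 0 ≤ P) (hQ : 0 ≤ Q) {c : ℝ} (h : ∀ u, ‖P u‖ ≤ c * ‖Q u‖)
    {θ : ℝ} (hθ : θ ∈ Set.Icc (0 : ℝ) 1) :
    ∃ c', 0 ≤ c' ∧ ∀ u, ‖(P ^ θ) u‖ ≤ c' * ‖(Q ^ θ) u‖ := by
  have h2 := CFC.rpow_le_rpow hθ (rpow_two_le_smul hP hQ h)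
  have e1 : (P ^ (2 : ℝ)) ^ θ = P ^ (2 * θ) :=
    CFC.rpow_rpow_of_exponent_nonneg P 2 θ zero_le_two hθ.1 hP
  have e2 : (Q ^ (2 : ℝ)) ^ θ = Q ^ (2 * θ) :=
    CFC.rpow_rpow_of_exponent_nonneg Q 2 θ zero_le_two hθ.1 hQ
  have e3 : (c ^ 2 • Q ^ (2 : ℝ)) ^ θ = (c ^ 2) ^ θ • (Q ^ (2 : ℝ)) ^ θ :=
    smul_rpow CFC.rpow_nonneg (sq_nonneg c) hθ.1
  rw [e1, e3, e2] at h2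
  exact ⟨√((c ^ 2) ^ θ), Real.sqrt_nonneg _,
    norm_rpow_le_of_le_smul hθ.1 (Real.rpow_nonneg (sq_nonneg c) θ) h2⟩

end PositiveOperator

namespace Sobolev

open PositiveOperator

variable {H : Type*} [NormedAddCommGroup H] [InnerProductSpace ℂ H] [CompleteSpace H]
variable {Θ : H →ₗ.[ℂ] H} {A P S : smooth Θ →ₗ[ℂ] smooth Θ}

/-! ### The algebra of operators of finite order -/

theorem IsOp.comp (hΘ : HasPositiveInverse Θ) {a b : ℝ} (hA : IsOp Θ a A) (hP : IsOp Θ b P) :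
    IsOp Θ (a + b) (A ∘ₗ P) := by
  rw [isOp_iff hΘ] at hA hP ⊢
  intro s
  obtain ⟨C, hC, h⟩ := hA s
  obtain ⟨C', hC', h'⟩ := hP (s + a)
  refine ⟨C * C', by positivity, fun x => (h (P x)).trans ?_⟩
  rw [mul_assoc, ← add_assoc]
  exact mul_le_mul_of_nonneg_left (h' x) hC

theorem IsOp.add (hΘ : HasPositiveInverse Θ) {a : ℝ} (hA : IsOp Θ a A) (hP : IsOp Θ a P) :
    IsOp Θ a (A + P) := by
  rw [isOp_iff hΘ] at hA hP ⊢
  intro s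
  obtain ⟨C, hC, h⟩ := hA s
  obtain ⟨C', hC', h'⟩ := hP s
  refine ⟨C + C', by positivity, fun x => ?_⟩
  rw [LinearMap.add_apply, map_add, add_mul]
  exact (norm_add_le _ _).trans (add_le_add (h x) (h' x))

theorem isOp_id (hΘ : HasPositiveInverse Θ) : IsOp Θ 0 LinearMap.id := by
  rw [isOp_iff hΘ]
  exact fun s => ⟨1, zero_le_one, fun x => by rw [add_zero, one_mul, LinearMap.id_apply]⟩

theorem IsOp.comp_isSmoothing (hΘ : HasPositiveInverse Θ) {a : ℝ} (hA : IsOp Θ a A)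
    (hS : IsSmoothing Θ S) : IsSmoothing Θ (A ∘ₗ S) := fun t => by
  have := hA.comp hΘ (hS (t - a))
  rwa [add_sub_cancel] at this

theorem IsSmoothing.comp_isOp (hΘ : HasPositiveInverse Θ) {a : ℝ} (hS : IsSmoothing Θ S)
    (hA : IsOp Θ a A) : IsSmoothing Θ (S ∘ₗ A) := fun t => by
  have := (hS (t - a)).comp hΘ hA
  rwa [sub_add_cancel] at this

theorem IsOp.pow (hΘ : HasPositiveInverse Θ) {a : ℝ} (hA : IsOp Θ a A) (k : ℕ) :
    IsOp Θ (k * a) (A ^ k) := by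
  induction k with
  | zero =>
    rw [pow_zero, Nat.cast_zero, zero_mul]
    exact isOp_id hΘ
  | succ k ih =>
    have h := ih.comp hΘ hA
    rw [pow_succ, Nat.cast_succ, add_mul, one_mul]
    exact h

/-- A right parametrix `P` of `A` gives the right parametrix `P ^ k` of `A ^ k`, by
`A ^ (k + 1) P ^ (k + 1) - 1 = A (A ^ k P ^ k - 1) P + (A P - 1)`. -/
theorem isSmoothing_pow_comp_pow (hΘ : HasPositiveInverse Θ) {a b : ℝ} (hA : IsOp Θ a A)
    (hP : IsOp Θ b P) (h : IsSmoothing Θ (A ∘ₗ P - LinearMap.id)) (k : ℕ) :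
    IsSmoothing Θ ((A ^ k) ∘ₗ (P ^ k) - LinearMap.id) := by
  induction k with
  | zero =>
    intro t
    rw [isOp_iff hΘ]
    exact fun s => ⟨0, le_rfl, fun x => by simp⟩
  | succ k ih =>
    have e : (A ^ (k + 1)) ∘ₗ (P ^ (k + 1)) - LinearMap.id
        = A ∘ₗ ((A ^ k) ∘ₗ (P ^ k) - LinearMap.id) ∘ₗ P + (A ∘ₗ P - LinearMap.id) := by
      rw [pow_succ', pow_succ]
      ext x
      simp
    rw [e]
    exact fun t => IsOp.add hΘ (hA.comp_isSmoothing hΘ (ih.comp_isOp hΘ hP) t) (h t)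

/-! ### Elliptic regularity -/

/-- A vector `y` whose inner products with `Θ ^ m v` are bounded by a multiple of `‖v‖` is in the
domain of `Θ ^ m`. -/
theorem exists_rpow_eq_of_inner_le (hΘ : HasPositiveInverse Θ) {m : ℝ} (hm : 0 ≤ m) {y : H} {C : ℝ}
    (hC : 0 ≤ C) (h : ∀ v : smooth Θ, ‖⟪y, (smoothPower hΘ m v : H)⟫_ℂ‖ ≤ C * ‖v‖) :
    ∃ w, (boundedInverse Θ ^ m) w = y ∧ ‖w‖ ≤ C := by
  let ℓ : smooth Θ →ₗ[ℂ] ℂ := (innerₛₗ ℂ y) ∘ₗ (smooth Θ).subtype ∘ₗ smoothPower hΘ m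
  have hd : DenseRange (smooth Θ).subtype := by
    have := dense_smooth hΘ
    rwa [DenseRange, Submodule.coe_subtype, Subtype.range_coe]
  let L : H →L[ℂ] ℂ := ℓ.extendOfNorm (smooth Θ).subtype
  have hL : ∀ v : smooth Θ, L v = ⟪y, (smoothPower hΘ m v : H)⟫_ℂ :=
    LinearMap.extendOfNorm_eq hd ⟨C, h⟩
  let w := (InnerProductSpace.toDual ℂ H).symm L
  refine ⟨w, ?_, ?_⟩
  · refine (dense_smooth hΘ).eq_of_inner_left ℂ fun u hu => ?_
    rw [inner_rpow, InnerProductSpace.toDual_symm_apply]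
    have h1 := hL (smoothPower hΘ (-m) ⟨u, hu⟩)
    rw [coe_smoothPower_neg hΘ hm, smoothPower_neg_cancel] at h1
    exact h1
  · rw [LinearIsometryEquiv.norm_map]
    exact LinearMap.opNorm_extendOfNorm_le hd hC h

/-- Elliptic regularity: if `A` has a right parametrix of order `-m` and `A' y = z` weakly, with
`A'` the formal adjoint of `A`, then `y` is in the domain of `Θ ^ m`. -/
theorem exists_rpow_eq_of_weak_solution (hΘ : HasPositiveInverse Θ) {m : ℝ} (hm : 0 ≤ m)
    (hP : IsOp Θ (-m) P) (hS : IsSmoothing Θ (A ∘ₗ P - LinearMap.id)) :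
    ∃ C, 0 ≤ C ∧ ∀ y z : H, (∀ x : smooth Θ, ⟪z, (x : H)⟫_ℂ = ⟪y, (A x : H)⟫_ℂ) →
      ∃ w, (boundedInverse Θ ^ m) w = y ∧ ‖w‖ ≤ C * (‖y‖ + ‖z‖) := by
  obtain ⟨C₁, hC₁, h₁⟩ := (isOp_iff hΘ).1 hP 0
  obtain ⟨C₂, hC₂, h₂⟩ := (isOp_iff hΘ).1 (hS (-m)) 0
  refine ⟨C₁ + C₂, by positivity, fun y z hyz => ?_⟩
  refine exists_rpow_eq_of_inner_le hΘ hm (by positivity) fun v => ?_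
  have b₁ := h₁ (smoothPower hΘ m v)
  have b₂ := h₂ (smoothPower hΘ m v)
  rw [smoothPower_zero, smoothPower_smoothPower, zero_add, neg_add_cancel, smoothPower_zero]
    at b₁ b₂
  have e : (smoothPower hΘ m v : H) = A (P (smoothPower hΘ m v))
      - ((A ∘ₗ P - LinearMap.id : smooth Θ →ₗ[ℂ] smooth Θ) (smoothPower hΘ m v) : H) := by simp
  rw [e, inner_sub_right, ← hyz]
  calc _ ≤ _ := norm_sub_le _ _
    _ ≤ ‖z‖ * (C₁ * ‖v‖) + ‖y‖ * (C₂ * ‖v‖) := by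
      refine add_le_add ((norm_inner_le_norm _ _).trans ?_) ((norm_inner_le_norm _ _).trans ?_)
      · exact mul_le_mul_of_nonneg_left b₁ (norm_nonneg _)
      · exact mul_le_mul_of_nonneg_left b₂ (norm_nonneg _)
    _ ≤ (C₁ + C₂) * (‖y‖ + ‖z‖) * ‖v‖ := by
      have := norm_nonneg v
      have := norm_nonneg y
      have := norm_nonneg z
      have : 0 ≤ C₁ * ‖y‖ * ‖v‖ + C₂ * ‖z‖ * ‖v‖ := by positivity
      nlinarith

/-! ### Self-adjointness of the extension -/

theorem extensionOp_apply (hΘ : HasPositiveInverse Θ) {r : ℝ} (hA : IsOp Θ r A) (x : smooth Θ) :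
    extensionOp Θ r A ⟨x, smooth_le_domain Θ r x.2⟩ = A x := by
  obtain ⟨C, hC, h⟩ := (isOp_iff hΘ).1 hA 0
  refine LinearMap.extendOfNorm_eq (f := (smooth Θ).subtype ∘ₗ A) (denseRange_toPreSpace hΘ r)
    ⟨C, fun x => ?_⟩ x
  have := h x
  rw [smoothPower_zero, zero_add] at this
  exact this

theorem mem_graph_extensionOp (hΘ : HasPositiveInverse Θ) {r : ℝ} (hA : IsOp Θ r A)
    (x : smooth Θ) : ((x : H), (A x : H)) ∈ (extensionOp Θ r A).graph :=
  (LinearPMap.mem_graph_iff _).2 ⟨⟨x, smooth_le_domain Θ r x.2⟩, rfl, extensionOp_apply hΘ hA x⟩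

theorem inner_extensionOp (hΘ : HasPositiveInverse Θ) {r : ℝ} (hr : 0 ≤ r) (hA : IsOp Θ r A)
    (hsym : A.IsSymmetric) (x y : (extensionOp Θ r A).domain) :
    ⟪extensionOp Θ r A x, (y : H)⟫_ℂ = ⟪(x : H), extensionOp Θ r A y⟫_ℂ := by
  let T : PreSpace Θ r →L[ℂ] H := ((smooth Θ).subtype ∘ₗ A).extendOfNorm (toPreSpace Θ r)
  let j : PreSpace Θ r →L[ℂ] H := LinearMap.mkContinuous (power Θ r).domain.subtype
    ‖boundedInverse Θ ^ r‖ fun x =>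
      (congrArg norm (rpow_power hΘ hr x)).symm.trans_le (ContinuousLinearMap.le_opNorm _ _)
  change ⟪T x, j y⟫_ℂ = ⟪j x, T y⟫_ℂ
  refine (denseRange_toPreSpace hΘ r).induction_on₂
    (p := fun x y : PreSpace Θ r => ⟪T x, j y⟫_ℂ = ⟪j x, T y⟫_ℂ)
    (isClosed_eq (by fun_prop) (by fun_prop)) (fun a b => ?_) x y
  have h := hsym a b
  have ha : T (toPreSpace Θ r a) = A a := extensionOp_apply hΘ hA a
  have hb : T (toPreSpace Θ r b) = A b := extensionOp_apply hΘ hA b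
  rw [ha, hb]
  exact h

/-- The extension of `A` is symmetric by continuity, and elliptic regularity puts the domain of its
adjoint into its own domain. -/
theorem isSelfAdjoint_extensionOp (hΘ : HasPositiveInverse Θ) {r : ℝ} (hr : 0 ≤ r)
    (hA : IsOp Θ r A) (hell : IsElliptic Θ r A) (hsym : A.IsSymmetric) :
    IsSelfAdjoint (extensionOp Θ r A) := by
  set T := extensionOp Θ r A
  have hd : Dense (T.domain : Set H) := (dense_smooth hΘ).mono (smooth_le_domain Θ r)
  have hle : T ≤ T.adjoint :=
    LinearPMap.IsFormalAdjoint.le_adjoint hd (inner_extensionOp hΘ hr hA hsym)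
  refine (LinearPMap.eq_of_le_of_domain_eq hle (le_antisymm hle.1 fun y hy => ?_)).symm
  obtain ⟨P, hP, hAP, -⟩ := hell
  obtain ⟨C, -, h⟩ := exists_rpow_eq_of_weak_solution hΘ hr hP hAP
  obtain ⟨w, hw, -⟩ := h y (T.adjoint ⟨y, hy⟩) fun x => by
    have h1 := LinearPMap.adjoint_isFormalAdjoint hd ⟨y, hy⟩ ⟨x, smooth_le_domain Θ r x.2⟩
    rw [extensionOp_apply hΘ hA] at h1
    exact h1
  exact (mem_domain_power hΘ hr).2 ⟨w, hw⟩

end Sobolev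

/-! ### The functional calculus on functions of polynomial growth -/

namespace SpectralMeasure

variable {H : Type*} [NormedAddCommGroup H] [InnerProductSpace ℂ H] [CompleteSpace H]
variable {E : SpectralMeasure H} {f g : ℝ → ℂ} {x : H}

theorem integralAt_congr {hf : Measurable f} {hg : Measurable g} (h : f = g) :
    E.integralAt hf x = E.integralAt hg x := by
  subst h
  rfl

theorem weight_two_mul_natCast (j : ℕ) (t : ℝ) : weight (2 * j) t = (1 + t ^ 2) ^ j := by
  rw [weight, mul_div_cancel_left₀ _ two_ne_zero, Real.rpow_natCast]

theorem ofReal_weight_two : (fun t => (weight 2 t : ℂ)) = fun t => 1 + ((t ^ 2 : ℝ) : ℂ) := by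
  ext t
  have := weight_two_mul_natCast 1 t
  rw [Nat.cast_one, mul_one, pow_one] at this
  rw [this, Complex.ofReal_add, Complex.ofReal_one]

theorem measurable_ofReal_pow (k : ℕ) : Measurable fun t : ℝ => ((t ^ k : ℝ) : ℂ) := by
  fun_prop

theorem norm_pow_mul_weight_le (j : ℕ) (t : ℝ) :
    ‖((t ^ (2 * j) : ℝ) : ℂ) * (weight (-(2 * j)) t : ℂ)‖ ≤ 1 := by
  rw [norm_mul, norm_weight, Complex.norm_real, pow_mul, norm_pow, norm_pow, Real.norm_eq_abs,
    sq_abs]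
  calc (t ^ 2) ^ j * weight (-(2 * j)) t ≤ (1 + t ^ 2) ^ j * weight (-(2 * j)) t := by
        have := (weight_pos (-(2 * j)) t).le
        gcongr
        linarith
    _ = 1 := by rw [← weight_two_mul_natCast, ← weight_add, add_neg_cancel, weight_zero]

/-- An essential bound for `f ⟨t⟩ ^ (-β)` with respect to `E` is one for each scalar measure of
`E`. -/
theorem ae_norm_le_of_mem_essBounds {β C : ℝ} (hf : Measurable f) (hC : C ∈ E.essBounds β f)
    (σ : ℝ) (x : H) :
    ∀ᵐ t ∂(E.scalar x), ‖(weight σ t : ℂ) * f t‖ ≤ C * ‖(weight (σ + β) t : ℂ)‖ := by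
  have hm : MeasurableSet {t : ℝ | C < ‖f t‖ * (1 + t ^ 2) ^ (-β / 2)} :=
    measurableSet_lt (by fun_prop) (by fun_prop)
  have h0 : E.scalar x {t : ℝ | C < ‖f t‖ * (1 + t ^ 2) ^ (-β / 2)} = 0 := by
    rw [E.scalar_apply x hm, hC.2]
    simp
  have h1 : ∀ᵐ t ∂(E.scalar x), ¬ (C < ‖f t‖ * weight (-β) t) := measure_eq_zero_iff_ae_notMem.1 h0
  filter_upwards [h1] with t ht
  rw [not_lt] at ht
  have h2 : weight (σ + β) t * weight (-β) t = weight σ t := by rw [← weight_add]; congr 1; ring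
  rw [norm_mul, norm_weight, norm_weight, ← h2]
  have := mul_le_mul_of_nonneg_left ht (weight_pos (σ + β) t).le
  linarith

theorem memLp_of_mem_essBounds {β C : ℝ} (hf : Measurable f) (hC : C ∈ E.essBounds β f) (σ : ℝ)
    (hx : E.MemWeight (σ + β) x) : MemLp (fun t => (weight σ t : ℂ) * f t) 2 (E.scalar x) :=
  MemLp.of_le_mul hx ((measurable_weight σ).mul hf).aestronglyMeasurable
    (ae_norm_le_of_mem_essBounds hf hC σ x)

theorem memLp_of_memWeight {β C : ℝ} (hf : Measurable f) (hC : C ∈ E.essBounds β f)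
    (hx : E.MemWeight β x) : MemLp f 2 (E.scalar x) := by
  have h := memLp_of_mem_essBounds hf hC 0 (by rwa [zero_add])
  simpa [weight_zero] using h

theorem memWeight_integralAt {β C : ℝ} (hf : Measurable f) (hC : C ∈ E.essBounds β f) {σ : ℝ}
    (h0 : E.MemWeight β x) (hx : E.MemWeight (σ + β) x) : E.MemWeight σ (E.integralAt hf x) :=
  (E.memLp_scalar_integralAt hf (memLp_of_memWeight hf hC h0) (measurable_weight σ)).2
    (memLp_of_mem_essBounds hf hC σ hx)

theorem norm_weightAt_integralAt_le {β C : ℝ} (hf : Measurable f) (hC : C ∈ E.essBounds β f)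
    {σ : ℝ} (h0 : E.MemWeight β x) (hx : E.MemWeight (σ + β) x) :
    ‖E.weightAt σ (E.integralAt hf x)‖ ≤ C * ‖E.weightAt (σ + β) x‖ := by
  have h := eLpNorm_le_mul_eLpNorm_of_ae_le_mul (ae_norm_le_of_mem_essBounds hf hC σ x) 2
  rw [← E.eLpNorm_scalar_integralAt hf (memLp_of_memWeight hf hC h0) (measurable_weight σ),
    ← E.enorm_integralAt (measurable_weight σ) (memWeight_integralAt hf hC h0 hx),
    ← E.enorm_integralAt (measurable_weight (σ + β)) hx, ← ofReal_norm, ← ofReal_norm,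
    ← ENNReal.ofReal_mul hC.1,
    ENNReal.ofReal_le_ofReal_iff (mul_nonneg hC.1 (norm_nonneg _))] at h
  exact h

end SpectralMeasure

/-! ### Duality between range inclusions and norm inequalities -/

namespace PositiveOperator

variable {H : Type*} [NormedAddCommGroup H] [InnerProductSpace ℂ H] [CompleteSpace H]
variable {P Q : H →L[ℂ] H} {u v : H}

/-- The identity `‖P u‖ ^ 2 = ⟪u, P (P u)⟫ = ⟪u, Q v⟫ = ⟪Q u, v⟫` turns range inclusions into norm
inequalities, and the other way round. -/
theorem sq_norm_le_of_apply_eq (hP : 0 ≤ P) (hQ : 0 ≤ Q) (h : P (P u) = Q v) :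
    ‖P u‖ ^ 2 ≤ ‖Q u‖ * ‖v‖ := by
  have h1 : ⟪P u, P u⟫_ℂ = ⟪u, P (P u)⟫_ℂ := hP.isSelfAdjoint.isSymmetric _ _
  have h2 : ⟪Q u, v⟫_ℂ = ⟪u, Q v⟫_ℂ := hQ.isSelfAdjoint.isSymmetric _ _
  rw [← inner_self_eq_norm_sq (𝕜 := ℂ), h1, h, ← h2]
  exact re_inner_le_norm _ _

theorem norm_le_of_apply_eq (hP : 0 ≤ P) (hQ : 0 ≤ Q) (h : P (P u) = Q v) {C : ℝ} (hC : 0 ≤ C)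
    (hv : ‖v‖ ≤ C * ‖P u‖) : ‖P u‖ ≤ C * ‖Q u‖ := by
  have h1 := sq_norm_le_of_apply_eq hP hQ h
  rcases (norm_nonneg (P u)).eq_or_lt with h0 | h0
  · rw [← h0]
    positivity
  · have h2 := mul_le_mul_of_nonneg_left hv (norm_nonneg (Q u))
    nlinarith

theorem norm_le_of_apply_eq' (hP : 0 ≤ P) (hQ : 0 ≤ Q) (h : P (P u) = Q v) {C : ℝ} (hC : 0 ≤ C)
    (hu : ‖Q u‖ ≤ C * ‖P u‖) : ‖P u‖ ≤ C * ‖v‖ := by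
  have h1 := sq_norm_le_of_apply_eq hP hQ h
  rcases (norm_nonneg (P u)).eq_or_lt with h0 | h0
  · rw [← h0]
    positivity
  · have h2 := mul_le_mul_of_nonneg_right hu (norm_nonneg v)
    nlinarith

end PositiveOperator

namespace Sobolev

open PositiveOperator SpectralMeasure

variable {H : Type*} [NormedAddCommGroup H] [InnerProductSpace ℂ H] [CompleteSpace H]
variable {Θ : H →ₗ.[ℂ] H} {A P : smooth Θ →ₗ[ℂ] smooth Θ} {E : SpectralMeasure H} {r : ℝ}

/-! ### Comparison of the scales of an elliptic operator and of `Θ` -/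

theorem IsOp.mono (hΘ : HasPositiveInverse Θ) {a b : ℝ} (hA : IsOp Θ a A) (hab : a ≤ b) :
    IsOp Θ b A := by
  rw [isOp_iff hΘ] at hA ⊢
  intro s
  obtain ⟨C, hC, h⟩ := hA s
  obtain ⟨C', hC', h'⟩ := exists_norm_smoothPower_le hΘ (add_le_add_right hab s)
  refine ⟨C * C', by positivity, fun x => (h x).trans ?_⟩
  rw [mul_assoc]
  exact mul_le_mul_of_nonneg_left (h' x) hC

/-- On smooth vectors `∫ t dE` is `A`. -/
theorem integralAt_ofReal (hΘ : HasPositiveInverse Θ) (hA : IsOp Θ r A)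
    (hE : E.IsSpectralMeasureOf (extensionOp Θ r A)) (x : smooth Θ) :
    MemLp (fun t : ℝ => (t : ℂ)) 2 (E.scalar x) ∧
      E.integralAt Complex.measurable_ofReal (x : H) = A x := by
  have h := mem_graph_extensionOp hΘ hA x
  have hE' : E.integral _ _ = extensionOp Θ r A := hE
  rw [← hE', LinearPMap.mem_graph_iff] at h
  obtain ⟨y, hy, hy'⟩ := h
  simp only at hy hy'
  rw [E.integral_apply, hy] at hy'
  refine ⟨?_, hy'⟩
  rw [← hy]
  exact y.2

theorem integralAt_ofReal_pow (hΘ : HasPositiveInverse Θ) (hA : IsOp Θ r A)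
    (hE : E.IsSpectralMeasureOf (extensionOp Θ r A)) (k : ℕ) (x : smooth Θ) :
    MemLp (fun t : ℝ => ((t ^ k : ℝ) : ℂ)) 2 (E.scalar x) ∧
      E.integralAt (measurable_ofReal_pow k) (x : H) = (A ^ k) x := by
  induction k generalizing x with
  | zero =>
    have e : (fun t : ℝ => ((t ^ 0 : ℝ) : ℂ)) = fun _ => 1 := by ext t; simp
    refine ⟨by rw [e]; exact memLp_const 1, ?_⟩
    rw [integralAt_congr (hg := measurable_const) e, E.integralAt_const, one_smul]
    simp
  | succ k ih =>
    obtain ⟨h1, h2⟩ := integralAt_ofReal hΘ hA hE x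
    obtain ⟨h3, h4⟩ := ih (A x)
    rw [← h2] at h3 h4
    have h5 := (E.memLp_scalar_integralAt _ h1 (measurable_ofReal_pow k)).1 h3
    have e : (fun t : ℝ => ((t ^ (k + 1) : ℝ) : ℂ)) = fun t : ℝ => ((t ^ k : ℝ) : ℂ) * (t : ℂ) := by
      ext t; push_cast; ring
    refine ⟨by rw [e]; exact h5, ?_⟩
    rw [integralAt_congr (hg := (measurable_ofReal_pow k).mul Complex.measurable_ofReal) e,
      ← E.integralAt_integralAt Complex.measurable_ofReal (measurable_ofReal_pow k) h1 h5, h4,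
      pow_succ]
    rfl

theorem weightAt_two (hΘ : HasPositiveInverse Θ) (hA : IsOp Θ r A)
    (hE : E.IsSpectralMeasureOf (extensionOp Θ r A)) (x : smooth Θ) :
    E.MemWeight 2 x ∧ E.weightAt 2 x = ((1 + A ^ 2 : Module.End ℂ (smooth Θ)) x : H) := by
  obtain ⟨h1, h2⟩ := integralAt_ofReal_pow hΘ hA hE 2 x
  have h0 : MemLp (fun _ : ℝ => (1 : ℂ)) 2 (E.scalar x) := memLp_const 1
  refine ⟨?_, ?_⟩
  · rw [MemWeight, ofReal_weight_two]
    exact h0.add h1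
  · have h3 := E.integralAt_add measurable_const (measurable_ofReal_pow 2) h0 h1
    rw [E.integralAt_const, one_smul, h2] at h3
    rw [LinearMap.add_apply, Module.End.one_apply, Submodule.coe_add, ← h3, weightAt]
    exact integralAt_congr ofReal_weight_two

/-- For even exponents the weight is a polynomial, so that `⟨T⟩ ^ (2 j)`, `T` the extension of `A`,
acts on the smooth vectors as `(1 + A ^ 2) ^ j`. -/
theorem weightAt_two_mul_natCast (hΘ : HasPositiveInverse Θ) (hA : IsOp Θ r A)
    (hE : E.IsSpectralMeasureOf (extensionOp Θ r A)) (j : ℕ) (x : smooth Θ) :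
    E.MemWeight (2 * j) x ∧
      E.weightAt (2 * j) x = (((1 + A ^ 2 : Module.End ℂ (smooth Θ)) ^ j) x : H) := by
  induction j generalizing x with
  | zero =>
    rw [Nat.cast_zero, mul_zero, weightAt_zero]
    exact ⟨memWeight_of_nonpos le_rfl _, by simp⟩
  | succ j ih =>
    obtain ⟨h3, h4⟩ := weightAt_two hΘ hA hE x
    obtain ⟨h5, h6⟩ := ih ((1 + A ^ 2 : Module.End ℂ (smooth Θ)) x)
    rw [← h4] at h5 h6
    have h7 := (memWeight_weightAt h3).1 h5
    rw [weightAt_weightAt h3 h7] at h6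
    have e2 : (2 * ((j + 1 : ℕ) : ℝ)) = 2 * j + 2 := by push_cast; ring
    rw [e2, pow_succ, Module.End.mul_apply]
    exact ⟨h7, h6⟩

theorem memWeight_coe (hΘ : HasPositiveInverse Θ) (hA : IsOp Θ r A)
    (hE : E.IsSpectralMeasureOf (extensionOp Θ r A)) (σ : ℝ) (x : smooth Θ) :
    E.MemWeight σ x := by
  obtain ⟨j, hj⟩ := exists_nat_ge (σ / 2)
  exact (weightAt_two_mul_natCast hΘ hA hE j x).1.mono (by linarith)

theorem exists_norm_weightAt_two_mul_natCast_le (hΘ : HasPositiveInverse Θ) (hr : 0 ≤ r)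
    (hA : IsOp Θ r A) (hE : E.IsSpectralMeasureOf (extensionOp Θ r A)) (j : ℕ) :
    ∃ C, 0 ≤ C ∧ ∀ x : smooth Θ, ‖E.weightAt (2 * j) x‖ ≤ C * ‖smoothPower hΘ (2 * j * r) x‖ := by
  have h1 : IsOp Θ (2 * r) (1 + A ^ 2 : Module.End ℂ (smooth Θ)) := by
    have h2 := hA.pow hΘ 2
    rw [Nat.cast_ofNat] at h2
    exact ((isOp_id hΘ).mono hΘ (by linarith)).add hΘ h2
  obtain ⟨C, hC, h⟩ := (isOp_iff hΘ).1 (h1.pow hΘ j) 0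
  refine ⟨C, hC, fun x => ?_⟩
  have h3 := h x
  rw [smoothPower_zero, zero_add, show (j : ℝ) * (2 * r) = 2 * j * r by ring] at h3
  rw [(weightAt_two_mul_natCast hΘ hA hE j x).2]
  exact h3

/-- Elliptic regularity in terms of the Bessel potentials: the range of `⟨T⟩ ^ (-2 j)`, where `T` is
the extension of `A`, is contained in the domain of `Θ ^ (2 j r)`. -/
theorem exists_rpow_eq_besselPotential (hΘ : HasPositiveInverse Θ) (hr : 0 ≤ r)
    (hA : IsOp Θ r A) (hP : IsOp Θ (-r) P) (hS : IsSmoothing Θ (A ∘ₗ P - LinearMap.id))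
    (hE : E.IsSpectralMeasureOf (extensionOp Θ r A)) (j : ℕ) :
    ∃ C, 0 ≤ C ∧ ∀ u, ∃ v, (boundedInverse Θ ^ (2 * j * r)) v = E.besselPotential (2 * j) u ∧
      ‖v‖ ≤ C * ‖u‖ := by
  have hj : (0 : ℝ) ≤ 2 * j := by positivity
  have hPj : IsOp Θ (-(2 * j * r)) (P ^ (2 * j)) := by
    have h := hP.pow hΘ (2 * j)
    rwa [mul_neg, Nat.cast_mul, Nat.cast_ofNat] at h
  obtain ⟨C, hC, h⟩ := exists_rpow_eq_of_weak_solution hΘ (by positivity) hPj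
    (isSmoothing_pow_comp_pow hΘ hA hP hS (2 * j))
  refine ⟨C * 2, by positivity, fun u => ?_⟩
  have hw : MemLp (fun t => (weight (-(2 * j)) t : ℂ)) 2 (E.scalar u) :=
    memWeight_of_nonpos (by linarith) u
  have hpw : MemLp (fun t => ((t ^ (2 * j) : ℝ) : ℂ) * (weight (-(2 * j)) t : ℂ)) 2 (E.scalar u) :=
    E.memLp_of_bounded ((measurable_ofReal_pow _).mul (measurable_weight _))
      (norm_pow_mul_weight_le j) u
  let z := E.integralAt ((measurable_ofReal_pow (2 * j)).mul (measurable_weight (-(2 * j)))) u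
  have hz : z = E.integralAt (measurable_ofReal_pow (2 * j)) (E.besselPotential (2 * j) u) := by
    rw [E.besselPotential_apply hj]
    exact (E.integralAt_integralAt _ _ hw hpw).symm
  obtain ⟨v, hv, hv'⟩ := h (E.besselPotential (2 * j) u) z fun x => by
    obtain ⟨h1, h2⟩ := integralAt_ofReal_pow hΘ hA hE (2 * j) x
    rw [hz, ← h2]
    refine E.inner_integralAt_ofReal (measurable_ofReal_pow (2 * j)) ?_ h1
    rw [E.besselPotential_apply hj]
    exact (E.memLp_scalar_integralAt _ hw (measurable_ofReal_pow (2 * j))).2 hpw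
  refine ⟨v, hv, hv'.trans ?_⟩
  have h3 : ‖z‖ ≤ 1 * ‖u‖ := E.norm_integralAt_le _ (norm_pow_mul_weight_le j) u
  have h4 := E.norm_besselPotential_le (2 * j) u
  rw [mul_assoc]
  exact mul_le_mul_of_nonneg_left (by linarith) hC

/-- The regularity of the range of `⟨T⟩ ^ (-2 j)`, dualized to a norm inequality. -/
theorem exists_norm_besselPotential_two_mul_natCast_le (hΘ : HasPositiveInverse Θ) (hr : 0 ≤ r)
    (hA : IsOp Θ r A) (hell : IsElliptic Θ r A)
    (hE : E.IsSpectralMeasureOf (extensionOp Θ r A)) (j : ℕ) :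
    ∃ C, 0 ≤ C ∧ ∀ u, ‖E.besselPotential (2 * j) u‖ ≤ C * ‖(boundedInverse Θ ^ (2 * j * r)) u‖ := by
  obtain ⟨P, hP, hS, -⟩ := hell
  obtain ⟨C, hC, h⟩ := exists_rpow_eq_besselPotential hΘ hr hA hP hS hE j
  refine ⟨C, hC, fun u => ?_⟩
  obtain ⟨v, hv, hv'⟩ := h (E.besselPotential (2 * j) u)
  exact norm_le_of_apply_eq (E.besselPotential_nonneg _) CFC.rpow_nonneg hv.symm hC hv'

/-- The converse inequality, from `(1 + A ^ 2) ^ j` being of order `2 j r`: on a smooth vector `u`,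
the vector `Θ ^ (-4 j r) u` is `⟨T⟩ ^ (-2 j)` of a vector of norm at most `C ‖Θ ^ (-2 j r) u‖`. -/
theorem exists_norm_rpow_two_mul_natCast_le (hΘ : HasPositiveInverse Θ) (hr : 0 ≤ r)
    (hA : IsOp Θ r A) (hE : E.IsSpectralMeasureOf (extensionOp Θ r A)) (j : ℕ) :
    ∃ C, 0 ≤ C ∧ ∀ u, ‖(boundedInverse Θ ^ (2 * j * r)) u‖ ≤ C * ‖E.besselPotential (2 * j) u‖ := by
  obtain ⟨C, hC, h⟩ := exists_norm_weightAt_two_mul_natCast_le hΘ hr hA hE j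
  have hj : (0 : ℝ) ≤ 2 * j * r := by positivity
  refine ⟨C, hC, isClosed_property (dense_smooth hΘ).denseRange_val
    (isClosed_le (by fun_prop) (by fun_prop)) fun u => ?_⟩
  let v : smooth Θ := smoothPower hΘ (-(2 * j * r)) (smoothPower hΘ (-(2 * j * r)) u)
  have hv : (v : H)
      = (boundedInverse Θ ^ (2 * j * r)) ((boundedInverse Θ ^ (2 * j * r)) (u : H)) := by
    rw [coe_smoothPower_neg hΘ hj, coe_smoothPower_neg hΘ hj]
  have hv' : ‖smoothPower hΘ (2 * j * r) v‖ = ‖(boundedInverse Θ ^ (2 * j * r)) (u : H)‖ := by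
    rw [← coe_smoothPower_neg hΘ hj, ← Submodule.coe_norm]
    exact congrArg norm (smoothPower_neg_cancel hΘ _ _)
  have h1 := h v
  rw [hv'] at h1
  refine norm_le_of_apply_eq CFC.rpow_nonneg (E.besselPotential_nonneg _) ?_ hC h1
  rw [E.besselPotential_weightAt (by positivity) (memWeight_coe hΘ hA hE _ v), hv]

theorem exists_interpolation_exponent {σ : ℝ} (hσ : 0 ≤ σ) :
    ∃ j : ℕ, ∃ θ ∈ Set.Icc (0 : ℝ) 1, 2 * j * θ = σ := by
  obtain ⟨j, hj⟩ := exists_nat_ge (σ / 2)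
  rcases Nat.eq_zero_or_pos j with rfl | h0
  · refine ⟨0, 0, by simp, ?_⟩
    rw [Nat.cast_zero] at hj
    linarith
  · have : (0 : ℝ) < j := Nat.cast_pos.2 h0
    refine ⟨j, σ / (2 * j), ⟨by positivity, ?_⟩, by field_simp⟩
    rw [div_le_one (by positivity)]
    linarith

theorem rpow_rpow_interpolation (hΘ : HasPositiveInverse Θ) (hr : 0 ≤ r) {a θ : ℝ} (ha : 0 ≤ a)
    (hθ : 0 ≤ θ) :
    (boundedInverse Θ ^ (a * r)) ^ θ = boundedInverse Θ ^ (a * θ * r) := by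
  rw [CFC.rpow_rpow_of_exponent_nonneg _ _ _ (mul_nonneg ha hr) hθ hΘ.nonneg]
  congr 1
  ring

/-- The Heinz inequality extends the comparison from even exponents to all `σ ≥ 0`. -/
theorem exists_norm_besselPotential_le (hΘ : HasPositiveInverse Θ) (hr : 0 ≤ r)
    (hA : IsOp Θ r A) (hell : IsElliptic Θ r A)
    (hE : E.IsSpectralMeasureOf (extensionOp Θ r A)) {σ : ℝ} (hσ : 0 ≤ σ) :
    ∃ C, 0 ≤ C ∧ ∀ u, ‖E.besselPotential σ u‖ ≤ C * ‖(boundedInverse Θ ^ (σ * r)) u‖ := by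
  obtain ⟨j, θ, hθ, rfl⟩ := exists_interpolation_exponent hσ
  have hj : (0 : ℝ) ≤ 2 * j := by positivity
  obtain ⟨C, -, h⟩ := exists_norm_besselPotential_two_mul_natCast_le hΘ hr hA hell hE j
  rw [← rpow_rpow_interpolation hΘ hr hj hθ.1, ← E.besselPotential_rpow hj hθ.1]
  exact exists_norm_rpow_le (E.besselPotential_nonneg _) CFC.rpow_nonneg h hθ

theorem exists_norm_rpow_le_besselPotential (hΘ : HasPositiveInverse Θ) (hr : 0 ≤ r)
    (hA : IsOp Θ r A) (hE : E.IsSpectralMeasureOf (extensionOp Θ r A)) {σ : ℝ} (hσ : 0 ≤ σ) :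
    ∃ C, 0 ≤ C ∧ ∀ u, ‖(boundedInverse Θ ^ (σ * r)) u‖ ≤ C * ‖E.besselPotential σ u‖ := by
  obtain ⟨j, θ, hθ, rfl⟩ := exists_interpolation_exponent hσ
  have hj : (0 : ℝ) ≤ 2 * j := by positivity
  obtain ⟨C, -, h⟩ := exists_norm_rpow_two_mul_natCast_le hΘ hr hA hE j
  rw [← rpow_rpow_interpolation hΘ hr hj hθ.1, ← E.besselPotential_rpow hj hθ.1]
  exact exists_norm_rpow_le CFC.rpow_nonneg (E.besselPotential_nonneg _) h hθ

/-- The domain of `⟨T⟩ ^ σ`, `T` the extension of `A`, is contained in that of `Θ ^ (σ r)`. -/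
theorem exists_rpow_eq_of_memWeight (hΘ : HasPositiveInverse Θ) (hr : 0 ≤ r)
    (hA : IsOp Θ r A) (hell : IsElliptic Θ r A)
    (hE : E.IsSpectralMeasureOf (extensionOp Θ r A)) {σ : ℝ} (hσ : 0 ≤ σ) :
    ∃ C, 0 ≤ C ∧ ∀ y, E.MemWeight σ y →
      ∃ w, (boundedInverse Θ ^ (σ * r)) w = y ∧ ‖w‖ ≤ C * ‖E.weightAt σ y‖ := by
  obtain ⟨C, hC, h⟩ := exists_norm_besselPotential_le hΘ hr hA hell hE hσ
  refine ⟨C, hC, fun y hy => exists_rpow_eq_of_inner_le hΘ (by positivity) (by positivity)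
    fun v => ?_⟩
  have h1 := h (smoothPower hΘ (σ * r) v)
  rw [rpow_smoothPower_self hΘ (by positivity)] at h1
  have h2 : ⟪y, (smoothPower hΘ (σ * r) v : H)⟫_ℂ
      = ⟪E.weightAt σ y, E.besselPotential σ (smoothPower hΘ (σ * r) v : H)⟫_ℂ := by
    rw [← E.inner_besselPotential, E.besselPotential_weightAt hσ hy]
  rw [h2]
  calc _ ≤ _ := norm_inner_le_norm _ _
    _ ≤ ‖E.weightAt σ y‖ * (C * ‖v‖) := mul_le_mul_of_nonneg_left h1 (norm_nonneg _)
    _ = C * ‖E.weightAt σ y‖ * ‖v‖ := by ring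

theorem mem_smooth_of_memWeight (hΘ : HasPositiveInverse Θ) (hr : 0 < r)
    (hA : IsOp Θ r A) (hell : IsElliptic Θ r A)
    (hE : E.IsSpectralMeasureOf (extensionOp Θ r A)) {y : H} (hy : ∀ σ, E.MemWeight σ y) :
    y ∈ smooth Θ := by
  refine (mem_smooth hΘ).2 fun s hs => ?_
  obtain ⟨C, -, h⟩ := exists_rpow_eq_of_memWeight hΘ hr.le hA hell hE (div_nonneg hs hr.le)
  obtain ⟨w, hw, -⟩ := h y (hy _)
  rw [div_mul_cancel₀ _ hr.ne'] at hw
  exact ⟨w, hw⟩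

/-- The norm `‖Θ ^ (σ r) x‖` is bounded by `‖⟨T⟩ ^ σ x‖`, where `T` is the extension of `A`. -/
theorem exists_norm_smoothPower_le_weightAt (hΘ : HasPositiveInverse Θ) (hr : 0 ≤ r)
    (hA : IsOp Θ r A) (hell : IsElliptic Θ r A)
    (hE : E.IsSpectralMeasureOf (extensionOp Θ r A)) (σ : ℝ) :
    ∃ C, 0 ≤ C ∧ ∀ x : smooth Θ, ‖smoothPower hΘ (σ * r) x‖ ≤ C * ‖E.weightAt σ x‖ := by
  rcases le_total 0 σ with hσ | hσ
  · obtain ⟨C, hC, h⟩ := exists_rpow_eq_of_memWeight hΘ hr hA hell hE hσ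
    refine ⟨C, hC, fun x => ?_⟩
    obtain ⟨w, hw, hw'⟩ := h x (memWeight_coe hΘ hA hE σ x)
    have e : w = smoothPower hΘ (σ * r) x := by
      refine rpow_injective hΘ.nonneg hΘ.injective (mul_nonneg hσ hr) ?_
      rw [hw, rpow_smoothPower_self hΘ (mul_nonneg hσ hr)]
    rwa [e] at hw'
  · have hσ' : 0 ≤ -σ := by linarith
    obtain ⟨C, hC, h⟩ := exists_norm_rpow_le_besselPotential hΘ hr hA hE hσ'
    refine ⟨C, hC, fun x => ?_⟩
    have h1 := h x
    rw [← coe_smoothPower_neg hΘ (mul_nonneg hσ' hr), E.besselPotential_apply hσ', neg_neg,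
      neg_mul, neg_neg] at h1
    exact h1

/-- The norm `‖⟨T⟩ ^ σ x‖`, where `T` is the extension of `A`, is bounded by `‖Θ ^ (σ r) x‖`. -/
theorem exists_norm_weightAt_le_smoothPower (hΘ : HasPositiveInverse Θ) (hr : 0 ≤ r)
    (hA : IsOp Θ r A) (hell : IsElliptic Θ r A)
    (hE : E.IsSpectralMeasureOf (extensionOp Θ r A)) (σ : ℝ) :
    ∃ C, 0 ≤ C ∧ ∀ x : smooth Θ, ‖E.weightAt σ x‖ ≤ C * ‖smoothPower hΘ (σ * r) x‖ := by
  rcases le_total 0 σ with hσ | hσ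
  · obtain ⟨C, hC, h⟩ := exists_norm_rpow_le_besselPotential hΘ hr hA hE hσ
    refine ⟨C, hC, fun x => ?_⟩
    have hx : E.weightAt σ x = E.besselPotential σ (E.weightAt (σ + σ) x) := by
      rw [E.besselPotential_apply hσ, weightAt_weightAt (memWeight_coe hΘ hA hE _ x)
        (memWeight_coe hΘ hA hE _ x)]
      congr 1
      ring
    rw [hx]
    refine norm_le_of_apply_eq' (E.besselPotential_nonneg σ) CFC.rpow_nonneg ?_ hC (h _)
    rw [← hx, E.besselPotential_weightAt hσ (memWeight_coe hΘ hA hE σ x)]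
    exact (rpow_smoothPower_self hΘ (mul_nonneg hσ hr) x).symm
  · have hσ' : 0 ≤ -σ := by linarith
    obtain ⟨C, hC, h⟩ := exists_norm_besselPotential_le hΘ hr hA hell hE hσ'
    refine ⟨C, hC, fun x => ?_⟩
    have h1 := h x
    rw [← coe_smoothPower_neg hΘ (mul_nonneg hσ' hr), E.besselPotential_apply hσ', neg_neg,
      neg_mul, neg_neg] at h1
    exact h1

/-! ### The functional calculus of an elliptic operator -/

/-- The restriction of `∫ f dE` to the smooth vectors, for `f` in `L^β_∞(E)`, is an operator on the
smooth vectors, bounded from `H^(s + β r)(Θ)` to `H^s(Θ)` by a multiple of each essential bound. -/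
theorem exists_restrictsTo_integral (hΘ : HasPositiveInverse Θ) (hr : 0 < r)
    (hA : IsOp Θ r A) (hell : IsElliptic Θ r A)
    (hE : E.IsSpectralMeasureOf (extensionOp Θ r A)) (β : ℝ) :
    ∃ C : ℝ → ℝ, (∀ s, 0 ≤ C s) ∧ ∀ (f : ℝ → ℂ) (hf : Measurable f), E.MemLinfty β f →
      ∃ F : smooth Θ →ₗ[ℂ] smooth Θ, RestrictsTo Θ (E.integral f hf) F ∧
        ∀ s, ∀ M ∈ E.essBounds β f, ∀ x,
          ‖smoothPower hΘ s (F x)‖ ≤ C s * M * ‖smoothPower hΘ (s + β * r) x‖ := by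
  -- `⟨T⟩ ^ (s / r)` corresponds to `Θ ^ s`, and multiplying by `f` costs the weight `⟨T⟩ ^ β`.
  choose C₁ hC₁ h₁ using exists_norm_smoothPower_le_weightAt hΘ hr.le hA hell hE
  choose C₂ hC₂ h₂ using exists_norm_weightAt_le_smoothPower hΘ hr.le hA hell hE
  refine ⟨fun s => C₁ (s / r) * C₂ (s / r + β), fun s => mul_nonneg (hC₁ _) (hC₂ _),
    fun f hf ⟨N, hN⟩ => ?_⟩
  have hw : ∀ (σ : ℝ) (x : smooth Θ), E.MemWeight σ (x : H) := memWeight_coe hΘ hA hE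
  have hdom : smooth Θ ≤ (E.integral f hf).domain := fun x hx =>
    memLp_of_memWeight hf hN (hw β ⟨x, hx⟩)
  let F : smooth Θ →ₗ[ℂ] smooth Θ :=
    ((E.integral f hf).toFun ∘ₗ Submodule.inclusion hdom).codRestrict (smooth Θ) fun x =>
      mem_smooth_of_memWeight hΘ hr hA hell hE fun σ =>
        memWeight_integralAt hf hN (hw _ x) (hw _ x)
  have hF : ∀ x, (F x : H) = E.integralAt hf (x : H) := fun x => rfl
  refine ⟨F, fun x => ⟨hdom x.2, rfl⟩, fun s M hM x => ?_⟩
  have e₁ : s / r * r = s := div_mul_cancel₀ _ hr.ne'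
  have e₂ : (s / r + β) * r = s + β * r := by rw [add_mul, e₁]
  have b₁ := h₁ (s / r) (F x)
  have b₂ := h₂ (s / r + β) x
  have b₃ := norm_weightAt_integralAt_le hf hM (hw β x) (hw (s / r + β) x)
  rw [e₁, hF] at b₁
  rw [e₂] at b₂
  calc _ ≤ _ := b₁
    _ ≤ C₁ (s / r) * (M * (C₂ (s / r + β) * ‖smoothPower hΘ (s + β * r) x‖)) :=
      mul_le_mul_of_nonneg_left (b₃.trans (mul_le_mul_of_nonneg_left b₂ hM.1)) (hC₁ _)
    _ = _ := by ring

end Sobolev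

end

theorem theoremT {H : Type*} [NormedAddCommGroup H] [InnerProductSpace ℂ H] [CompleteSpace H]
    [TopologicalSpace.SeparableSpace H]
    (Θ : H →ₗ.[ℂ] H) (hΘ : IsSelfAdjoint Θ) (hpos : ∀ x : Θ.domain, 0 ≤ (⟪Θ x, (x : H)⟫_ℂ).re)
    (hinv : Function.Bijective Θ)
    (r : ℝ) (hr : 0 < r) (A : Sobolev.smooth Θ →ₗ[ℂ] Sobolev.smooth Θ)
    (hA : Sobolev.IsOp Θ r A) (hell : Sobolev.IsElliptic Θ r A) (hsym : A.IsSymmetric) :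
    IsSelfAdjoint (Sobolev.extensionOp Θ r A) ∧
    (∃ E : SpectralMeasure H, E.IsSpectralMeasureOf (Sobolev.extensionOp Θ r A)) ∧
    ∀ E : SpectralMeasure H, E.IsSpectralMeasureOf (Sobolev.extensionOp Θ r A) →
      ∀ β : ℝ, ∃ C : ℝ → ℝ, ∀ (f : ℝ → ℂ) (hf : Measurable f), E.MemLinfty β f →
        ∃ F : Sobolev.smooth Θ →ₗ[ℂ] Sobolev.smooth Θ,
          Sobolev.RestrictsTo Θ (E.integral f hf) F ∧ Sobolev.IsOp Θ (β * r) F ∧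
          ∀ (s : ℝ) (T : Sobolev.Space Θ (s + β * r) →L[ℂ] Sobolev.Space Θ s),
            Sobolev.Extends Θ T F → ‖T‖ ≤ C s * E.linftyNorm β f := by
  have h := Sobolev.hasPositiveInverse hΘ hpos hinv
  have hsa := Sobolev.isSelfAdjoint_extensionOp h hr.le hA hell hsym
  refine ⟨hsa, SelfAdjointOperator.exists_spectralMeasure hsa, fun E hE β => ?_⟩
  obtain ⟨C, hC, hC'⟩ := Sobolev.exists_restrictsTo_integral h hr hA hell hE β
  refine ⟨C, fun f hf hfβ => ?_⟩
  obtain ⟨F, hF, hF'⟩ := hC' f hf hfβ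
  refine ⟨F, hF, (Sobolev.isOp_iff h).2 fun s => ?_, fun s T hT => ?_⟩
  · obtain ⟨M, hM⟩ := hfβ
    exact ⟨C s * M, mul_nonneg (hC s) hM.1, hF' s M hM⟩
  · -- `‖T‖ ≤ C s * M` for every essential bound `M`, and `linftyNorm` is their infimum.
    refine le_of_le_of_eq (le_csInf (Set.Nonempty.smul_set (a := C s) hfβ) ?_)
      (Real.sInf_smul_of_nonneg (hC s) _)
    rintro _ ⟨M, hM, rfl⟩
    exact Sobolev.norm_le_of_extends h (mul_nonneg (hC s) hM.1) hT (hF' s M hM)
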